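/- **Notation.** $\mathcal M$ is the set of matrices $A=(a_{ij})_{i,j\ge 1}$ with non-negative integer entries and finite support; $\mathrm{supp}(A)=\{(i,j): a_{ij}\neq 0\}$. The rows are labelled by letters $-1^\vee<-2^\vee<\cdots$ and the columns by $1<2<\cdots$. For a partition $\nu$, $\nu^\pi$ is its diagram rotated by $180^\circ$ and $\ell(\nu)$ its number of parts; semistandard tableaux have weakly increasing rows and columns strictly increasing downwards. $\mathcal T$ is the set of pairs $(S,T)$ of semistandard tableaux of a common shape $\nu^\pi$, $S$ in the letters $-i^\vee$ and $T$ in the letters $j$. *The map $\kappa$.* $U\leftarrow a$ is the column insertion starting at the right-most column: the largest entry $a'\le a$ of the column is replaced by $a$ and $a'$ is inserted in the next column to the left; if there is no such entry, $a$ is put on top of the column. A word is inserted letter by letter. List the positions of $A$ with multiplicity as $(i_1,j_1),\dots,(i_r,j_r)$ with $j$ weakly increasing and, for equal $j$, $i$ weakly decreasing; and as $(k_1,l_1),\dots,(k_r,l_r)$ with $k$ weakly increasing and, for equal $k$, $l$ weakly decreasing. Then $\kappa(A)=(\mathbf P,\mathbf Q)$ where $\mathbf P$ is the insertion of $-i_r^\vee\cdots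 -i_1^\vee$ and $\mathbf Q$ that of $l_r\cdots l_1$. *Crystal operators.* A word is a tensor product of its letters, with the rule $\tilde e_i(b_1\otimes b_2)=\tilde e_ib_1\otimes b_2$ if $\varphi_i(b_1)\ge\varepsilon_i(b_2)$ and $b_1\otimes\tilde e_ib_2$ otherwise, and $\tilde f_i(b_1\otimes b_2)=\tilde f_ib_1\otimes b_2$ if $\varphi_i(b_1)>\varepsilon_i(b_2)$ and $b_1\otimes\tilde f_ib_2$ otherwise; on letters, for $i>0$, $\tilde f_i$ maps $i$ to $i+1$ and $\tilde f_{-i}$ maps $-i^\vee$ to $-(i+1)^\vee$. On $\mathcal M$, $\tilde e_i,\tilde f_i$ act for $i<0$ on the word $-i_1^\vee\cdots -i_r^\vee$ (keeping $j_1\cdots j_r$), for $i>0$ on the word $l_1\cdots l_r$ (keeping $k_1\cdots k_r$), $\tilde f_0$ adds $1$ to $a_{11}$, and $\tilde e_0$ subtracts $1$ from $a_{11}$ (giving $\mathbf 0$ if $a_{11}=0$). On $\mathcal T$, $\tilde e_i$ acts for $i<0$ on $S$ and for $i>0$ on $T$, through the words obtained by reading the rows from top to bottom, each from right to left. For $\tilde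 e_0$, give each column the sign $-$ if its top entries in $S$ and $T$ are $-1^\vee$ and $1$, the sign $+$ if neither is, and no sign otherwise; cancel repeatedly pairs consisting of a $-$ and the next remaining sign to its right when that is a $+$; then $\tilde e_0(S,T)$ is obtained by removing the top boxes of both tableaux in the column of the left-most remaining $-$ (and is $\mathbf 0$ if there is none). *Permutations.* $W$ is the group of permutations of $\mathbb Z\setminus\{0\}$ generated by $s_i=(i\ i{+}1)$ $(i>0)$, $s_i=(i{-}1\ i)$ $(i<0)$ and $s_0=(-1\ 1)$, with its length function $\ell$ and Bruhat order $\le$; $W^{\Lambda_0}=\{w\in W:\ell(ws_i)>\ell(w)\text{ for all } i\ne 0\}$. For $w\in W^{\Lambda_0}$, $\lambda(w)$ is the partition with parts $\lambda(w)_i=|\{j: -i<w^{-1}(j),\ j<w(-i)\}|$; this is a bijection of $W^{\Lambda_0}$ onto the set of partitions. Write $\lambda=(\alpha_1,\dots,\alpha_d\,|\,\beta_1,\dots,\beta_d)$ if $\lambda$ has $d$ diagonal boxes and $\alpha_k=\lambda'_k-k+1$, $\beta_k=\lambda_k-k+1$; for $\lambda=\lambda(w)$ put $d(w)=d$, $\alpha(w)=(\alpha_1,\dots,\alpha_d)$,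 $\beta(w)=(\beta_1,\dots,\beta_d)$, and let $\phi(w)$, $\psi(w)$ be the reversed sequences of $\alpha(w)$, $\beta(w)$. For a word $s_{i_1}\cdots s_{i_r}$ that is a reduced expression of $w$, let $\mathcal M_w=\{\tilde f_{i_1}^{m_1}\cdots\tilde f_{i_r}^{m_r}\mathbb O: m_1,\dots,m_r\ge 0\}\setminus\{\mathbf 0\}$, where $\mathbb O$ is the zero matrix. *Supports.* For a finite set $S\subset\mathbb N^2$ (with $\mathbb N=\{1,2,\dots\}$) let $\theta(S)$ be the set of boxes $(i,j)$ of the smallest partition $\lambda\supset S$ with $(i+1,j+1)\notin\lambda$, and $c(S)$ the pair (number of rows of $\lambda$, number of columns of $\lambda$). Put $S^{(1)}=S$, $S^{(k+1)}=S^{(k)}\setminus\theta(S^{(k)})$, $(\alpha_k,\beta_k)=c(S^{(k)})$ as long as $S^{(k)}\ne\emptyset$, and $\lambda(S)=(\alpha_1,\dots,\alpha_d\,|\,\beta_1,\dots,\beta_d)$. Let $w(S)\in W^{\Lambda_0}$ be the element with $\lambda(w(S))=\lambda(S)$. *Flags.* For a flag $\phi=(\phi_1\le\dots\le\phi_d)$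 and $\ell(\nu)\le d$, $SST_{\mathbf B^\vee_{<0}}(\nu^\pi)_\phi$ (resp. $SST_{\mathbf B_{>0}}(\nu^\pi)_\phi$) is the set of semistandard tableaux of shape $\nu^\pi$ in the letters $-i^\vee$ (resp. $j$) whose entries in the $i$-th row from the bottom are at most $-\phi_{d-i+1}^\vee$ (resp. $\phi_{d-i+1}$). For $\alpha=(\alpha_1,\dots,\alpha_d)$ put $\widehat s_\nu(X_\alpha)=\det\bigl(h_{\nu_i-i+j}(x_1,\dots,x_{\alpha_j})\bigr)_{1\le i,j\le d}$, with $h_k$ the complete symmetric function ($h_k=0$ for $k<0$), and similarly $\widehat s_\nu(Y_\beta)$ in the variables $y_j$. **Statement.** Let $w\in W^{\Lambda_0}$. 1. For every reduced expression of $w$, $\mathcal M_w=\{A\in\mathcal M:\lambda(\mathrm{supp}\,A)\subseteq\lambda(w)\}$. 2. $\kappa$ restricts to a bijection $$\{A\in\mathcal M:\lambda(\mathrm{supp}\,A)\subseteq\lambda(w)\}\longrightarrow\bigsqcup_{\ell(\nu)\le d(w)}SST_{\mathbf B^\vee_{<0}}(\nu^\pi)_{\phi(w)}\times SST_{\mathbf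 B_{>0}}(\nu^\pi)_{\psi(w)} .$$ 3. For all $i\in\mathbb Z$ and all $A$ in the set on the left, $\tilde e_iA$ is $\mathbf 0$ or lies in that set again, and $\kappa(\tilde e_iA)=\tilde e_i\kappa(A)$ (with $\kappa(\mathbf 0)=\mathbf 0$). 4. As formal power series with integer coefficients in $x_1,x_2,\dots,y_1,y_2,\dots$ (both sums converging coefficientwise), $$\sum_{\substack{S\subset\mathbb N^2\text{ finite}\\ w(S)\le w}}\ \prod_{(i,j)\in S}\frac{x_iy_j}{1-x_iy_j}=\sum_{\ell(\nu)\le d(w)}\widehat s_\nu(X_{\alpha(w)})\,\widehat s_\nu(Y_{\beta(w)}).$$ -/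

import Mathlib

/-!
# Matrices, bitableaux, Grassmannian permutations and flagged Schur functions

Conventions.  The index sets `{1, 2, 3, ...}` are modelled by `ℕ`, with `k : ℕ` standing for `k + 1`:
* the letter `k` of a word or tableau is `k + 1` of the crystal `B_{>0}`, or `-(k + 1)^∨` of the
  crystal `B_{<0}^∨`.  Both crystals are linearly ordered like `ℕ`
  (`1 < 2 < ⋯` and `-1^∨ < -2^∨ < ⋯`);
* the position `(i, j)` of a matrix is row `-(i + 1)^∨`, column `j + 1`;
* rows and columns of diagrams are counted from `0`.
The formal symbol `0` of a crystal is `none`.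
-/

namespace FlaggedRSK

/-! ## Crystals of words -/

/-- `ε` of a letter.  The colour `c : ℕ` stands for the operator with index `c + 1` on `B_{>0}`, and
for the operator with index `-(c + 1)` on `B_{<0}^∨`; in both crystals the only arrow of this
colour goes from the letter `c` to the letter `c + 1`. -/
def letterEps (c x : ℕ) : ℤ := if x = c + 1 then 1 else 0

/-- `φ` of a letter. -/
def letterPhi (c x : ℕ) : ℤ := if x = c then 1 else 0

/-- `⟨wt x, h⟩ = φ x - ε x` for a letter `x`. -/
def letterWt (c x : ℕ) : ℤ := letterPhi c x - letterEps c x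

/-- `ε` of the word `x₁ x₂ ⋯ = x₁ ⊗ (x₂ ⊗ ⋯)` by the tensor product rule. -/
def wordEps (c : ℕ) : List ℕ → ℤ
  | [] => 0
  | x :: u => max (letterEps c x) (wordEps c u - letterWt c x)

/-- The raising operator on words, by the tensor product rule
`e (b₁ ⊗ b₂) = e b₁ ⊗ b₂` if `ε b₂ ≤ φ b₁`, and `b₁ ⊗ e b₂` otherwise. -/
def wordE (c : ℕ) : List ℕ → Option (List ℕ)
  | [] => none
  | x :: u =>
      if wordEps c u ≤ letterPhi c x then (if x = c + 1 then some (c :: u) else none)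
      else (wordE c u).map (fun v => x :: v)

/-- The lowering operator on words, by the tensor product rule
`f (b₁ ⊗ b₂) = f b₁ ⊗ b₂` if `ε b₂ < φ b₁`, and `b₁ ⊗ f b₂` otherwise. -/
def wordF (c : ℕ) : List ℕ → Option (List ℕ)
  | [] => none
  | x :: u =>
      if wordEps c u < letterPhi c x then (if x = c then some ((c + 1) :: u) else none)
      else (wordF c u).map (fun v => x :: v)

/-! ## The crystal of matrices -/

/-- `ℕ × ℕ` matrices with nonnegative integer entries and finite support. -/
abbrev Mat : Type := (ℕ × ℕ) →₀ ℕ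

/-- The order of the biwords in `Ω`: `(i, j) < (k, l)` iff `j < l`, or `j = l` and `i > k`. -/
def omegaLE (p q : ℕ × ℕ) : Prop := p.2 < q.2 ∨ (p.2 = q.2 ∧ q.1 ≤ p.1)

/-- The order of the biwords in `Ω'`: `(i, j) <' (k, l)` iff `i < k`, or `i = k` and `j > l`. -/
def omegaLE' (p q : ℕ × ℕ) : Prop := p.1 < q.1 ∨ (p.1 = q.1 ∧ q.2 ≤ p.2)

instance : DecidableRel omegaLE := fun p q => by unfold omegaLE; infer_instance
instance : DecidableRel omegaLE' := fun p q => by unfold omegaLE'; infer_instance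
instance : IsTrans (ℕ × ℕ) omegaLE := ⟨fun _ _ _ h h' => by unfold omegaLE at *; omega⟩
instance : IsTrans (ℕ × ℕ) omegaLE' := ⟨fun _ _ _ h h' => by unfold omegaLE' at *; omega⟩
instance : Std.Antisymm omegaLE :=
  ⟨fun a b h h' => by unfold omegaLE at *; ext <;> omega⟩
instance : Std.Antisymm omegaLE' :=
  ⟨fun a b h h' => by unfold omegaLE' at *; ext <;> omega⟩
instance : Std.Total omegaLE := ⟨fun _ _ => by unfold omegaLE; omega⟩
instance : Std.Total omegaLE' := ⟨fun _ _ => by unfold omegaLE'; omega⟩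

/-- The biword in `Ω` of a matrix: position `(i, j)` is repeated as often as the entry says. -/
noncomputable def biword (A : Mat) : List (ℕ × ℕ) := (Finsupp.toMultiset A).sort omegaLE

/-- The biword in `Ω'` of a matrix. -/
noncomputable def biword' (A : Mat) : List (ℕ × ℕ) := (Finsupp.toMultiset A).sort omegaLE'

/-- The matrix `A(i, j)` of a biword: the entry at `p` is the number of occurrences of `p`. -/
noncomputable def ofBiword (l : List (ℕ × ℕ)) : Mat := Multiset.toFinsupp (l : Multiset (ℕ × ℕ))

/-- A word operator acting on the row indices of a matrix, through `Ω`. -/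
noncomputable def actRows (op : List ℕ → Option (List ℕ)) (A : Mat) : Option Mat :=
  (op ((biword A).map Prod.fst)).map (fun u => ofBiword (u.zip ((biword A).map Prod.snd)))

/-- A word operator acting on the column indices of a matrix, through `Ω'`. -/
noncomputable def actCols (op : List ℕ → Option (List ℕ)) (A : Mat) : Option Mat :=
  (op ((biword' A).map Prod.snd)).map (fun u => ofBiword (((biword' A).map Prod.fst).zip u))

/-- The operator `ẽ_i` (`i ∈ ℤ`) on matrices. -/
noncomputable def matE : ℤ → Mat → Option Mat
  | Int.negSucc c, A => actRows (wordE c) A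
  | Int.ofNat 0, A => if A (0, 0) = 0 then none else some (A - Finsupp.single (0, 0) 1)
  | Int.ofNat (c + 1), A => actCols (wordE c) A

/-- The operator `f̃_i` (`i ∈ ℤ`) on matrices. -/
noncomputable def matF : ℤ → Mat → Option Mat
  | Int.negSucc c, A => actRows (wordF c) A
  | Int.ofNat 0, A => some (A + Finsupp.single (0, 0) 1)
  | Int.ofNat (c + 1), A => actCols (wordF c) A

/-- For the word `i₁ ⋯ i_r`, the set of all matrices `f̃_{i₁}^{m₁} ⋯ f̃_{i_r}^{m_r} 𝕆` with
`m₁, …, m_r ≥ 0`, where `𝕆` is the zero matrix. -/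
def demazure : List ℤ → Set Mat
  | [] => {0}
  | i :: l => {B | ∃ A ∈ demazure l, ∃ m : ℕ, (fun o => o.bind (matF i))^[m] (some A) = some B}

/-! ## Tableaux of anti-normal shape -/

/-- A filling of a diagram `ν^π` (`ν` rotated by 180 degrees), as the list of its columns from right
to left, each column being the list of its entries from bottom to top. -/
abbrev Tab : Type := List (List ℕ)

/-- `T` is a semistandard tableau of shape `ν^π`: its columns have the lengths of those of `ν`, are
strictly increasing from top to bottom, and its rows are weakly increasing from left to right.
The entry `x` is in row `i` from the bottom and column `j` from the right if `T[j][i] = x`. -/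
def IsSST (ν : YoungDiagram) (T : Tab) : Prop :=
  T.map List.length = ν.transpose.rowLens ∧
  (∀ c ∈ T, c.Pairwise (· > ·)) ∧
  ∀ i j : ℕ, ∀ col col' : List ℕ, ∀ x x' : ℕ,
    T[j]? = some col → T[j + 1]? = some col' → col[i]? = some x → col'[i]? = some x' → x' ≤ x

/-- Column insertion of `a` into a column: the largest entry `a' ≤ a` is replaced by `a` and
returned; if there is none, `a` is put on top.  (As the entries decrease from bottom to top, the
largest entry `≤ a` is the first one met.) -/
def colInsert (a : ℕ) : List ℕ → List ℕ × Option ℕ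
  | [] => ([a], none)
  | x :: c =>
      if x ≤ a then (a :: c, some x)
      else (x :: (colInsert a c).1, (colInsert a c).2)

/-- The insertion `T ← a`, starting at the right-most column. -/
def tabInsert : Tab → ℕ → Tab
  | [], a => [[a]]
  | c :: T, a =>
      match colInsert a c with
      | (c', none) => c' :: T
      | (c', some b) => c' :: tabInsert T b

/-- `P(w) = (⋯((w₁ ← w₂) ← w₃)⋯) ← w_r`. -/
def insertWord (u : List ℕ) : Tab := u.foldl tabInsert []

/-- The map `κ(A) = (P(A), Q(A))`: with `A = A(i, j) = A(k, l)`, `(i, j) ∈ Ω`, `(k, l) ∈ Ω'`,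
`P(A)` and `Q(A)` are obtained by inserting the reversed words of `i` and of `l`. -/
noncomputable def kappa (A : Mat) : Tab × Tab :=
  (insertWord ((biword A).map Prod.fst).reverse, insertWord ((biword' A).map Prod.snd).reverse)

/-- The boxes (row from the bottom, column from the right) of a tableau in reading order: row by row
from top to bottom, each row from right to left. -/
def boxes (T : Tab) : List (ℕ × ℕ) :=
  (List.range (T.headD []).length).reverse.flatMap fun i =>
    ((List.range T.length).filter fun j => i < (T.getD j []).length).map fun j => (i, j)

/-- The reading word `w(T)`. -/
def readingWord (T : Tab) : List ℕ := (boxes T).map fun p => (T.getD p.2 []).getD p.1 0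

/-- The tableau of the same shape as `T` with reading word `u`. -/
def refill (T : Tab) (u : List ℕ) : Tab :=
  T.mapIdx fun j c => c.mapIdx fun i _ => u.getD ((boxes T).idxOf (i, j)) 0

/-- The raising operator on tableaux, through reading words. -/
def tabE (c : ℕ) (T : Tab) : Option Tab := (wordE c (readingWord T)).map (refill T)

/-- The uncancelled signs (`true` for `+`, `false` for `-`) with their column numbers, listed from
left to right.  The columns are given from right to left, starting with number `k`, as pairs (column
of `S`, column of `T`), and `acc` lists the signs that are uncancelled so far.
A column has sign `-` if `-1^∨` and `1` are the topmost (that is, smallest) entries, `+` if neither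
is, and no sign otherwise; a `-` cancels with the nearest uncancelled sign to its right if that is
a `+`.  The empty columns further left, all of sign `+`, take no part in the cancellation and are
left out. -/
def signature : ℕ → List (List ℕ × List ℕ) → List (Bool × ℕ) → List (Bool × ℕ)
  | _, [], acc => acc
  | k, (c, c') :: l, acc =>
      if c.getLast? = some 0 ∧ c'.getLast? = some 0 then
        match acc with
        | (true, _) :: acc' => signature (k + 1) l acc'
        | acc' => signature (k + 1) l ((false, k) :: acc')
      else if c.getLast? ≠ some 0 ∧ c'.getLast? ≠ some 0 then
        signature (k + 1) l ((true, k) :: acc)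
      else signature (k + 1) l acc

/-- Removal of the top box of column `k` (from the right). -/
def removeTop (k : ℕ) (T : Tab) : Tab := (T.modify k List.dropLast).filter fun c => c ≠ []

/-- The operator `ẽ_0` on bitableaux: the top boxes are removed in the column of the left-most `-`
of the `0`-signature. -/
def bitabE0 (p : Tab × Tab) : Option (Tab × Tab) :=
  ((signature 0 (p.1.zip p.2) []).find? fun s => s.1 = false).map fun s =>
    (removeTop s.2 p.1, removeTop s.2 p.2)

/-- The operator `ẽ_i` (`i ∈ ℤ`) on bitableaux. -/
def bitabE : ℤ → Tab × Tab → Option (Tab × Tab)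
  | Int.negSucc c, p => (tabE c p.1).map fun S => (S, p.2)
  | Int.ofNat 0, p => bitabE0 p
  | Int.ofNat (c + 1), p => (tabE c p.2).map fun T => (p.1, T)

/-- `SST(ν^π)_φ` for a flag `φ` of length `d`: the entries in row `i` from the bottom are at most
`φ_{d - i + 1}` (here with `i` counted from `1`; letters are shifted by one, whence `<`). -/
def flaggedSST (ν : YoungDiagram) {d : ℕ} (φ : Fin d → ℕ) : Set Tab :=
  {T | IsSST ν T ∧ ∀ i : Fin d, ∀ col ∈ T, ∀ x : ℕ, col[(i : ℕ)]? = some x → x < φ i.rev}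

/-- The union of `SST(ν^π)_φ × SST(ν^π)_ψ` over all partitions `ν` with at most `d` parts. -/
def flaggedBitableaux {d : ℕ} (φ ψ : Fin d → ℕ) : Set (Tab × Tab) :=
  ⋃ ν ∈ {ν : YoungDiagram | ν.colLen 0 ≤ d}, flaggedSST ν φ ×ˢ flaggedSST ν ψ

/-! ## Frobenius notation and the partition of a support -/

/-- The diagonal length of a partition. -/
def diagLen (μ : YoungDiagram) : ℕ := (μ.cells.filter fun p => p.1 = p.2).card

/-- The lower Frobenius coordinates `α` of `μ = (α | β)`: the number of boxes in column `k` on or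
below the diagonal. -/
def frobLower (μ : YoungDiagram) (k : Fin (diagLen μ)) : ℕ := μ.colLen k - k

/-- The upper Frobenius coordinates `β` of `μ = (α | β)`: the number of boxes in row `k` on or to
the right of the diagonal. -/
def frobUpper (μ : YoungDiagram) (k : Fin (diagLen μ)) : ℕ := μ.rowLen k - k

/-- The smallest partition containing the finite set `S`. -/
def hull (S : Finset (ℕ × ℕ)) : YoungDiagram where
  cells := S.biUnion fun p => Finset.Iic p
  isLowerSet := by
    intro a b hba ha
    simp only [Finset.coe_biUnion, Finset.coe_Iic, Set.mem_iUnion, Set.mem_Iic] at ha ⊢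
    obtain ⟨p, hp, hap⟩ := ha
    exact ⟨p, hp, hba.trans hap⟩

theorem mem_hull {S : Finset (ℕ × ℕ)} {a : ℕ × ℕ} : a ∈ hull S ↔ ∃ p ∈ S, a ≤ p := by
  rw [← YoungDiagram.mem_cells]; simp [hull]

/-- The border strip `θ(S)` of the smallest partition containing `S`: the boxes `(i, j)` such that
`(i + 1, j + 1)` is not a box. -/
def borderStrip (S : Finset (ℕ × ℕ)) : Finset (ℕ × ℕ) :=
  (hull S).cells.filter fun p => (p.1 + 1, p.2 + 1) ∉ hull S

/-- `c(S)`: the numbers of rows and of columns of the smallest partition containing `S`, which are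
its first Frobenius coordinates. -/
def corner (S : Finset (ℕ × ℕ)) : ℕ × ℕ := ((hull S).colLen 0, (hull S).rowLen 0)

theorem card_sdiff_borderStrip_lt {S : Finset (ℕ × ℕ)} (h : S.Nonempty) :
    (S \ borderStrip S).card < S.card := by
  obtain ⟨p, hp, hmax⟩ := S.exists_max_image Prod.fst h
  apply Finset.card_lt_card
  refine Finset.ssubset_iff_of_subset Finset.sdiff_subset |>.2 ⟨p, hp, ?_⟩
  simp only [Finset.mem_sdiff, not_and, not_not]
  intro _
  simp only [borderStrip, Finset.mem_filter, YoungDiagram.mem_cells]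
  refine ⟨mem_hull.2 ⟨p, hp, le_rfl⟩, fun hc => ?_⟩
  obtain ⟨q, hq, hle⟩ := mem_hull.1 hc
  have h1 := hle.1
  have h2 := hmax q hq
  simp only at h1
  omega

/-- The points `c₁, …, c_d` of `S`, where `S^{(1)} = S` and
`S^{(k+1)} = S^{(k)} \ θ(S^{(k)})` as long as this is nonempty. -/
def corners (S : Finset (ℕ × ℕ)) : List (ℕ × ℕ) :=
  if h : S.Nonempty then corner S :: corners (S \ borderStrip S) else []
termination_by S.card
decreasing_by exact card_sdiff_borderStrip_lt h

theorem corner_sdiff_lt {S : Finset (ℕ × ℕ)} (h : (S \ borderStrip S).Nonempty) :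
    (corner (S \ borderStrip S)).1 < (corner S).1 ∧
      (corner (S \ borderStrip S)).2 < (corner S).2 := by
  have key : ∀ q ∈ S \ borderStrip S, (q.1 + 1, q.2 + 1) ∈ hull S := by
    intro q hq
    simp only [borderStrip, Finset.mem_sdiff, Finset.mem_filter, YoungDiagram.mem_cells] at hq
    by_contra hn
    exact hq.2 ⟨mem_hull.2 ⟨q, hq.1, le_rfl⟩, hn⟩
  obtain ⟨r, hr⟩ := h
  have hr' := key r hr
  constructor
  · simp only [corner]
    rcases Nat.eq_zero_or_pos ((hull (S \ borderStrip S)).colLen 0) with h0 | h0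
    · rw [h0, ← YoungDiagram.mem_iff_lt_colLen]
      exact (hull S).isLowerSet (show ((0, 0) : ℕ × ℕ) ≤ _ from ⟨by simp, by simp⟩) hr'
    · obtain ⟨n, hn⟩ := Nat.exists_eq_succ_of_ne_zero h0.ne'
      have hm : (n, 0) ∈ hull (S \ borderStrip S) := by
        rw [YoungDiagram.mem_iff_lt_colLen]; omega
      obtain ⟨q, hq, hle⟩ := mem_hull.1 hm
      rw [hn, ← YoungDiagram.mem_iff_lt_colLen]
      exact (hull S).isLowerSet
        (show ((n + 1, 0) : ℕ × ℕ) ≤ _ from ⟨Nat.succ_le_succ hle.1, by simp⟩) (key q hq)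
  · simp only [corner]
    rcases Nat.eq_zero_or_pos ((hull (S \ borderStrip S)).rowLen 0) with h0 | h0
    · rw [h0, ← YoungDiagram.mem_iff_lt_rowLen]
      exact (hull S).isLowerSet (show ((0, 0) : ℕ × ℕ) ≤ _ from ⟨by simp, by simp⟩) hr'
    · obtain ⟨n, hn⟩ := Nat.exists_eq_succ_of_ne_zero h0.ne'
      have hm : (0, n) ∈ hull (S \ borderStrip S) := by
        rw [YoungDiagram.mem_iff_lt_rowLen]; omega
      obtain ⟨q, hq, hle⟩ := mem_hull.1 hm
      rw [hn, ← YoungDiagram.mem_iff_lt_rowLen]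
      exact (hull S).isLowerSet
        (show ((0, n + 1) : ℕ × ℕ) ≤ _ from ⟨by simp, Nat.succ_le_succ hle.2⟩) (key q hq)

theorem corner_pos {S : Finset (ℕ × ℕ)} (h : S.Nonempty) :
    0 < (corner S).1 ∧ 0 < (corner S).2 := by
  obtain ⟨p, hp⟩ := h
  have h0 : ((0, 0) : ℕ × ℕ) ∈ hull S := mem_hull.2 ⟨p, hp, ⟨by simp, by simp⟩⟩
  exact ⟨YoungDiagram.mem_iff_lt_colLen.1 h0, YoungDiagram.mem_iff_lt_rowLen.1 h0⟩

theorem corners_mem {S : Finset (ℕ × ℕ)} : ∀ q ∈ corners S,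
    (0 < q.1 ∧ 0 < q.2) ∧ q.1 ≤ (corner S).1 ∧ q.2 ≤ (corner S).2 := by
  intro q hq
  rw [corners] at hq
  split_ifs at hq with h
  · rcases List.mem_cons.1 hq with rfl | hq
    · exact ⟨corner_pos h, le_rfl, le_rfl⟩
    · have ih := corners_mem q hq
      have hne : (S \ borderStrip S).Nonempty := by
        by_contra hne
        rw [corners, dif_neg hne] at hq
        simp at hq
      have := corner_sdiff_lt hne
      exact ⟨ih.1, by omega, by omega⟩
  · simp at hq
termination_by S.card
decreasing_by exact card_sdiff_borderStrip_lt h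

/-- `α₁ > α₂ > ⋯` and `β₁ > β₂ > ⋯`. -/
theorem corners_pairwise (S : Finset (ℕ × ℕ)) :
    (corners S).Pairwise fun p q => q.1 < p.1 ∧ q.2 < p.2 := by
  rw [corners]
  split_ifs with h
  · refine List.pairwise_cons.2 ⟨fun q hq => ?_, corners_pairwise _⟩
    have hne : (S \ borderStrip S).Nonempty := by
      by_contra hne
      rw [corners, dif_neg hne] at hq
      simp at hq
    have h1 := corners_mem q hq
    have h2 := corner_sdiff_lt hne
    omega
  · exact List.Pairwise.nil
termination_by S.card
decreasing_by exact card_sdiff_borderStrip_lt h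

/-- The boxes of `(α₁, …, α_d | β₁, …, β_d)`, for `l = [(α₁, β₁), …, (α_d, β_d)]`: the `k`-th hook
consists of `α_k` boxes downwards and `β_k` boxes to the right from the diagonal box `(k, k)`,
which is counted in both. -/
def frobeniusCells (l : List (ℕ × ℕ)) : Finset (ℕ × ℕ) :=
  (Finset.range l.length).biUnion fun k =>
    ((Finset.range (l.getD k (0, 0)).1).image fun m => (k + m, k)) ∪
      ((Finset.range (l.getD k (0, 0)).2).image fun m => (k, k + m))

theorem mem_frobeniusCells {l : List (ℕ × ℕ)} {a : ℕ × ℕ} :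
    a ∈ frobeniusCells l ↔ ∃ k, ∃ _ : k < l.length,
      (a.2 = k ∧ k ≤ a.1 ∧ a.1 < k + l[k].1) ∨ (a.1 = k ∧ k ≤ a.2 ∧ a.2 < k + l[k].2) := by
  simp only [frobeniusCells, Finset.mem_biUnion, Finset.mem_range, Finset.mem_union,
    Finset.mem_image]
  constructor
  · rintro ⟨k, hk, ⟨m, hm, rfl⟩ | ⟨m, hm, rfl⟩⟩
    · rw [List.getD_eq_getElem _ _ hk] at hm
      exact ⟨k, hk, Or.inl ⟨rfl, by simp, by simpa using hm⟩⟩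
    · rw [List.getD_eq_getElem _ _ hk] at hm
      exact ⟨k, hk, Or.inr ⟨rfl, by simp, by simpa using hm⟩⟩
  · rintro ⟨k, hk, ⟨h1, h2, h3⟩ | ⟨h1, h2, h3⟩⟩
    · refine ⟨k, hk, Or.inl ⟨a.1 - k, ?_, ?_⟩⟩
      · rw [List.getD_eq_getElem _ _ hk]; omega
      · ext
        · simp only; omega
        · exact h1.symm
    · refine ⟨k, hk, Or.inr ⟨a.2 - k, ?_, ?_⟩⟩
      · rw [List.getD_eq_getElem _ _ hk]; omega
      · ext
        · exact h1.symm
        · simp only; omega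

theorem isLowerSet_frobeniusCells {l : List (ℕ × ℕ)}
    (hl : l.Pairwise fun p q => q.1 < p.1 ∧ q.2 < p.2) (hpos : ∀ q ∈ l, 0 < q.1 ∧ 0 < q.2) :
    IsLowerSet (frobeniusCells l : Set (ℕ × ℕ)) := by
  have dec : ∀ n m (hm : m + n < l.length),
      l[m + n].1 + n ≤ (l[m]'(by omega)).1 ∧ l[m + n].2 + n ≤ (l[m]'(by omega)).2 := by
    intro n
    induction n with
    | zero => intro m hm; simp
    | succ n ih =>
      intro m hm
      have h1 := ih m (by omega)
      have h2 := List.pairwise_iff_getElem.1 hl (m + n) (m + (n + 1)) (by omega) hm (by omega)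
      omega
  rintro ⟨a, b⟩ ⟨a', b'⟩ ⟨ha, hb⟩ h
  simp only at ha hb
  rw [Finset.mem_coe, mem_frobeniusCells] at h ⊢
  obtain ⟨k, hk, h⟩ := h
  have hp := hpos _ (List.getElem_mem hk)
  simp only at h ⊢
  rcases le_total b' a' with hba | hba
  · have hb'k : b' ≤ k := by omega
    obtain ⟨n, rfl⟩ := Nat.exists_eq_add_of_le hb'k
    have := dec n b' hk
    exact ⟨b', by omega, Or.inl ⟨rfl, hba, by omega⟩⟩
  · have ha'k : a' ≤ k := by omega
    obtain ⟨n, rfl⟩ := Nat.exists_eq_add_of_le ha'k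
    have := dec n a' hk
    exact ⟨a', by omega, Or.inr ⟨rfl, hba, by omega⟩⟩

/-- The partition `λ(S) = (α₁, …, α_d | β₁, …, β_d)`, in Frobenius notation. -/
def suppShape (S : Finset (ℕ × ℕ)) : YoungDiagram where
  cells := frobeniusCells (corners S)
  isLowerSet := isLowerSet_frobeniusCells (corners_pairwise S) fun q hq => (corners_mem q hq).1

/-! ## The Weyl group -/

/-- Nonzero integers. -/
abbrev NZ : Type := {n : ℤ // n ≠ 0}

/-- The simple reflection `s_i` (`i ∈ ℤ`) as a permutation of the nonzero integers: `(i i+1)` if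
`0 < i`, `(i-1 i)` if `i < 0`, and `(-1 1)` if `i = 0`. -/
def simpleRefl (i : ℤ) : Equiv.Perm NZ :=
  if h : 0 < i then Equiv.swap ⟨i, by omega⟩ ⟨i + 1, by omega⟩
  else if h' : i < 0 then Equiv.swap ⟨i - 1, by omega⟩ ⟨i, by omega⟩
  else Equiv.swap ⟨-1, by omega⟩ ⟨1, by omega⟩

/-- The Weyl group. -/
def weylGroup : Subgroup (Equiv.Perm NZ) := Subgroup.closure (Set.range simpleRefl)

/-- The length of an element of the Weyl group. -/
noncomputable def weylLength (w : Equiv.Perm NZ) : ℕ :=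
  sInf {n | ∃ l : List ℤ, l.length = n ∧ (l.map simpleRefl).prod = w}

/-- `w = s_{i₁} ⋯ s_{i_r}` is a reduced expression. -/
def IsReducedExpr (l : List ℤ) (w : Equiv.Perm NZ) : Prop :=
  (l.map simpleRefl).prod = w ∧ l.length = weylLength w

/-- The Bruhat order on the Weyl group: the reflexive and transitive closure of `u < u t`, where
`t` is a reflection (a conjugate of a simple reflection) and `u t` is longer than `u`. -/
def BruhatLE : Equiv.Perm NZ → Equiv.Perm NZ → Prop :=
  Relation.ReflTransGen fun u v =>
    ∃ g ∈ weylGroup, ∃ i : ℤ, v = u * (g * simpleRefl i * g⁻¹) ∧ weylLength u < weylLength v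

/-- `W^{Λ₀}`: the `w` in the Weyl group with `ℓ(w s_i) > ℓ(w)` for all simple reflections `s_i` in
the stabilizer of `Λ₀`, that is, for all `i ≠ 0`. -/
def minReps : Set (Equiv.Perm NZ) :=
  {w | w ∈ weylGroup ∧ ∀ i : ℤ, i ≠ 0 → weylLength w < weylLength (w * simpleRefl i)}

/-- The diagram `D(w)`. -/
def diagram (w : Equiv.Perm NZ) : Set (NZ × NZ) :=
  {p | p.1 < w.symm p.2 ∧ p.2 < w p.1}

/-- The `i`-th part (counted from `0`) of `λ(w)`: the number of `j` with `(-(i + 1), j) ∈ D(w)`. -/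
noncomputable def shapePart (w : Equiv.Perm NZ) (i : ℕ) : ℕ :=
  {j : NZ | ((⟨-((i : ℤ) + 1), by omega⟩ : NZ), j) ∈ diagram w}.ncard

open Classical in
/-- The partition `λ(w)` with parts `shapePart w`.  (For `w` in `W^{Λ₀}` these do form a
partition.) -/
noncomputable def shape (w : Equiv.Perm NZ) : YoungDiagram :=
  if h : {p : ℕ × ℕ | p.2 < shapePart w p.1}.Finite ∧
      IsLowerSet {p : ℕ × ℕ | p.2 < shapePart w p.1} then
    { cells := h.1.toFinset
      isLowerSet := by rw [Set.Finite.coe_toFinset]; exact h.2 }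
  else ⊥

/-- `α(w)`, where `λ(w) = (α(w) | β(w))`. -/
noncomputable def alpha (w : Equiv.Perm NZ) : Fin (diagLen (shape w)) → ℕ := frobLower (shape w)

/-- `β(w)`, where `λ(w) = (α(w) | β(w))`. -/
noncomputable def beta (w : Equiv.Perm NZ) : Fin (diagLen (shape w)) → ℕ := frobUpper (shape w)

/-- The flag `φ(w)`, the reverse of `α(w)`. -/
noncomputable def phi (w : Equiv.Perm NZ) : Fin (diagLen (shape w)) → ℕ := fun i => alpha w i.rev

/-- The flag `ψ(w)`, the reverse of `β(w)`. -/
noncomputable def psi (w : Equiv.Perm NZ) : Fin (diagLen (shape w)) → ℕ := fun i => beta w i.rev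

/-- The matrices `A` with `λ(supp A) ⊆ λ(w)`. -/
def boundedMats (w : Equiv.Perm NZ) : Set Mat := {A | suppShape A.support ≤ shape w}

/-- The finite sets `S ⊂ ℕ²` with `w(S) ≤ w`, where `w(S) ∈ W^{Λ₀}` is the permutation with
`λ(w(S)) = λ(S)`. -/
def dominatedSupports (w : Equiv.Perm NZ) : Set (Finset (ℕ × ℕ)) :=
  {S | ∃ u ∈ minReps, shape u = suppShape S ∧ BruhatLE u w}

/-! ## Characters -/

/-- Formal power series over `ℤ` in the variables `x_{i+1} = X (inl i)` and `y_{j+1} = X (inr j)`. -/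
abbrev Ser : Type := MvPowerSeries (ℕ ⊕ ℕ) ℤ

/-- The complete symmetric function `h_k(z_1, …, z_n)`, which is `0` for `k < 0`, in the first `n`
of the variables `X (ι 0), X (ι 1), …`. -/
noncomputable def completeSymm (ι : ℕ → ℕ ⊕ ℕ) (n : ℕ) (k : ℤ) : MvPolynomial (ℕ ⊕ ℕ) ℤ :=
  if k < 0 then 0
  else MvPolynomial.rename (fun i : Fin n => ι i) (MvPolynomial.hsymm (Fin n) ℤ k.toNat)

/-- `ŝ_ν(Z_α) = det (h_{ν_i - i + j}(Z_{α_j}))_{1 ≤ i, j ≤ d}`, in the variables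
`X (ι 0), X (ι 1), …`. -/
noncomputable def hatSchur (ι : ℕ → ℕ ⊕ ℕ) (ν : YoungDiagram) {d : ℕ} (α : Fin d → ℕ) :
    MvPolynomial (ℕ ⊕ ℕ) ℤ :=
  (Matrix.of fun i j : Fin d => completeSymm ι (α j) ((ν.rowLen i : ℤ) - i + j)).det

/-- The series `x_i y_j / (1 - x_i y_j)`. -/
noncomputable def edgeSeries (p : ℕ × ℕ) : Ser :=
  (MvPowerSeries.X (Sum.inl p.1) * MvPowerSeries.X (Sum.inr p.2)) *
    MvPowerSeries.invOfUnit
      (1 - MvPowerSeries.X (Sum.inl p.1) * MvPowerSeries.X (Sum.inr p.2)) 1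

end FlaggedRSK

open FlaggedRSK
open scoped MvPowerSeries.WithPiTopology

/-! Everything is controlled by the first columns of the two tableaux of κ(A). Column insertion is
carried out one column at a time: pushing a biword through a column yields that column, the list of
times at which it grew, and the biword of the bumped letters, on which the process repeats.
Transposing a biword exchanges the column and the list of times (`peel_swap`). Hence P(A) is the
recording tableau of the insertion that produces Q(A) (`kappa_eq`), and every statement for a
negative colour is the transposed statement for a positive one.

κ commutes with the raising operators (`bitabE_kappa`). For nonzero colours this comes from a single
insertion of a letter into a column (`wordE_colInsert`), iterated over a biword
(`RaiseLetters.peel`) and over the columns (`RaiseLetters.tab`). Column reading is exchanged for row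
reading because the row word of a tableau inserts to that tableau (`ins_rowWord`). For colour zero,
the multiplicity of the first position in a biword and in its bumped biword differ by the sign of
the first columns (`count_pout`), so the signature rule finds the column where removing one copy of
that position shows (`find_signature`).

κ is injective since every nonzero matrix can be raised and raising is inverted by lowering. It is
surjective since any pair of tableaux of equal shape can be raised to a pair of highest weight,
which is the image of a diagonal matrix.

The k-th Frobenius coordinates of λ(S) are the largest row and the largest column in which a
strictly increasing chain of k points of S starts. Insertion computes the same maxima as entries of
the first columns. Thus λ(supp A) ⊆ μ says that the first columns of κ(A) fit into μ (`fits_iff`).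
This is the flag condition, because entries of a row are largest in the first (right-most) column.
It is inherited under raising, because raising only lowers an entry of the first columns or removes
their top boxes.

For the sets generated by reduced expressions, boxes of λ(w) are inversions of w, and the first
letter of a reduced expression removes a corner box whose content is the index of that letter
(`remove_box`). If μ' is μ without a corner of content i, then lowering by colour i preserves the
matrices that fit μ, and those of them annihilated by raising fit μ'. So the former are exactly the
lowering strings of the matrices that fit μ' (`fits_iff_exists_iterate`), and induction on the
expression finishes.

For the power series, the Bruhat order below w is containment of partitions
(`mem_dominatedSupports`). Both sides are the sum of the monomials of all bounded matrices, grouped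
by support on the left and by the shape of κ(A) on the right. The groups on the right are evaluated
by a flagged Jacobi–Trudi formula (`exists_flagFilling`). -/

namespace FlaggedRSK

/-! ## Peeling off the first columns -/

/-- Insertion of the letter `p.2` at time `p.1`; the state is the column, the list of the times at
which it grew, and the biword of the letters bumped so far (latest first). -/
def peelStep (p : ℕ × ℕ) (s : List ℕ × List ℕ × List (ℕ × ℕ)) : List ℕ × List ℕ × List (ℕ × ℕ) :=
  ((colInsert p.2 s.1).1,
    if (colInsert p.2 s.1).2.isSome then s.2.1 else s.2.1 ++ [p.1],
    ((colInsert p.2 s.1).2.toList.map fun b => (p.1, b)) ++ s.2.2)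

/-- The first column of the insertion tableau of a biword, the first column of its recording
tableau, and the biword of the bumped letters. -/
def peel (L : List (ℕ × ℕ)) : List ℕ × List ℕ × List (ℕ × ℕ) := L.foldr peelStep ([], [], [])

/-- The first column of the insertion tableau. -/
def pcol (L : List (ℕ × ℕ)) : List ℕ := (peel L).1
/-- The first column of the recording tableau. -/
def prec (L : List (ℕ × ℕ)) : List ℕ := (peel L).2.1
/-- The biword of the letters bumped out of the first column. -/
def pout (L : List (ℕ × ℕ)) : List (ℕ × ℕ) := (peel L).2.2

@[simp] theorem pcol_nil : pcol [] = [] := rfl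
@[simp] theorem prec_nil : prec [] = [] := rfl
@[simp] theorem pout_nil : pout [] = [] := rfl

theorem pcol_cons (p : ℕ × ℕ) (L : List (ℕ × ℕ)) : pcol (p :: L) = (colInsert p.2 (pcol L)).1 := rfl

theorem prec_cons (p : ℕ × ℕ) (L : List (ℕ × ℕ)) : prec (p :: L) =
    if (colInsert p.2 (pcol L)).2.isSome then prec L else prec L ++ [p.1] := rfl

theorem pout_cons (p : ℕ × ℕ) (L : List (ℕ × ℕ)) : pout (p :: L) =
    ((colInsert p.2 (pcol L)).2.toList.map fun b => (p.1, b)) ++ pout L := rfl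

/-- Either the column contains no letter `≤ a` and `a` is put on top, or the column splits at the
first such letter. -/
theorem colInsert_cases (a : ℕ) (C : List ℕ) :
    ((∀ x ∈ C, a < x) ∧ colInsert a C = (C ++ [a], none)) ∨
    ∃ C1 b C2, C = C1 ++ b :: C2 ∧ (∀ x ∈ C1, a < x) ∧ b ≤ a ∧
      colInsert a C = (C1 ++ a :: C2, some b) := by
  induction C with
  | nil => left; simp [colInsert]
  | cons x C ih =>
    by_cases h : x ≤ a
    · right
      exact ⟨[], x, C, rfl, by simp, h, by simp [colInsert, h]⟩
    · rcases ih with ⟨h1, h2⟩ | ⟨C1, b, C2, h1, h2, h3, h4⟩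
      · left
        refine ⟨?_, by simp [colInsert, h, h2]⟩
        intro y hy
        rcases List.mem_cons.1 hy with rfl | hy
        · omega
        · exact h1 y hy
      · right
        refine ⟨x :: C1, b, C2, by simp [h1], ?_, h3, by simp [colInsert, h, h4]⟩
        intro y hy
        rcases List.mem_cons.1 hy with rfl | hy
        · omega
        · exact h2 y hy

theorem colInsert_of_forall_lt {a : ℕ} {C : List ℕ} (h : ∀ x ∈ C, a < x) :
    colInsert a C = (C ++ [a], none) := by
  induction C with
  | nil => simp [colInsert]
  | cons x C ih =>
    have := h x (by simp)
    simp [colInsert, ih fun y hy => h y (by simp [hy]), Nat.not_le.2 this]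

theorem colInsert_append_cons {a b : ℕ} {C1 C2 : List ℕ} (h : ∀ x ∈ C1, a < x) (hb : b ≤ a) :
    colInsert a (C1 ++ b :: C2) = (C1 ++ a :: C2, some b) := by
  induction C1 with
  | nil => simp [colInsert, hb]
  | cons x C ih =>
    have := h x (by simp)
    simp [colInsert, ih fun y hy => h y (by simp [hy]), Nat.not_le.2 this]

theorem colInsert_pairwise {a : ℕ} {C : List ℕ} (h : C.Pairwise (· > ·)) :
    (colInsert a C).1.Pairwise (· > ·) := by
  rcases colInsert_cases a C with ⟨h1, h2⟩ | ⟨C1, b, C2, rfl, h2, h3, h4⟩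
  · rw [h2]
    simp only [List.pairwise_append, List.pairwise_cons, List.mem_singleton]
    refine ⟨h, by simp, ?_⟩
    rintro x hx _ rfl
    exact h1 x hx
  · rw [h4]
    simp only [List.pairwise_append, List.pairwise_cons, List.mem_cons] at h ⊢
    refine ⟨h.1, ⟨fun y hy => ?_, h.2.1.2⟩, ?_⟩
    · have := h.2.1.1 y hy; omega
    · rintro x hx y (rfl | hy)
      · exact h2 x hx
      · exact h.2.2 x hx y (Or.inr hy)

theorem colInsert_ne_nil (a : ℕ) (C : List ℕ) : (colInsert a C).1 ≠ [] := by
  rcases colInsert_cases a C with ⟨h1, h2⟩ | ⟨C1, b, C2, rfl, h2, h3, h4⟩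
  · rw [h2]; simp
  · rw [h4]; simp

theorem pcol_pairwise (L : List (ℕ × ℕ)) : (pcol L).Pairwise (· > ·) := by
  induction L with
  | nil => simp
  | cons p L ih => rw [pcol_cons]; exact colInsert_pairwise ih

theorem pcol_ne_nil {L : List (ℕ × ℕ)} (h : L ≠ []) : pcol L ≠ [] := by
  cases L with
  | nil => exact absurd rfl h
  | cons p L => rw [pcol_cons]; exact colInsert_ne_nil _ _

theorem length_prec (L : List (ℕ × ℕ)) : (prec L).length = (pcol L).length := by
  induction L with
  | nil => simp
  | cons p L ih =>
    rw [prec_cons, pcol_cons]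
    rcases colInsert_cases p.2 (pcol L) with ⟨h1, h2⟩ | ⟨C1, b, C2, h1, h2, h3, h4⟩
    · rw [h2]; simp [ih]
    · rw [h1] at ih; rw [h4]; simpa using ih

theorem length_pout (L : List (ℕ × ℕ)) : (pout L).length + (pcol L).length = L.length := by
  induction L with
  | nil => simp
  | cons p L ih =>
    rw [pout_cons, pcol_cons]
    rcases colInsert_cases p.2 (pcol L) with ⟨h1, h2⟩ | ⟨C1, b, C2, h1, h2, h3, h4⟩
    · rw [h2]; simp; omega
    · rw [h1] at ih; rw [h4]; simp at ih ⊢; omega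

theorem length_pout_lt {L : List (ℕ × ℕ)} (h : L ≠ []) : (pout L).length < L.length := by
  have h1 := length_pout L
  have h2 := List.length_pos_iff.2 (pcol_ne_nil h)
  omega

/-- The insertion tableau of a word that is inserted from its end to its beginning. -/
def ins (u : List ℕ) : Tab := u.foldr (fun a T => tabInsert T a) []

theorem insertWord_reverse (u : List ℕ) : insertWord u.reverse = ins u := by
  simp [insertWord, ins]

/-- The recording tableau of a biword. -/
def recTab (L : List (ℕ × ℕ)) : Tab :=
  if h : L = [] then [] else prec L :: recTab (pout L)
termination_by L.length
decreasing_by exact length_pout_lt h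

@[simp] theorem recTab_nil : recTab [] = [] := by rw [recTab]; simp

theorem recTab_of_ne_nil {L : List (ℕ × ℕ)} (h : L ≠ []) :
    recTab L = prec L :: recTab (pout L) := by rw [recTab]; simp [h]

@[simp] theorem ins_nil : ins [] = [] := rfl

theorem ins_cons (a : ℕ) (u : List ℕ) : ins (a :: u) = tabInsert (ins u) a := rfl

/-- What enters the second column is exactly the sequence of letters bumped from the first, in the
order of bumping, so the remaining columns are the insertion tableau of the bumped biword. -/
theorem ins_of_ne_nil {L : List (ℕ × ℕ)} (h : L ≠ []) :
    ins (L.map Prod.snd) = pcol L :: ins ((pout L).map Prod.snd) := by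
  induction L with
  | nil => exact absurd rfl h
  | cons p L ih =>
    rcases eq_or_ne L [] with rfl | hL
    · simp [ins, tabInsert, pcol_cons, pout_cons, colInsert]
    · rw [List.map_cons, ins_cons, ih hL, pout_cons, pcol_cons]
      rcases colInsert_cases p.2 (pcol L) with ⟨h1, h2⟩ | ⟨C1, b, C2, h1, h2, h3, h4⟩
      · simp [tabInsert, h2]
      · simp [tabInsert, h4, ins_cons]

/-- The pair of tableaux of a biword. -/
theorem ins_map_snd_induction {P : List (ℕ × ℕ) → Prop} (h0 : P [])
    (h1 : ∀ L, L ≠ [] → P (pout L) → P L) (L : List (ℕ × ℕ)) : P L := by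
  by_cases h : L = []
  · rw [h]; exact h0
  · exact h1 L h (ins_map_snd_induction h0 h1 (pout L))
termination_by L.length
decreasing_by exact length_pout_lt h

/-! ### Order properties -/

theorem mem_pout_fst {L : List (ℕ × ℕ)} {q : ℕ × ℕ} (h : q ∈ pout L) : ∃ p ∈ L, p.1 = q.1 := by
  induction L with
  | nil => simp at h
  | cons p L ih =>
    rw [pout_cons] at h
    rcases List.mem_append.1 h with h | h
    · simp at h
      obtain ⟨b, -, rfl⟩ := h
      exact ⟨p, by simp, rfl⟩
    · obtain ⟨r, hr, hr'⟩ := ih h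
      exact ⟨r, by simp [hr], hr'⟩

theorem mem_prec {L : List (ℕ × ℕ)} {k : ℕ} (h : k ∈ prec L) : ∃ p ∈ L, p.1 = k := by
  induction L with
  | nil => simp at h
  | cons p L ih =>
    rw [prec_cons] at h
    split_ifs at h with h'
    · obtain ⟨r, hr, hr'⟩ := ih h
      exact ⟨r, by simp [hr], hr'⟩
    · rcases List.mem_append.1 h with h | h
      · obtain ⟨r, hr, hr'⟩ := ih h
        exact ⟨r, by simp [hr], hr'⟩
      · simp at h
        exact ⟨p, by simp, h.symm⟩

theorem mem_pcol {L : List (ℕ × ℕ)} {k : ℕ} (h : k ∈ pcol L) : ∃ p ∈ L, p.2 = k := by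
  induction L with
  | nil => simp at h
  | cons p L ih =>
    rw [pcol_cons] at h
    rcases colInsert_cases p.2 (pcol L) with ⟨h1, h2⟩ | ⟨C1, b, C2, h1, h2, h3, h4⟩
    · rw [h2] at h
      simp at h
      rcases h with h | h
      · obtain ⟨r, hr, hr'⟩ := ih h
        exact ⟨r, by simp [hr], hr'⟩
      · exact ⟨p, by simp, h.symm⟩
    · rw [h4] at h
      rw [h1] at ih
      simp only [List.mem_append, List.mem_cons] at h ih
      by_cases hk : k = p.2
      · exact ⟨p, by simp, hk.symm⟩
      · obtain ⟨r, hr, hr'⟩ := ih (by tauto)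
        exact ⟨r, by simp [hr], hr'⟩

/-- A bumped letter is at most the letter that bumped it, and the latter has the same time, hence is
at most the letter of a point that precedes it in the order. -/
theorem le_of_mem_pout {r q : ℕ × ℕ} {L : List (ℕ × ℕ)} (hr : ∀ s ∈ L, omegaLE' r s)
    (hq : q ∈ pout L) (hq1 : q.1 = r.1) : q.2 ≤ r.2 := by
  induction L with
  | nil => simp at hq
  | cons s L ih =>
    rw [pout_cons] at hq
    have hrs := hr s (by simp)
    rcases List.mem_append.1 hq with hq | hq
    · simp at hq
      obtain ⟨b', hb', rfl⟩ := hq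
      rcases colInsert_cases s.2 (pcol L) with ⟨h1, h2⟩ | ⟨C1, b1, C2, h1, h2, h3, h4⟩
      · rw [h2] at hb'; simp at hb'
      · rw [h4] at hb'
        simp at hb'
        unfold omegaLE' at hrs
        simp at hq1 ⊢; omega
    · exact ih (fun x hx => hr x (by simp [hx])) hq

/-- Letters of equal time are inserted in weakly increasing order, and then the bumped letters are
weakly increasing too. Hence the bumped biword is again sorted and peeling can be iterated. The
induction needs the stronger claim about an arbitrary admissible next point `p`. -/
theorem pout_sorted {L : List (ℕ × ℕ)} (h : L.Pairwise omegaLE') : (pout L).Pairwise omegaLE' := by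
  suffices H : (pout L).Pairwise omegaLE' ∧
      ∀ p : ℕ × ℕ, (∀ q ∈ L, omegaLE' p q) → ∀ b, (colInsert p.2 (pcol L)).2 = some b →
        ∀ q ∈ pout L, omegaLE' (p.1, b) q from H.1
  induction L with
  | nil => simp
  | cons r L ih =>
    obtain ⟨hr, hL⟩ := List.pairwise_cons.1 h
    obtain ⟨ih1, ih2⟩ := ih hL
    have key : (pout (r :: L)).Pairwise omegaLE' := by
      rw [pout_cons]
      cases hb : (colInsert r.2 (pcol L)).2 with
      | none => simpa using ih1
      | some b =>
        simp only [Option.toList_some, List.map_cons, List.map_nil, List.singleton_append,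
          List.pairwise_cons]
        exact ⟨ih2 r hr b hb, ih1⟩
    refine ⟨key, fun p hp b hb q hq => ?_⟩
    have hpr := hp r (by simp)
    obtain ⟨s, hs, hs'⟩ := mem_pout_fst hq
    have hps := hp s hs
    -- only the points of the same time matter
    by_cases hlt : p.1 < q.1
    · exact Or.inl hlt
    have hpq : p.1 = q.1 := by
      unfold omegaLE' at hps; omega
    refine Or.inr ⟨hpq, ?_⟩
    have hrq : r.1 ≤ q.1 := by
      rcases List.mem_cons.1 hs with rfl | hs
      · omega
      · have := hr s hs; unfold omegaLE' at this; omega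
    have hpr1 : p.1 = r.1 ∧ r.2 ≤ p.2 := by unfold omegaLE' at hpr; omega
    -- With `r.2 ≤ p.2`, the letter `p.2` bumps either `r.2` itself, which is at least what `r.2`
    -- had bumped, or an entry closer to the bottom, which is larger.
    have hbig : ∀ b', (colInsert r.2 (pcol L)).2 = some b' → b' ≤ b := by
      intro b' hb'
      rw [pcol_cons] at hb
      rcases colInsert_cases r.2 (pcol L) with ⟨h1, h2⟩ | ⟨C1, b1, C2, h1, h2, h3, h4⟩
      · rw [h2] at hb'; simp at hb'
      · rw [h4] at hb hb'
        simp only [Option.some.injEq] at hb'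
        subst hb'
        rcases colInsert_cases p.2 (C1 ++ r.2 :: C2) with ⟨h5, h6⟩ | ⟨D1, b2, D2, h5, h6, h7, h8⟩
        · have := h5 r.2 (by simp); omega
        · simp only [h8, Option.some.injEq] at hb
          subst hb
          rw [List.append_eq_append_iff] at h5
          rcases h5 with ⟨a, ha, ha'⟩ | ⟨a, ha, ha'⟩
          · cases a with
            | nil => simp at ha'; omega
            | cons x a =>
              simp at ha'
              have := h6 x (by simp [ha]); omega
          · cases a with
            | nil => simp at ha'; omega
            | cons x a =>
              simp at ha'
              have := h2 b2 (by simp [ha, ha']); omega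
    rw [pout_cons] at hq
    rcases List.mem_append.1 hq with hq | hq
    · simp at hq
      obtain ⟨b', hb', rfl⟩ := hq
      exact hbig b' hb'
    · cases hb' : (colInsert r.2 (pcol L)).2 with
      | some b' =>
        have := ih2 r hr b' hb' q hq
        have h2 := hbig b' hb'
        unfold omegaLE' at this
        simp only at this ⊢; omega
      | none =>
        -- `r.2` was put on top, hence is bumped by `p.2` or something larger is
        have hrb : r.2 ≤ b := by
          rw [pcol_cons] at hb
          rcases colInsert_cases r.2 (pcol L) with ⟨h1, h2⟩ | ⟨C1, b1, C2, h1, h2, h3, h4⟩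
          · rw [h2] at hb
            rcases colInsert_cases p.2 (pcol L ++ [r.2]) with ⟨h5, h6⟩ | ⟨D1, b2, D2, h5, h6, h7, h8⟩
            · rw [h6] at hb; simp at hb
            · simp only [h8, Option.some.injEq] at hb
              subst hb
              have : b2 ∈ pcol L ++ [r.2] := by rw [h5]; simp
              rcases List.mem_append.1 this with h | h
              · exact (h1 b2 h).le
              · simp at h; omega
          · rw [h4] at hb'; simp at hb'
        exact (le_of_mem_pout hr hq (by omega)).trans hrb

/-- The first column dominates the second one. -/
def ColLE (D C : List ℕ) : Prop := ∀ i x : ℕ, D[i]? = some x → ∃ y, C[i]? = some y ∧ x ≤ y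

theorem colLE_nil (C : List ℕ) : ColLE [] C := by intro i x h; simp at h

theorem ColLE.length_le {D C : List ℕ} (h : ColLE D C) : D.length ≤ C.length := by
  by_contra hlt
  obtain ⟨y, hy, -⟩ := h C.length (D[C.length]) (List.getElem?_eq_getElem _)
  simp at hy

theorem colLE_colInsert_of_none {a : ℕ} {D C : List ℕ} (h : ColLE D C)
    (hn : (colInsert a C).2 = none) : ColLE D (colInsert a C).1 := by
  rcases colInsert_cases a C with ⟨h1, h2⟩ | ⟨C1, b, C2, rfl, h2, h3, h4⟩
  · rw [h2]
    intro i x hx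
    obtain ⟨y, hy, hxy⟩ := h i x hx
    refine ⟨y, ?_, hxy⟩
    rw [List.getElem?_append_left (List.getElem?_eq_some_iff.1 hy).1]
    exact hy
  · rw [h4] at hn; simp at hn

/-- The bumped letter `b` stood at height `C1.length` in the first column, so the second column has
at that height, if anything, an entry at most `b`. Therefore `b` enters the second column at that
height or lower, where the new first column has entries at least `b`. -/
theorem colLE_colInsert_of_some {a b : ℕ} {D C : List ℕ} (h : ColLE D C)
    (hC : C.Pairwise (· > ·))
    (hb : (colInsert a C).2 = some b) : ColLE (colInsert b D).1 (colInsert a C).1 := by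
  rcases colInsert_cases a C with ⟨h1, h2⟩ | ⟨C1, b', C2, rfl, h2, h3, h4⟩
  · rw [h2] at hb; simp at hb
  · rw [h4] at hb ⊢
    obtain rfl : b' = b := by simpa using hb
    have hC1 : ∀ x ∈ C1, b' < x := by
      intro x hx
      exact (List.pairwise_append.1 hC).2.2 x hx b' (by simp)
    -- the old column is dominated by the new one
    have hD : ColLE D (C1 ++ a :: C2) := by
      intro i x hx
      obtain ⟨y, hy, hxy⟩ := h i x hx
      rcases lt_trichotomy i C1.length with hi | rfl | hi
      · rw [List.getElem?_append_left hi] at hy ⊢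
        exact ⟨y, hy, hxy⟩
      · simp at hy ⊢; omega
      · rw [List.getElem?_append_right hi.le] at hy ⊢
        obtain ⟨n, hn⟩ : ∃ n, i - C1.length = n + 1 := ⟨i - C1.length - 1, by omega⟩
        rw [hn] at hy ⊢
        simp only [List.getElem?_cons_succ] at hy ⊢
        exact ⟨y, hy, hxy⟩
    have hpos : ∀ i, i ≤ C1.length → ∃ y, (C1 ++ a :: C2)[i]? = some y ∧ b' ≤ y := by
      intro i hi
      rcases hi.lt_or_eq with hi | rfl
      · rw [List.getElem?_append_left hi, List.getElem?_eq_getElem hi]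
        exact ⟨_, rfl, (hC1 _ (List.getElem_mem hi)).le⟩
      · simpa using h3
    rcases colInsert_cases b' D with ⟨h5, h6⟩ | ⟨D1, c, D2, h5, h6, h7, h8⟩
    · have hlen : D.length ≤ C1.length := by
        by_contra hlt
        push Not at hlt
        obtain ⟨y, hy, hxy⟩ := h C1.length _ (List.getElem?_eq_getElem hlt)
        have := h5 _ (List.getElem_mem hlt)
        simp at hy
        omega
      rw [h6]
      intro i x hx
      rcases lt_or_ge i D.length with hi | hi
      · simp only [List.getElem?_append_left hi] at hx
        exact hD i x hx
      · simp only [List.getElem?_append_right hi, List.getElem?_singleton] at hx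
        split_ifs at hx with h0
        obtain rfl : b' = x := by simpa using hx
        exact hpos i (by omega)
    · have hlen : D1.length ≤ C1.length := by
        by_contra hlt
        push Not at hlt
        obtain ⟨y, hy, hxy⟩ := h C1.length (D1[C1.length]) (by
          rw [h5, List.getElem?_append_left hlt, List.getElem?_eq_getElem hlt])
        have := h6 _ (List.getElem_mem hlt)
        simp at hy
        omega
      rw [h8]
      intro i x hx
      rcases lt_trichotomy i D1.length with hi | rfl | hi
      · refine hD i x ?_
        rw [h5, List.getElem?_append_left hi]
        simpa only [List.getElem?_append_left hi] using hx
      · simp at hx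
        subst hx
        exact hpos _ hlen
      · refine hD i x ?_
        obtain ⟨n, hn⟩ : ∃ n, i - D1.length = n + 1 := ⟨i - D1.length - 1, by omega⟩
        rw [h5, List.getElem?_append_right hi.le, hn]
        simp only [List.getElem?_append_right hi.le, hn] at hx
        simpa using hx

theorem pcol_pout_le (L : List (ℕ × ℕ)) : ColLE (pcol (pout L)) (pcol L) := by
  induction L with
  | nil => exact colLE_nil _
  | cons p L ih =>
    rw [pcol_cons, pout_cons]
    cases hb : (colInsert p.2 (pcol L)).2 with
    | none => simpa using colLE_colInsert_of_none ih hb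
    | some b =>
      simp only [Option.toList_some, List.map_cons, List.map_nil, List.singleton_append, pcol_cons]
      exact colLE_colInsert_of_some ih (pcol_pairwise L) hb

/-- The effect of one additional point whose letter is minimal. -/
theorem peel_insert_point {t k : ℕ} {M1 M2 : List (ℕ × ℕ)} (h1 : ∀ q ∈ M1, k ≤ q.2)
    (h2 : ∀ x ∈ pcol M2, k < x) :
    (pcol (M1 ++ (t, k) :: M2) = pcol (M1 ++ M2) ++ [k] ∧ prec (M1 ++ M2) = prec M2 ∧
      prec (M1 ++ (t, k) :: M2) = prec M2 ++ [t] ∧ pout (M1 ++ (t, k) :: M2) = pout (M1 ++ M2)) ∨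
    ∃ t' R1, (∃ q ∈ M1, q.1 = t') ∧ pcol (M1 ++ (t, k) :: M2) = pcol (M1 ++ M2) ∧
      prec (M1 ++ M2) = prec M2 ++ t' :: R1 ∧ prec (M1 ++ (t, k) :: M2) = prec M2 ++ t :: R1 ∧
      (pout (M1 ++ (t, k) :: M2)).Perm ((t', k) :: pout (M1 ++ M2)) := by
  induction M1 with
  | nil =>
    left
    simp [pcol_cons, prec_cons, pout_cons, colInsert_of_forall_lt h2]
  | cons q M1 ih =>
    have hq := h1 q (by simp)
    simp only [List.cons_append]
    rcases ih (fun x hx => h1 x (by simp [hx])) with ⟨e1, e2, e3, e4⟩ | ⟨t', R1, hm, e1, e2, e3, e4⟩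
    -- So far the larger column has an extra `k` on top. A letter that makes the smaller column grow
    -- bumps this `k` from the larger one; from then on the columns agree, and the records differ
    -- only by `t` in place of `q.1`.
    · rcases colInsert_cases q.2 (pcol (M1 ++ M2)) with ⟨h3, h4⟩ | ⟨C1, b, C2, h3, h4, h5, h6⟩
      · right
        have h7 : colInsert q.2 (pcol (M1 ++ M2) ++ [k]) = (pcol (M1 ++ M2) ++ [q.2], some k) :=
          colInsert_append_cons h3 hq
        refine ⟨q.1, [], ⟨q, by simp, rfl⟩, ?_⟩
        simp [pcol_cons, prec_cons, pout_cons, e1, e2, e3, e4, h4, h7]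
      · left
        have h7 : colInsert q.2 (pcol (M1 ++ M2) ++ [k]) = (C1 ++ q.2 :: C2 ++ [k], some b) := by
          rw [h3, List.append_assoc, List.cons_append, colInsert_append_cons h4 h5]
          simp
        simp [pcol_cons, prec_cons, pout_cons, e1, e2, e3, e4, h6, h7]
    · right
      rw [pcol_cons, pcol_cons, prec_cons, prec_cons, pout_cons, pout_cons, e1, e2, e3]
      cases hb : (colInsert q.2 (pcol (M1 ++ M2))).2 with
      | none =>
        refine ⟨t', R1 ++ [q.1], ?_, rfl, by simp, by simp, by simpa using e4⟩
        obtain ⟨r, hr, hr'⟩ := hm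
        exact ⟨r, by simp [hr], hr'⟩
      | some b =>
        refine ⟨t', R1, ?_, rfl, by simp, by simp, ?_⟩
        · obtain ⟨r, hr, hr'⟩ := hm
          exact ⟨r, by simp [hr], hr'⟩
        · simp only [Option.toList_some, List.map_cons, List.map_nil, List.singleton_append]
          exact (e4.cons _).trans (List.Perm.swap _ _ _)

theorem omegaLE'_sorted_perm_eq {L M : List (ℕ × ℕ)} (hL : L.Pairwise omegaLE')
    (hM : M.Pairwise omegaLE') (h : L.Perm M) : L = M :=
  h.eq_of_pairwise (fun _ _ _ _ h1 h2 => antisymm h1 h2) hL hM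

/-- Transposing a biword exchanges the roles of insertion and recording. -/
theorem peel_swap {L N : List (ℕ × ℕ)} (hL : L.Pairwise omegaLE') (hN : N.Pairwise omegaLE')
    (h : N.Perm (L.map Prod.swap)) :
    pcol N = prec L ∧ prec N = pcol L ∧ (pout N).Perm ((pout L).map Prod.swap) := by
  induction L generalizing N with
  | nil => simp at h; subst h; simp
  | cons p L ih =>
    obtain ⟨k, l⟩ := p
    obtain ⟨hp, hL'⟩ := List.pairwise_cons.1 hL
    have hmem : (l, k) ∈ N := h.symm.subset (by simp)
    -- split at the last occurrence
    obtain ⟨M1, M2, rfl, hM2⟩ : ∃ M1 M2, N = M1 ++ (l, k) :: M2 ∧ (l, k) ∉ M2 := by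
      obtain ⟨a, b, hab, hb⟩ := List.eq_append_cons_of_mem (List.mem_reverse.2 hmem)
      refine ⟨b.reverse, a.reverse, ?_, by simpa using hb⟩
      have := congrArg List.reverse hab
      simpa using this
    have hperm : (M1 ++ M2).Perm (L.map Prod.swap) := by
      have h3 : ((l, k) :: (M1 ++ M2)).Perm ((l, k) :: L.map Prod.swap) :=
        (List.perm_middle.symm).trans (by simpa using h)
      exact (List.perm_cons _).1 h3
    have hsorted : (M1 ++ M2).Pairwise omegaLE' := hN.sublist (by simp)
    have hkl : ∀ q ∈ M1 ++ M2, k < q.2 ∨ (k = q.2 ∧ q.1 ≤ l) := by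
      intro q hq
      have hq' := hperm.subset hq
      simp only [List.mem_map] at hq'
      obtain ⟨r, hr, rfl⟩ := hq'
      exact hp r hr
    -- After the last occurrence of `(l, k)` no equal point is left, so the orders of `N` and of the
    -- transposed `L` together make both coordinates strictly larger.
    have hM2' : ∀ q ∈ M2, l < q.1 ∧ k < q.2 := by
      intro q hq
      have h5 := hkl q (by simp [hq])
      have h6 := (List.pairwise_append.1 hN).2.1
      have h7 := (List.pairwise_cons.1 h6).1 q hq
      have h8 : q ≠ (l, k) := fun h => hM2 (h ▸ hq)
      have h9 : ¬ (q.1 = l ∧ q.2 = k) := fun h => h8 (Prod.ext h.1 h.2)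
      unfold omegaLE' at h7
      simp only at h7
      omega
    have hM1' : ∀ q ∈ M1, q.1 ≤ l ∧ k ≤ q.2 := by
      intro q hq
      have h5 := hkl q (by simp [hq])
      have h6 := (List.pairwise_append.1 hN).2.2 q hq (l, k) (by simp)
      unfold omegaLE' at h6
      simp only at h6
      omega
    obtain ⟨i1, i2, i3⟩ := ih hL' hsorted hperm
    have hcol : ∀ x ∈ pcol M2, k < x := by
      intro x hx
      obtain ⟨q, hq, rfl⟩ := mem_pcol hx
      exact (hM2' q hq).2
    have hrec : ∀ x ∈ prec M2, l < x := by
      intro x hx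
      obtain ⟨q, hq, rfl⟩ := mem_prec hx
      exact (hM2' q hq).1
    rw [pcol_cons, prec_cons, pout_cons, ← i2]
    -- Adding the point with smallest letter `k` to the transposed biword changes its record as
    -- inserting `l` into a column does; the two outcomes are the growth and the bumping case of
    -- that insertion.
    rcases peel_insert_point (t := l) (fun q hq => (hM1' q hq).2) hcol with
      ⟨e1, e2, e3, e4⟩ | ⟨t', R1, ⟨q, hq, rfl⟩, e1, e2, e3, e4⟩
    · have : colInsert l (prec M2) = (prec M2 ++ [l], none) := colInsert_of_forall_lt hrec
      rw [e1, e2, e3, e4, i1]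
      simpa [this] using i3
    · have : colInsert l (prec M2 ++ q.1 :: R1) = (prec M2 ++ l :: R1, some q.1) :=
        colInsert_append_cons hrec (hM1' q hq).1
      rw [e1, e2, e3, i1]
      simp only [this, Option.isSome_some, if_true, Option.toList_some, List.map_cons,
        List.map_nil, List.singleton_append, Prod.swap_prod_mk, true_and]
      exact e4.trans (i3.cons _)

/-- Iteration of `peel_swap`: the bumped biwords are again transposes of each other, and
`pout_sorted` keeps them in order. -/
theorem ins_swap {L N : List (ℕ × ℕ)} (hL : L.Pairwise omegaLE') (hN : N.Pairwise omegaLE')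
    (h : N.Perm (L.map Prod.swap)) : ins (N.map Prod.snd) = recTab L := by
  induction L using ins_map_snd_induction generalizing N with
  | h0 => simp at h; subst h; simp
  | h1 L hL0 ih =>
    have hN0 : N ≠ [] := by
      rintro rfl
      simp at h
      exact hL0 h
    obtain ⟨e1, e2, e3⟩ := peel_swap hL hN h
    rw [ins_of_ne_nil hN0, recTab_of_ne_nil hL0, e1, ih (pout_sorted hL) (pout_sorted hN) e3]

/-! ### Biwords of matrices and transposition -/

theorem biword_sorted (A : Mat) : (biword A).Pairwise omegaLE :=
  Multiset.pairwise_sort _ _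

theorem biword'_sorted (A : Mat) : (biword' A).Pairwise omegaLE' :=
  Multiset.pairwise_sort _ _

theorem coe_biword (A : Mat) : (biword A : Multiset (ℕ × ℕ)) = Finsupp.toMultiset A :=
  Multiset.sort_eq _ _

theorem coe_biword' (A : Mat) : (biword' A : Multiset (ℕ × ℕ)) = Finsupp.toMultiset A :=
  Multiset.sort_eq _ _

theorem biword_swap_sorted (A : Mat) : ((biword A).map Prod.swap).Pairwise omegaLE' := by
  rw [List.pairwise_map]
  exact (biword_sorted A).imp fun {a b} h => by
    unfold omegaLE at h; unfold omegaLE'; simpa using h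

theorem biword_swap_perm (A : Mat) :
    ((biword A).map Prod.swap).Perm ((biword' A).map Prod.swap) := by
  apply List.Perm.map
  rw [← Multiset.coe_eq_coe, coe_biword, coe_biword']

/-- The biword in Ω is the transpose of the one in Ω', so the two independent insertions in the
definition of κ become insertion and recording of a single process. -/
theorem kappa_eq (A : Mat) : kappa A = (recTab (biword' A), ins ((biword' A).map Prod.snd)) := by
  rw [kappa, insertWord_reverse, insertWord_reverse,
    ← ins_swap (biword'_sorted A) (biword_swap_sorted A) (biword_swap_perm A)]
  simp [Function.comp_def]

theorem ofBiword_biword' (A : Mat) : ofBiword (biword' A) = A := by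
  rw [ofBiword, coe_biword']
  simp

theorem biword'_ofBiword {L : List (ℕ × ℕ)} (hL : L.Pairwise omegaLE') :
    biword' (ofBiword L) = L := by
  refine omegaLE'_sorted_perm_eq (biword'_sorted _) hL ?_
  rw [← Multiset.coe_eq_coe, coe_biword', ofBiword]
  simp

/-- The transposed matrix. -/
noncomputable def transposeMat (A : Mat) : Mat := A.equivMapDomain (Equiv.prodComm ℕ ℕ)

@[simp] theorem transposeMat_transposeMat (A : Mat) : transposeMat (transposeMat A) = A := by
  ext ⟨i, j⟩; simp [transposeMat]

theorem transposeMat_apply (A : Mat) (i j : ℕ) : transposeMat A (i, j) = A (j, i) := rfl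

theorem transposeMat_ofBiword (L : List (ℕ × ℕ)) :
    transposeMat (ofBiword L) = ofBiword (L.map Prod.swap) := by
  ext ⟨i, j⟩
  rw [transposeMat_apply]
  simp only [ofBiword, Multiset.toFinsupp_apply, Multiset.coe_count]
  induction L with
  | nil => simp
  | cons p L ih => simp [List.count_cons, ih, Prod.ext_iff, and_comm]

theorem biword'_transposeMat (A : Mat) : biword' (transposeMat A) = (biword A).map Prod.swap := by
  have : A = ofBiword (biword A) := by rw [ofBiword, coe_biword]; simp
  conv_lhs => rw [this, transposeMat_ofBiword]
  exact biword'_ofBiword (biword_swap_sorted A)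

theorem biword_transposeMat (A : Mat) : biword (transposeMat A) = (biword' A).map Prod.swap := by
  have := biword'_transposeMat (transposeMat A)
  rw [transposeMat_transposeMat] at this
  rw [this]; simp

theorem kappa_transposeMat (A : Mat) : kappa (transposeMat A) = (kappa A).swap := by
  simp [kappa, biword'_transposeMat, biword_transposeMat, Function.comp_def]

theorem peel_transposeMat (A : Mat) :
    pcol (biword' (transposeMat A)) = prec (biword' A) ∧
      prec (biword' (transposeMat A)) = pcol (biword' A) := by
  have := peel_swap (biword'_sorted A) (biword_swap_sorted A) (biword_swap_perm A)
  rw [biword'_transposeMat]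
  exact ⟨this.1, this.2.1⟩

/-! ## Crystals of words -/

/-- `⟨wt u, h⟩` for a word `u`. -/
def wordWt (c : ℕ) (u : List ℕ) : ℤ := (u.map (letterWt c)).sum

/-- `φ` of a word. -/
def wordPhi (c : ℕ) (u : List ℕ) : ℤ := wordEps c u + wordWt c u

@[simp] theorem wordEps_nil (c : ℕ) : wordEps c [] = 0 := rfl
@[simp] theorem wordWt_nil (c : ℕ) : wordWt c [] = 0 := rfl
@[simp] theorem wordPhi_nil (c : ℕ) : wordPhi c [] = 0 := rfl

theorem wordEps_cons (c x : ℕ) (u : List ℕ) :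
    wordEps c (x :: u) = max (letterEps c x) (wordEps c u - letterWt c x) := rfl

@[simp] theorem wordWt_cons (c x : ℕ) (u : List ℕ) :
    wordWt c (x :: u) = letterWt c x + wordWt c u := by simp [wordWt]

@[simp] theorem wordWt_append (c : ℕ) (u v : List ℕ) :
    wordWt c (u ++ v) = wordWt c u + wordWt c v := by simp [wordWt]

theorem letterEps_nonneg (c x : ℕ) : 0 ≤ letterEps c x := by unfold letterEps; split_ifs <;> simp
theorem letterPhi_nonneg (c x : ℕ) : 0 ≤ letterPhi c x := by unfold letterPhi; split_ifs <;> simp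

theorem wordEps_nonneg (c : ℕ) (u : List ℕ) : 0 ≤ wordEps c u := by
  cases u with
  | nil => simp
  | cons x u => exact (letterEps_nonneg c x).trans (le_max_left _ _)

theorem wordEps_append (c : ℕ) (u v : List ℕ) :
    wordEps c (u ++ v) = max (wordEps c u) (wordEps c v - wordWt c u) := by
  induction u with
  | nil => simp [wordEps_nonneg]
  | cons x u ih => simp only [List.cons_append, wordEps_cons, ih, wordWt_cons]; omega

theorem wordPhi_append (c : ℕ) (u v : List ℕ) :
    wordPhi c (u ++ v) = max (wordPhi c u + wordWt c v) (wordPhi c v) := by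
  simp only [wordPhi, wordEps_append, wordWt_append]; omega

theorem wordPhi_cons (c x : ℕ) (u : List ℕ) :
    wordPhi c (x :: u) = max (letterPhi c x + wordWt c u) (wordPhi c u) := by
  simp only [wordPhi, wordEps_cons, wordWt_cons, letterWt]; omega

theorem wordPhi_nonneg (c : ℕ) (u : List ℕ) : 0 ≤ wordPhi c u := by
  induction u with
  | nil => simp
  | cons x u ih => rw [wordPhi_cons]; exact ih.trans (le_max_right _ _)

theorem letterEps_succ (c : ℕ) : letterEps c (c + 1) = 1 := by simp [letterEps]
theorem letterPhi_succ (c : ℕ) : letterPhi c (c + 1) = 0 := by simp [letterPhi]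
theorem letterEps_self (c : ℕ) : letterEps c c = 0 := by simp [letterEps]
theorem letterPhi_self (c : ℕ) : letterPhi c c = 1 := by simp [letterPhi]
theorem letterWt_succ (c : ℕ) : letterWt c (c + 1) = -1 := by simp [letterWt, letterPhi, letterEps]
theorem letterWt_self (c : ℕ) : letterWt c c = 1 := by simp [letterWt, letterPhi, letterEps]

/-- The tensor product rule unrolled: the letter acted on has nothing of `φ` left before it and
nothing of `ε` left after it. This serves as the working description of the operator. Its symmetry
with `wordF_eq_some` makes raising and lowering mutually inverse. -/
theorem wordE_eq_some {c : ℕ} {w w' : List ℕ} : wordE c w = some w' ↔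
    ∃ u v, w = u ++ (c + 1) :: v ∧ w' = u ++ c :: v ∧ wordPhi c u = 0 ∧ wordEps c v = 0 := by
  induction w generalizing w' with
  | nil => simp [wordE]
  | cons x t ih =>
    rw [wordE]
    have hE := wordEps_nonneg c t
    split_ifs with h1 h2
    · subst h2
      rw [letterPhi_succ] at h1
      simp only [Option.some.injEq]
      constructor
      · rintro rfl
        exact ⟨[], t, rfl, rfl, rfl, by omega⟩
      · rintro ⟨u, v, h3, h4, h5, h6⟩
        cases u with
        | nil => simp at h3 h4; rw [h4, h3]
        | cons y u =>
          exfalso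
          simp only [List.cons_append, List.cons.injEq] at h3
          rw [h3.2, wordEps_append, wordEps_cons, letterEps_succ] at h1
          rw [wordPhi_cons] at h5
          have := letterPhi_nonneg c y
          omega
    · simp only [false_iff, not_exists, not_and]
      intro u v h3 h4 h5 h6
      cases u with
      | nil => simp at h3; exact h2 h3.1
      | cons y u =>
        simp only [List.cons_append, List.cons.injEq] at h3
        rw [h3.2, wordEps_append, wordEps_cons, letterEps_succ] at h1
        rw [wordPhi_cons, ← h3.1] at h5
        omega
    · simp only [Option.map_eq_some_iff, ih]
      have h0 := letterPhi_nonneg c x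
      constructor
      · rintro ⟨z, ⟨u, v, rfl, rfl, h5, h6⟩, rfl⟩
        refine ⟨x :: u, v, rfl, rfl, ?_, h6⟩
        rw [wordEps_append, wordEps_cons, letterEps_succ, letterWt_succ] at h1
        rw [wordPhi_cons]
        unfold wordPhi at h5 ⊢
        omega
      · rintro ⟨u, v, h3, rfl, h5, h6⟩
        cases u with
        | nil => simp at h3; rw [h3.2] at h1; omega
        | cons y u =>
          simp only [List.cons_append, List.cons.injEq] at h3
          obtain ⟨rfl, rfl⟩ := h3
          refine ⟨u ++ c :: v, ⟨u, v, rfl, rfl, ?_, h6⟩, rfl⟩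
          rw [wordPhi_cons] at h5
          have := wordPhi_nonneg c u
          omega

theorem wordF_eq_some {c : ℕ} {w w' : List ℕ} : wordF c w = some w' ↔
    ∃ u v, w = u ++ c :: v ∧ w' = u ++ (c + 1) :: v ∧ wordPhi c u = 0 ∧ wordEps c v = 0 := by
  induction w generalizing w' with
  | nil => simp [wordF]
  | cons x t ih =>
    rw [wordF]
    have hE := wordEps_nonneg c t
    split_ifs with h1 h2
    · subst h2
      rw [letterPhi_self] at h1
      simp only [Option.some.injEq]
      constructor
      · rintro rfl
        exact ⟨[], t, rfl, rfl, rfl, by omega⟩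
      · rintro ⟨u, v, h3, h4, h5, h6⟩
        cases u with
        | nil => simp at h3 h4; rw [h4, h3]
        | cons y u =>
          exfalso
          simp only [List.cons_append, List.cons.injEq] at h3
          rw [wordPhi_cons, ← h3.1, letterPhi_self] at h5
          rw [h3.2, wordEps_append, wordEps_cons, letterEps_self, letterWt_self, h6] at h1
          omega
    · have : letterPhi c x = 0 := by simp [letterPhi, h2]
      omega
    · simp only [Option.map_eq_some_iff, ih]
      have h0 := letterPhi_nonneg c x
      constructor
      · rintro ⟨z, ⟨u, v, rfl, rfl, h5, h6⟩, rfl⟩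
        refine ⟨x :: u, v, rfl, rfl, ?_, h6⟩
        rw [wordEps_append, wordEps_cons, letterEps_self, letterWt_self] at h1
        rw [wordPhi_cons]
        unfold wordPhi at h5 ⊢
        omega
      · rintro ⟨u, v, h3, rfl, h5, h6⟩
        cases u with
        | nil =>
          simp at h3
          obtain ⟨rfl, rfl⟩ := h3
          rw [letterPhi_self] at h1; omega
        | cons y u =>
          simp only [List.cons_append, List.cons.injEq] at h3
          obtain ⟨rfl, rfl⟩ := h3
          refine ⟨u ++ (c + 1) :: v, ⟨u, v, rfl, rfl, ?_, h6⟩, rfl⟩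
          rw [wordPhi_cons] at h5
          have := wordPhi_nonneg c u
          omega

theorem wordE_eq_some_iff_wordF {c : ℕ} {w w' : List ℕ} :
    wordE c w = some w' ↔ wordF c w' = some w := by
  rw [wordE_eq_some, wordF_eq_some]
  constructor <;> rintro ⟨u, v, h1, h2, h3⟩ <;> exact ⟨u, v, h2, h1, h3⟩

theorem wordE_eq_none {c : ℕ} {w : List ℕ} : wordE c w = none ↔ wordEps c w = 0 := by
  induction w with
  | nil => simp [wordE]
  | cons x t ih =>
    have hE := wordEps_nonneg c t
    have h0 := letterPhi_nonneg c x
    have h3 := letterEps_nonneg c x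
    rw [wordE, wordEps_cons, letterWt]
    split_ifs with h1 h2
    · subst h2
      rw [letterEps_succ]; simp; omega
    · have : letterEps c x = 0 := by simp [letterEps, h2]
      simp; omega
    · rw [Option.map_eq_none_iff, ih]; omega

theorem wordF_eq_none {c : ℕ} {w : List ℕ} : wordF c w = none ↔ wordPhi c w = 0 := by
  induction w with
  | nil => simp [wordF]
  | cons x t ih =>
    have hE := wordEps_nonneg c t
    have h0 := letterPhi_nonneg c x
    have h4 := wordPhi_nonneg c t
    rw [wordF, wordPhi_cons]
    split_ifs with h1 h2
    · subst h2
      rw [letterPhi_self] at h1 ⊢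
      unfold wordPhi at h4 ⊢
      exact iff_of_false (by simp) (by omega)
    · have : letterPhi c x = 0 := by simp [letterPhi, h2]
      omega
    · rw [Option.map_eq_none_iff, ih]
      unfold wordPhi at h4 ⊢
      omega

/-! ### Letters without effect -/

theorem wordEps_wt_filter (c : ℕ) (u : List ℕ) :
    wordEps c (u.filter fun x => x = c ∨ x = c + 1) = wordEps c u ∧
      wordWt c (u.filter fun x => x = c ∨ x = c + 1) = wordWt c u := by
  induction u with
  | nil => simp
  | cons x u ih =>
    rw [List.filter_cons]
    split_ifs with h
    · simp only [wordEps_cons, wordWt_cons, ih]; simp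
    · simp only [decide_eq_true_eq, not_or] at h
      have h1 : letterEps c x = 0 := by simp [letterEps, h.2]
      have h2 : letterWt c x = 0 := by simp [letterWt, letterPhi, h.1, h1]
      have := wordEps_nonneg c u
      rw [wordEps_cons, wordWt_cons, ih.1, ih.2, h1, h2]
      omega

theorem wordEps_eq_of_filter {c : ℕ} {u v : List ℕ}
    (h : u.filter (fun x => x = c ∨ x = c + 1) = v.filter fun x => x = c ∨ x = c + 1) :
    wordEps c u = wordEps c v ∧ wordPhi c u = wordPhi c v := by
  have h1 := wordEps_wt_filter c u
  have h2 := wordEps_wt_filter c v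
  rw [h] at h1
  unfold wordPhi
  omega

/-- No letter of the word is changed by the operators of colour `c`. -/
def Inert (c : ℕ) (u : List ℕ) : Prop := ∀ x ∈ u, x ≠ c ∧ x ≠ c + 1

theorem Inert.eps_wt {c : ℕ} {u : List ℕ} (h : Inert c u) : wordEps c u = 0 ∧ wordWt c u = 0 := by
  have : u.filter (fun x => x = c ∨ x = c + 1) = [] := by
    simp only [List.filter_eq_nil_iff, decide_eq_true_eq, not_or]
    exact h
  have h1 := wordEps_wt_filter c u
  rw [this] at h1
  simpa [eq_comm] using h1

theorem inert_of_lt {c : ℕ} {u : List ℕ} (h : ∀ x ∈ u, x < c) : Inert c u := fun x hx => by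
  have := h x hx; omega

theorem inert_of_gt {c : ℕ} {u : List ℕ} (h : ∀ x ∈ u, c + 1 < x) : Inert c u := fun x hx => by
  have := h x hx; omega

theorem Inert.reverse {c : ℕ} {u : List ℕ} (h : Inert c u) : Inert c u.reverse :=
  fun x hx => h x (List.mem_reverse.1 hx)

theorem wordEps_perm_wt {c : ℕ} {u v : List ℕ} (h : u.Perm v) : wordWt c u = wordWt c v :=
  (h.map _).sum_eq

/-! ### Insertion of a letter into a column -/

theorem colInsert_append_left {a : ℕ} {V : List ℕ} (W : List ℕ) (h : ∀ x ∈ V, a < x) :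
    colInsert a (V ++ W) = (V ++ (colInsert a W).1, (colInsert a W).2) := by
  induction V with
  | nil => simp
  | cons x V ih =>
    have := h x (by simp)
    simp [colInsert, ih fun y hy => h y (by simp [hy]), Nat.not_le.2 this]

/-- A strictly decreasing column meets the letters `c` and `c + 1` in one of only four ways; the
parts above and below are inert for the colour `c`. All case analysis for insertion into a column
rests on this. -/
theorem exists_split {c : ℕ} {D : List ℕ} (h : D.Pairwise (· > ·)) :
    ∃ V mid U, D = V ++ (mid ++ U) ∧ (∀ x ∈ V, c + 1 < x) ∧ (∀ x ∈ U, x < c) ∧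
      (mid = [] ∨ mid = [c] ∨ mid = [c + 1] ∨ mid = [c + 1, c]) := by
  induction D with
  | nil => exact ⟨[], [], [], rfl, by simp, by simp, by simp⟩
  | cons x D ih =>
    obtain ⟨h1, h2⟩ := List.pairwise_cons.1 h
    obtain ⟨V, mid, U, rfl, h3, h4, h5⟩ := ih h2
    by_cases hx : c + 1 < x
    · refine ⟨x :: V, mid, U, rfl, ?_, h4, h5⟩
      intro y hy
      rcases List.mem_cons.1 hy with rfl | hy
      · exact hx
      · exact h3 y hy
    have hV : V = [] := by
      cases V with
      | nil => rfl
      | cons y V =>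
        have := h1 y (by simp)
        have := h3 y (by simp)
        omega
    subst hV
    rcases lt_trichotomy x c with hx' | rfl | hx'
    · have hm : mid = [] := by
        cases mid with
        | nil => rfl
        | cons y mid =>
          have := h1 y (by simp)
          rcases h5 with h5 | h5 | h5 | h5 <;> simp at h5 <;> omega
      subst hm
      refine ⟨[], [], x :: U, rfl, by simp, ?_, by simp⟩
      intro y hy
      rcases List.mem_cons.1 hy with rfl | hy
      · exact hx'
      · exact h4 y hy
    · have hm : mid = [] := by
        cases mid with
        | nil => rfl
        | cons y mid =>
          have := h1 y (by simp)
          rcases h5 with h5 | h5 | h5 | h5 <;> simp at h5 <;> omega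
      subst hm
      exact ⟨[], [x], U, rfl, by simp, h4, by simp⟩
    · obtain rfl : x = c + 1 := by omega
      refine ⟨[], (c + 1) :: mid, U, rfl, by simp, h4, ?_⟩
      rcases h5 with rfl | rfl | rfl | rfl
      · simp
      · simp
      · have := h1 (c + 1) (by simp); omega
      · have := h1 (c + 1) (by simp); omega

theorem wordWt_colInsert (c x : ℕ) (D : List ℕ) :
    wordWt c ((colInsert x D).1.reverse ++ (colInsert x D).2.toList) =
      wordWt c (x :: D.reverse) := by
  apply wordEps_perm_wt
  rcases colInsert_cases x D with ⟨h1, h2⟩ | ⟨C1, b, C2, rfl, h2, h3, h4⟩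
  · rw [h2]; simp
  · rw [h4]
    rw [← Multiset.coe_eq_coe]
    simp only [List.reverse_append, List.reverse_cons, Option.toList_some, ← Multiset.coe_add,
      ← Multiset.cons_coe, ← Multiset.singleton_add, Multiset.coe_nil, Multiset.coe_reverse]
    abel

theorem colInsert_append_some {a b : ℕ} {V V' : List ℕ} (W : List ℕ)
    (h : colInsert a V = (V', some b)) : colInsert a (V ++ W) = (V' ++ W, some b) := by
  rcases colInsert_cases a V with ⟨h1, h2⟩ | ⟨C1, b, C2, rfl, h2, h3, h4⟩
  · rw [h2] at h; simp at h
  · rw [h4] at h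
    simp only [Prod.mk.injEq, Option.some.injEq] at h
    obtain ⟨rfl, rfl⟩ := h
    rw [List.append_assoc, List.cons_append, colInsert_append_cons h2 h3]
    simp

theorem colInsert_of_forall_ge {a : ℕ} {U : List ℕ} (h : ∀ x ∈ U, x ≤ a) :
    colInsert a U = (a :: U.tail, U.head?) := by
  cases U with
  | nil => simp [colInsert]
  | cons x U => simp [colInsert, h x (by simp)]

theorem letter_of_ne {c x : ℕ} (h1 : x ≠ c) (h2 : x ≠ c + 1) :
    letterEps c x = 0 ∧ letterPhi c x = 0 ∧ letterWt c x = 0 := by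
  simp [letterEps, letterPhi, letterWt, h1, h2]

/-- A Knuth-type invariance: the word of the letter followed by the old column and that of the new
column followed by the bumped letter agree in `ε`. Inserting into an inert part changes nothing for
the colour `c`; what is left is the insertion of a letter at least `c` into the four possible middle
parts. -/
theorem wordEps_colInsert {c x : ℕ} {D : List ℕ} (hD : D.Pairwise (· > ·)) :
    wordEps c ((colInsert x D).1.reverse ++ (colInsert x D).2.toList) =
      wordEps c (x :: D.reverse) := by
  obtain ⟨V, mid, U, rfl, h3, h4, h5⟩ := exists_split (c := c) hD
  have iV := (inert_of_gt h3).reverse.eps_wt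
  have iU := (inert_of_lt h4).reverse.eps_wt
  have iUt : wordEps c U.tail.reverse = 0 ∧ wordWt c U.tail.reverse = 0 :=
    (inert_of_lt fun x hx => h4 x (List.mem_of_mem_tail hx)).reverse.eps_wt
  have iUh : wordEps c U.head?.toList = 0 ∧ wordWt c U.head?.toList = 0 := by
    refine (inert_of_lt fun x hx => h4 x ?_).eps_wt
    simp at hx
    exact List.mem_of_mem_head? hx
  rcases colInsert_cases x V with ⟨h6, h7⟩ | ⟨V1, v, V2, rfl, h6, h7, h8⟩
  · rw [colInsert_append_left _ h6]
    rcases lt_or_ge x c with hx | hx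
    · have hm : ∀ y ∈ mid, x < y := by
        intro y hy
        rcases h5 with rfl | rfl | rfl | rfl <;> simp at hy <;> omega
      rw [colInsert_append_left _ hm]
      have lx := letter_of_ne (show x ≠ c by omega) (show x ≠ c + 1 by omega)
      have iU2 : wordEps c ((colInsert x U).1).reverse = 0 ∧
          wordWt c ((colInsert x U).1).reverse = 0 ∧ wordEps c ((colInsert x U).2).toList = 0 := by
        rcases colInsert_cases x U with ⟨g1, g2⟩ | ⟨C1, b, C2, rfl, g2, g3, g4⟩
        · rw [g2]
          have := (inert_of_lt (c := c) (u := U ++ [x]) (by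
            intro y hy
            rcases List.mem_append.1 hy with hy | hy
            · exact h4 y hy
            · simp at hy; omega)).reverse.eps_wt
          exact ⟨this.1, this.2, by simp⟩
        · rw [g4]
          have := (inert_of_lt (c := c) (u := C1 ++ x :: C2) (by
            intro y hy
            simp only [List.mem_append, List.mem_cons] at hy h4
            rcases hy with hy | rfl | hy
            · exact h4 y (by simp [hy])
            · exact hx
            · exact h4 y (by simp [hy]))).reverse.eps_wt
          exact ⟨this.1, this.2, (inert_of_lt (c := c) (u := [b]) (by
            intro y hy
            exact h4 y (by simp at hy ⊢; simp [hy]))).eps_wt.1⟩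
      simp only [List.reverse_append, List.append_assoc, wordEps_append, wordEps_cons,
        lx, iU2, iV, iU]
      omega
    · have hxU : ∀ y ∈ U, y ≤ x := fun y hy => by have := h4 y hy; omega
      have hxcU : ∀ y ∈ c :: U, y ≤ x := by
        intro y hy
        rcases List.mem_cons.1 hy with rfl | hy
        · exact hx
        · exact hxU y hy
      rcases hx.lt_or_eq with hx | rfl
      · have hsx : c + 1 ≤ x := hx
        have lx : letterPhi c x = 0 := by simp [letterPhi]; omega
        have lx' := letterEps_nonneg c x
        have lx'' : letterEps c x ≤ 1 := by unfold letterEps; split_ifs <;> simp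
        have hall : ∀ y ∈ mid ++ U, y ≤ x := by
          intro y hy
          rcases List.mem_append.1 hy with hy | hy
          · rcases h5 with rfl | rfl | rfl | rfl <;> simp at hy <;> omega
          · exact hxU y hy
        rw [colInsert_of_forall_ge hall]
        rcases h5 with rfl | rfl | rfl | rfl
        · simp only [List.nil_append, List.reverse_append, List.reverse_cons, List.append_assoc,
            wordEps_append, wordEps_cons, wordWt_cons, wordEps_nil, wordWt_nil,
            letterWt, lx, iV, iU, iUt, iUh]
          omega
        · simp only [List.singleton_append, List.tail_cons, List.head?_cons, Option.toList_some,
            List.reverse_append, List.reverse_cons, List.append_assoc,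
            wordEps_append, wordEps_cons, wordWt_cons, wordEps_nil,
            letterWt, lx, iV, iU, letterEps_self, letterPhi_self]
          omega
        · simp only [List.singleton_append, List.tail_cons, List.head?_cons, Option.toList_some,
            List.reverse_append, List.reverse_cons, List.append_assoc,
            wordEps_append, wordEps_cons, wordWt_cons, wordEps_nil,
            letterWt, lx, iV, iU, letterEps_succ, letterPhi_succ]
          omega
        · simp only [List.cons_append, List.tail_cons, List.head?_cons, Option.toList_some,
            List.reverse_append, List.reverse_cons, List.append_assoc, List.nil_append,
            wordEps_append, wordEps_cons, wordEps_nil,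
            letterWt, lx, iV, iU, letterEps_succ, letterPhi_succ, letterEps_self, letterPhi_self]
          omega
      · rcases h5 with rfl | rfl | rfl | rfl
        · rw [List.nil_append, colInsert_of_forall_ge hxU]
          simp only [List.reverse_append, List.reverse_cons, List.append_assoc,
            wordEps_append, wordEps_cons, wordWt_cons, wordEps_nil, wordWt_nil,
            iV, iU, iUt, iUh, letterEps_self, letterWt_self]
          omega
        · rw [List.singleton_append, colInsert_of_forall_ge hxcU]
          simp only [List.tail_cons, List.head?_cons, Option.toList_some,
            List.reverse_append, List.reverse_cons, List.append_assoc,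
            wordEps_append, wordEps_cons, wordWt_cons, wordEps_nil, wordWt_nil,
            iV, iU, letterEps_self, letterWt_self]
          omega
        · rw [colInsert_append_left (V := [c + 1]) _ (by simp), colInsert_of_forall_ge hxU]
          simp only [List.cons_append, List.reverse_append, List.reverse_cons, List.append_assoc,
            List.nil_append, wordEps_append, wordEps_cons,
            iV, iU, iUt, iUh, letterEps_self, letterWt_self, letterEps_succ,
            letterWt_succ]
          omega
        · rw [show [c + 1, c] ++ U = [c + 1] ++ (c :: U) from rfl,
            colInsert_append_left (V := [c + 1]) _ (by simp), colInsert_of_forall_ge hxcU]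
          simp only [List.tail_cons, List.head?_cons, Option.toList_some, List.cons_append,
            List.reverse_append, List.reverse_cons, List.append_assoc,
            List.nil_append, wordEps_append, wordEps_cons, wordEps_nil,
            iV, iU, letterEps_self, letterWt_self, letterEps_succ, letterWt_succ]
          omega
  · rw [colInsert_append_some _ h8]
    have hv := h3 v (by simp)
    have iV1 := (inert_of_gt (c := c) (u := V1 ++ x :: V2) (by
      intro y hy
      simp only [List.mem_append, List.mem_cons] at hy h3
      rcases hy with hy | rfl | hy
      · exact h3 y (by simp [hy])
      · omega
      · exact h3 y (by simp [hy]))).reverse.eps_wt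
    have lx := letter_of_ne (show x ≠ c by omega) (show x ≠ c + 1 by omega)
    have lv := letter_of_ne (show v ≠ c by omega) (show v ≠ c + 1 by omega)
    have hm := wordEps_nonneg c mid.reverse
    generalize V1 ++ x :: V2 = W at iV1 ⊢
    generalize V1 ++ v :: V2 = V at iV ⊢
    simp only [List.reverse_append, List.append_assoc, Option.toList_some, wordEps_append,
      wordEps_cons, wordEps_nil, lx, lv, iV1, iV, iU]
    omega

/-- The operators of colour `c` commute with the insertion of a letter into a column. -/
theorem wordE_colInsert {c x : ℕ} {D X : List ℕ} (hD : D.Pairwise (· > ·))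
    (hX : wordE c (x :: D.reverse) = some X) :
    ∃ x' D', X = x' :: D'.reverse ∧ D'.Pairwise (· > ·) ∧
      (colInsert x' D').2.isSome = (colInsert x D).2.isSome ∧
      wordE c ((colInsert x D).1.reverse ++ (colInsert x D).2.toList) =
        some ((colInsert x' D').1.reverse ++ (colInsert x' D').2.toList) := by
  obtain ⟨u, v, h1, rfl, h3, h4⟩ := wordE_eq_some.1 hX
  -- Either the operator changes the inserted letter `x = c + 1`, or it changes an entry `c + 1` of
  -- the column.
  cases u with
  | nil =>
    simp only [List.nil_append, List.cons.injEq] at h1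
    obtain ⟨rfl, rfl⟩ := h1
    refine ⟨c, D, rfl, hD, ?_⟩
    obtain ⟨V, mid, U, rfl, h5, h6, h7⟩ := exists_split (c := c) hD
    have hUc : ∀ y ∈ U, y ≤ c := fun y hy => (h6 y hy).le
    have hUc1 : ∀ y ∈ U, y ≤ c + 1 := fun y hy => by have := h6 y hy; omega
    have iU := (inert_of_lt h6).reverse.eps_wt
    have iV := (inert_of_gt h5).reverse.eps_wt
    have iUt : wordEps c U.tail.reverse = 0 ∧ wordWt c U.tail.reverse = 0 :=
      (inert_of_lt fun x hx => h6 x (List.mem_of_mem_tail hx)).reverse.eps_wt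
    have iUh : wordEps c U.head?.toList = 0 ∧ wordWt c U.head?.toList = 0 := by
      refine (inert_of_lt fun x hx => h6 x ?_).eps_wt
      simp at hx
      exact List.mem_of_mem_head? hx
    rw [colInsert_append_left _ h5, colInsert_append_left _ fun y hy => (by
      have := h5 y hy; omega : c < y)]
    rcases h7 with rfl | rfl | rfl | rfl
    · rw [List.nil_append, colInsert_of_forall_ge hUc, colInsert_of_forall_ge hUc1]
      refine ⟨rfl, wordE_eq_some.2 ⟨U.tail.reverse, V.reverse ++ U.head?.toList, by simp, by simp,
        ?_, ?_⟩⟩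
      · simp [wordPhi, iUt]
      · simp [wordEps_append, iV, iUh]
    · rw [colInsert_of_forall_ge (a := c) (U := [c] ++ U) (by
          intro y hy; simp at hy; rcases hy with rfl | hy
          · exact le_rfl
          · exact hUc y hy),
        colInsert_of_forall_ge (a := c + 1) (U := [c] ++ U) (by
          intro y hy; simp at hy; rcases hy with rfl | hy
          · omega
          · exact hUc1 y hy)]
      refine ⟨rfl, wordE_eq_some.2 ⟨U.reverse, V.reverse ++ [c], by simp, by simp, ?_, ?_⟩⟩
      · simp [wordPhi, iU]
      · simp [wordEps_append, wordEps_cons, iV, letterEps_self, letterWt_self]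
    -- A column with `c + 1` but without `c` has positive `ε`, so the operator would not have acted
    -- on the inserted letter.
    · exfalso
      simp only [List.reverse_append, List.reverse_singleton, List.append_assoc, wordEps_append,
        iU, iV, wordEps_cons, letterEps_succ, wordEps_nil] at h4
      omega
    -- Here `c + 1` bumps `c + 1` and `c` bumps `c`: the column is unchanged in both cases and the
    -- change is passed on to the bumped letter.
    · rw [show [c + 1, c] ++ U = [c + 1] ++ (c :: U) from rfl,
        colInsert_append_left (a := c) (V := [c + 1]) _ (by simp),
        colInsert_of_forall_ge (a := c) (U := c :: U) (by
          intro y hy; simp at hy; rcases hy with rfl | hy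
          · exact le_rfl
          · exact hUc y hy),
        colInsert_of_forall_ge (a := c + 1) (U := [c + 1] ++ c :: U) (by
          intro y hy; simp at hy; rcases hy with rfl | rfl | hy
          · omega
          · omega
          · exact hUc1 y hy)]
      refine ⟨rfl, wordE_eq_some.2 ⟨(V ++ (c + 1) :: c :: U).reverse, [], by simp, by simp, ?_, rfl⟩⟩
      simp only [wordPhi, List.reverse_append, List.reverse_cons, List.append_assoc,
        List.cons_append, List.nil_append, wordEps_append, wordEps_cons, wordWt_append, wordWt_cons,
        iU, iV, letterEps_succ, letterEps_self, letterWt_succ, letterWt_self]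
      omega
  | cons y u =>
    simp only [List.cons_append, List.cons.injEq] at h1
    obtain ⟨rfl, h1⟩ := h1
    obtain rfl : D = v.reverse ++ (c + 1) :: u.reverse := by
      have := congrArg List.reverse h1
      simpa using this
    rw [wordPhi_cons] at h3
    have hu0 : wordPhi c u = 0 := by
      have := wordPhi_nonneg c u
      omega
    obtain ⟨p1, p2, p3⟩ := List.pairwise_append.1 hD
    have p4 := List.pairwise_cons.1 p2
    have hv : ∀ y ∈ v.reverse, c + 1 < y := fun y hy => p3 y hy (c + 1) (by simp)
    -- An entry `c` just above the entry `c + 1` would make `φ` of the prefix positive.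
    have hu1 : ∀ y ∈ u.reverse, y < c := by
      intro y hy
      have := p4.1 y hy
      rcases (show y < c ∨ y = c by omega) with h | rfl
      · exact h
      exfalso
      have hyu : y ∈ u := by simpa using hy
      obtain ⟨a, b, rfl⟩ := List.append_of_mem hyu
      have hb : Inert y b := by
        intro z hz
        have hz' := p4.1 z (by simp [hz])
        have := p4.2
        simp only [List.reverse_append, List.reverse_cons, List.append_assoc] at this
        have := (List.pairwise_append.1 this).2.2 z (by simp [hz]) y (by simp)
        omega
      rw [wordPhi_append, wordPhi_cons, letterPhi_self, hb.eps_wt.2] at hu0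
      omega
    have iu := (inert_of_lt hu1).reverse.eps_wt
    rw [List.reverse_reverse] at iu
    have hxc : x ≠ c := by
      rintro rfl
      rw [letterPhi_self, iu.2] at h3
      omega
    have iv := (inert_of_gt hv).eps_wt
    have ivr := (inert_of_gt hv).reverse.eps_wt
    refine ⟨x, v.reverse ++ c :: u.reverse, by simp, ?_, ?_⟩
    · refine List.pairwise_append.2 ⟨p1, List.pairwise_cons.2 ⟨hu1, p4.2⟩, ?_⟩
      intro a ha b hb
      rcases List.mem_cons.1 hb with rfl | hb
      · have := hv a ha; omega
      · exact p3 a ha b (by simp [hb])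
    rcases colInsert_cases x v.reverse with ⟨h6, h7⟩ | ⟨V1, b, V2, h5, h6, h7, h8⟩
    · rw [colInsert_append_left _ h6, colInsert_append_left _ h6]
      rcases lt_or_ge x c with hx | hx
      · rw [← List.singleton_append (x := c + 1), ← List.singleton_append (x := c),
          colInsert_append_left (V := [c + 1]) _ (by simp; omega),
          colInsert_append_left (V := [c]) _ (by simpa)]
        refine ⟨rfl, wordE_eq_some.2 ⟨(colInsert x u.reverse).1.reverse,
          v ++ (colInsert x u.reverse).2.toList, by simp, by simp, ?_, ?_⟩⟩
        · have : Inert c (colInsert x u.reverse).1 := by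
            rcases colInsert_cases x u.reverse with ⟨g1, g2⟩ | ⟨C1, b, C2, g1, g2, g3, g4⟩
            · rw [g2]
              intro y hy
              rcases List.mem_append.1 hy with hy | hy
              · have := hu1 y hy; omega
              · simp at hy; omega
            · rw [g4]
              rw [g1] at hu1
              intro y hy
              simp only [List.mem_append, List.mem_cons] at hy hu1
              rcases hy with hy | rfl | hy
              · have := hu1 y (by simp [hy]); omega
              · omega
              · have := hu1 y (by simp [hy]); omega
          simp [wordPhi, this.reverse.eps_wt]
        · have : Inert c ((colInsert x u.reverse).2.toList) := by
            rcases colInsert_cases x u.reverse with ⟨g1, g2⟩ | ⟨C1, b, C2, g1, g2, g3, g4⟩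
            · rw [g2]; simp [Inert]
            · rw [g4]
              rw [g1] at hu1
              have := hu1 b (by simp)
              simp [Inert]; omega
          rw [List.reverse_reverse] at ivr
          simp [wordEps_append, ivr, this.eps_wt]
      · have hx' : c < x := by omega
        rw [colInsert_of_forall_ge (U := (c + 1) :: u.reverse) (by
            intro y hy; rcases List.mem_cons.1 hy with rfl | hy
            · omega
            · have := hu1 y hy; omega),
          colInsert_of_forall_ge (U := c :: u.reverse) (by
            intro y hy; rcases List.mem_cons.1 hy with rfl | hy
            · omega
            · have := hu1 y hy; omega)]
        refine ⟨rfl, wordE_eq_some.2 ⟨(v.reverse ++ x :: u.reverse).reverse, [], by simp, by simp,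
          ?_, rfl⟩⟩
        have lx : letterPhi c x = 0 := by simp [letterPhi, hxc]
        have lx' := letterEps_nonneg c x
        rw [List.reverse_reverse] at ivr
        simp only [wordPhi, List.reverse_append, List.reverse_cons, List.reverse_reverse,
          List.append_assoc, List.cons_append, List.nil_append, wordEps_append, wordEps_cons,
          wordWt_append, wordWt_cons, iu, ivr, letterWt, lx]
        omega
    · rw [h5, List.append_assoc, List.append_assoc, List.cons_append, List.cons_append,
        colInsert_append_cons h6 h7, colInsert_append_cons h6 h7]
      have hb := hv b (by rw [h5]; simp)
      refine ⟨rfl, wordE_eq_some.2 ⟨u, (V1 ++ x :: V2).reverse ++ [b], by simp, by simp,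
        hu0, ?_⟩⟩
      have : Inert c ((V1 ++ x :: V2).reverse ++ [b]) := by
        rw [h5] at hv
        intro y hy
        simp only [List.mem_append, List.mem_reverse, List.mem_cons, List.not_mem_nil,
          or_false] at hy hv
        rcases hy with (hy | rfl | hy) | rfl
        · have := hv y (by simp [hy]); omega
        · omega
        · have := hv y (by simp [hy]); omega
        · omega
      exact this.eps_wt.1

/-! ### Raising operators on biwords and on matrices -/

theorem wordE_append (c : ℕ) (u v : List ℕ) : wordE c (u ++ v) =
    if wordEps c v ≤ wordPhi c u then (wordE c u).map (· ++ v)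
    else (wordE c v).map (u ++ ·) := by
  induction u with
  | nil =>
    split_ifs with h
    · have := wordEps_nonneg c v
      rw [wordPhi_nil] at h
      simpa [wordE] using wordE_eq_none.2 (le_antisymm h this)
    · simp
  | cons x u ih =>
    rw [List.cons_append, wordE, wordE, wordEps_append, ih, wordPhi_cons]
    have hu : wordPhi c u = wordEps c u + wordWt c u := rfl
    split_ifs <;> first | (exfalso; omega) | simp [Function.comp_def]

/-- The biword `M` is obtained by the raising operator of colour `c` acting on the letters. -/
def RaiseLetters (c : ℕ) (L M : List (ℕ × ℕ)) : Prop :=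
  M.map Prod.fst = L.map Prod.fst ∧ wordE c (L.map Prod.snd) = some (M.map Prod.snd)

theorem wordE_length {c : ℕ} {u v : List ℕ} (h : wordE c u = some v) : v.length = u.length := by
  obtain ⟨a, b, rfl, rfl, -, -⟩ := wordE_eq_some.1 h
  simp

theorem wordF_length {c : ℕ} {u v : List ℕ} (h : wordF c u = some v) : v.length = u.length := by
  obtain ⟨a, b, rfl, rfl, -, -⟩ := wordF_eq_some.1 h
  simp

/-- One step turns letter, column, bumped word into new column, bumped letter, bumped word; by
`wordEps_colInsert` and `wordWt_colInsert` it changes neither `ε` nor the weight. -/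
theorem wordEps_wt_peel (c : ℕ) (L : List (ℕ × ℕ)) :
    wordEps c ((pcol L).reverse ++ (pout L).map Prod.snd) = wordEps c (L.map Prod.snd) ∧
      wordWt c ((pcol L).reverse ++ (pout L).map Prod.snd) = wordWt c (L.map Prod.snd) := by
  induction L with
  | nil => simp
  | cons p L ih =>
    have h1 := wordEps_colInsert (c := c) (x := p.2) (pcol_pairwise L)
    have h2 := wordWt_colInsert c p.2 (pcol L)
    have h3 : (pout (p :: L)).map Prod.snd =
        (colInsert p.2 (pcol L)).2.toList ++ (pout L).map Prod.snd := by
      rw [pout_cons]; simp [Function.comp_def]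
    have h4 := wordEps_append c (p.2 :: (pcol L).reverse) ((pout L).map Prod.snd)
    have h5 := wordWt_append c (p.2 :: (pcol L).reverse) ((pout L).map Prod.snd)
    rw [List.cons_append, wordEps_cons, ih.1] at h4
    rw [List.cons_append, wordWt_cons, ih.2] at h5
    rw [h3, pcol_cons, ← List.append_assoc, wordEps_append, wordWt_append c (_ ++ _), h1, h2, ← h4,
      ← h5, List.map_cons, wordEps_cons, wordWt_cons]
    exact ⟨rfl, rfl⟩

/-- The raising operators on the letters commute with peeling off the first column. -/
theorem RaiseLetters.peel {c : ℕ} {L M : List (ℕ × ℕ)} (h : RaiseLetters c L M) :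
    prec M = prec L ∧
    ((wordE c (pcol L).reverse = some (pcol M).reverse ∧ pout M = pout L ∧
        wordEps c ((pout L).map Prod.snd) ≤ wordPhi c (pcol L).reverse) ∨
      (pcol M = pcol L ∧ RaiseLetters c (pout L) (pout M) ∧
        wordPhi c (pcol L).reverse < wordEps c ((pout L).map Prod.snd))) := by
  induction L generalizing M with
  | nil => simp [RaiseLetters, wordE] at h
  | cons p L ih =>
    obtain ⟨h1, h2⟩ := h
    cases M with
    | nil => simp at h1
    | cons q M =>
      simp only [List.map_cons, List.cons.injEq] at h1 h2
      have hpout : ∀ (r : ℕ × ℕ) (N : List (ℕ × ℕ)), (pout (r :: N)).map Prod.snd =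
          (colInsert r.2 (pcol N)).2.toList ++ (pout N).map Prod.snd := by
        intro r N; rw [pout_cons]; simp [Function.comp_def]
      have hpout1 : ∀ (r : ℕ × ℕ) (N : List (ℕ × ℕ)), (pout (r :: N)).map Prod.fst =
          ((colInsert r.2 (pcol N)).2.toList.map fun _ => r.1) ++ (pout N).map Prod.fst := by
        intro r N; rw [pout_cons]; simp [Function.comp_def]
      have e1 := wordEps_colInsert (c := c) (x := p.2) (pcol_pairwise L)
      have e2 := wordWt_colInsert c p.2 (pcol L)
      have hmid : wordPhi c ((colInsert p.2 (pcol L)).1.reverse ++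
          (colInsert p.2 (pcol L)).2.toList) = wordPhi c (p.2 :: (pcol L).reverse) := by
        rw [wordPhi, e1, e2, wordPhi]
      have hpeel := wordEps_wt_peel c L
      -- the operator acts on the letter and the column
      have caseA : ∀ x' D', wordE c (p.2 :: (pcol L).reverse) = some (x' :: D'.reverse) →
          D'.Pairwise (· > ·) →
          wordEps c ((pout L).map Prod.snd) ≤ wordPhi c (p.2 :: (pcol L).reverse) →
          x' = q.2 → D' = pcol M → prec M = prec L → pout M = pout L →
          prec (q :: M) = prec (p :: L) ∧
          ((wordE c (pcol (p :: L)).reverse = some (pcol (q :: M)).reverse ∧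
              pout (q :: M) = pout (p :: L) ∧
              wordEps c ((pout (p :: L)).map Prod.snd) ≤ wordPhi c (pcol (p :: L)).reverse) ∨
            (pcol (q :: M) = pcol (p :: L) ∧ RaiseLetters c (pout (p :: L)) (pout (q :: M)) ∧
              wordPhi c (pcol (p :: L)).reverse < wordEps c ((pout (p :: L)).map Prod.snd))) := by
        rintro x' D' hx' - hle rfl rfl hr ho
        obtain ⟨x2, D2, g1, g2, g3, g4⟩ := wordE_colInsert (pcol_pairwise L) hx'
        simp only [List.cons.injEq, List.reverse_inj] at g1
        obtain ⟨rfl, rfl⟩ := g1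
        refine ⟨by rw [prec_cons, prec_cons, g3, hr, h1.1], ?_⟩
        -- After the insertion the changed letter is either in the new column, and the bumped words
        -- coincide, or it is the letter bumped at this very step, and the columns coincide.
        rw [wordE_append] at g4
        split_ifs at g4 with hs
        · left
          simp only [Option.map_eq_some_iff] at g4
          obtain ⟨z, hz, hz'⟩ := g4
          have hl := congrArg List.length hz'
          have hl2 := wordE_length hz
          have hlen : z.length = (colInsert q.2 (pcol M)).1.reverse.length := by
            have : (colInsert p.2 (pcol L)).2.toList.length =
                (colInsert q.2 (pcol M)).2.toList.length := by
              revert g3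
              cases (colInsert p.2 (pcol L)).2 <;> cases (colInsert q.2 (pcol M)).2 <;> simp
            simp only [List.length_append] at hl
            omega
          obtain ⟨rfl, hb⟩ := List.append_inj hz' hlen
          refine ⟨hz, ?_, ?_⟩
          · rw [pout_cons, pout_cons, ho, h1.1, hb]
          · rw [hpout, pcol_cons, wordEps_append]
            rw [← hmid, wordPhi_append] at hle
            unfold wordPhi at *
            omega
        · right
          simp only [Option.map_eq_some_iff] at g4
          obtain ⟨z, hz, hz'⟩ := g4
          have hl := congrArg List.length hz'
          have hl2 := wordE_length hz
          have hlen : (colInsert p.2 (pcol L)).1.reverse.length =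
              (colInsert q.2 (pcol M)).1.reverse.length := by
            have : (colInsert p.2 (pcol L)).2.toList.length =
                (colInsert q.2 (pcol M)).2.toList.length := by
              revert g3
              cases (colInsert p.2 (pcol L)).2 <;> cases (colInsert q.2 (pcol M)).2 <;> simp
            simp only [List.length_append] at hl
            omega
          obtain ⟨hc, rfl⟩ := List.append_inj hz' hlen
          refine ⟨by rw [pcol_cons, pcol_cons]; exact (List.reverse_inj.1 hc).symm, ⟨?_, ?_⟩, ?_⟩
          · rw [hpout1, hpout1, ho, h1.1]
            revert g3
            cases (colInsert p.2 (pcol L)).2 <;> cases (colInsert q.2 (pcol M)).2 <;> simp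
          · rw [hpout, hpout, wordE_append, ho, hz, if_pos, Option.map_some]
            rw [← hmid, wordPhi_append] at hle
            generalize (colInsert p.2 (pcol L)).2.toList = B at *
            have := (wordE_eq_some (c := c) (w := B)).1 hz
            unfold wordPhi at *
            omega
          · rw [hpout, pcol_cons, wordEps_append]
            omega
      -- The operator acts on the newest letter, or on the column built from the earlier ones, or on
      -- a letter bumped earlier. The first two are `caseA`; in the third the newest step is the
      -- same for both biwords.
      rw [wordE] at h2
      split_ifs at h2 with h3 h4
      · simp only [Option.some.injEq, List.cons.injEq] at h2
        have hML : M = L := by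
          have hz : ∀ N : List (ℕ × ℕ), N = (N.map Prod.fst).zip (N.map Prod.snd) := by
            intro N; rw [← List.unzip_fst, ← List.unzip_snd, List.zip_unzip]
          rw [hz M, hz L, h1.2, h2.2]
        subst hML
        refine caseA c (pcol M) ?_ (pcol_pairwise M) ?_ h2.1 rfl rfl rfl
        · rw [wordE, if_pos, if_pos h4]
          rw [← hpeel.1, wordEps_append] at h3
          omega
        · rw [← hpeel.1, wordEps_append] at h3
          rw [wordPhi_cons]
          unfold wordPhi
          omega
      · rw [Option.map_eq_some_iff] at h2
        obtain ⟨z, hz, hz'⟩ := h2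
        simp only [List.cons.injEq] at hz'
        obtain ⟨hpq, rfl⟩ := hz'
        rw [← hpeel.1, wordEps_append] at h3
        rcases ih ⟨h1.2, hz⟩ with ⟨i1, ⟨i2, i3, i4⟩ | ⟨i2, i3, i4⟩⟩
        · refine caseA p.2 (pcol M) ?_ (pcol_pairwise M) ?_ hpq rfl i1 i3
          · rw [wordE, if_neg, i2, Option.map_some]
            unfold wordPhi at i4
            omega
          · rw [wordPhi_cons]; omega
        · have hp : p = q := Prod.ext h1.1.symm hpq
          subst hp
          refine ⟨by rw [prec_cons, prec_cons, i2, i1], Or.inr ⟨by rw [pcol_cons, pcol_cons, i2],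
            ⟨?_, ?_⟩, ?_⟩⟩
          · rw [hpout1, hpout1, i2, i3.1]
          · rw [hpout, hpout, wordE_append, if_neg, i3.2, Option.map_some, i2]
            have : wordPhi c (p.2 :: (pcol L).reverse) < wordEps c ((pout L).map Prod.snd) := by
              rw [wordPhi_cons]
              unfold wordPhi at *
              omega
            rw [← hmid, wordPhi_append] at this
            omega
          · rw [hpout, pcol_cons, wordEps_append]
            have : wordPhi c (p.2 :: (pcol L).reverse) < wordEps c ((pout L).map Prod.snd) := by
              rw [wordPhi_cons]
              unfold wordPhi at *
              omega
            rw [← hmid, wordPhi_append] at this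
            omega

theorem zip_map_fst_snd (N : List (ℕ × ℕ)) : (N.map Prod.fst).zip (N.map Prod.snd) = N := by
  rw [← List.unzip_fst, ← List.unzip_snd, List.zip_unzip]

theorem RaiseLetters.split {c : ℕ} {L M : List (ℕ × ℕ)} (h : RaiseLetters c L M) :
    ∃ L1 k L2, L = L1 ++ (k, c + 1) :: L2 ∧ M = L1 ++ (k, c) :: L2 ∧
      wordPhi c (L1.map Prod.snd) = 0 ∧ wordEps c (L2.map Prod.snd) = 0 := by
  obtain ⟨h1, h2⟩ := h
  obtain ⟨u, v, h3, h4, h5, h6⟩ := wordE_eq_some.1 h2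
  obtain ⟨L1, L', rfl, rfl, h7⟩ := List.map_eq_append_iff.1 h3
  obtain ⟨p, L2, rfl, h8, rfl⟩ := List.map_eq_cons_iff.1 h7
  refine ⟨L1, p.1, L2, by rw [← h8], ?_, h5, h6⟩
  rw [← zip_map_fst_snd M, h1, h4, List.map_append, List.map_cons,
    List.zip_append (by simp), List.zip_cons_cons, zip_map_fst_snd, zip_map_fst_snd]

/-- Replacing `(k, c + 1)` by `(k, c)` breaks the order only if another `(k, c + 1)` follows
immediately, which `ε = 0` of the suffix forbids. In the other direction a preceding `(k, c)` is
forbidden by `φ = 0` of the prefix. -/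
theorem RaiseLetters.sorted_iff {c : ℕ} {L M : List (ℕ × ℕ)} (h : RaiseLetters c L M) :
    L.Pairwise omegaLE' ↔ M.Pairwise omegaLE' := by
  obtain ⟨L1, k, L2, rfl, rfl, h1, h2⟩ := h.split
  simp only [List.pairwise_append, List.pairwise_cons, List.mem_cons, forall_eq_or_imp]
  constructor
  · rintro ⟨g1, ⟨g2, g3⟩, g4⟩
    refine ⟨g1, ⟨?_, g3⟩, fun p hp => ⟨?_, (g4 p hp).2⟩⟩
    · intro q hq
      by_contra hn
      have hq' := g2 q hq
      have hqe : q = (k, c + 1) := by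
        unfold omegaLE' at hq' hn
        ext <;> simp only at hq' hn ⊢ <;> omega
      cases L2 with
      | nil => simp at hq
      | cons r L2 =>
        have hr : r = (k, c + 1) := by
          rcases List.mem_cons.1 hq with rfl | hq2
          · exact hqe
          · exact antisymm (hqe ▸ (List.pairwise_cons.1 g3).1 q hq2) (g2 r (by simp))
        rw [List.map_cons, wordEps_cons, hr, letterEps_succ] at h2
        omega
    · have := (g4 p hp).1
      unfold omegaLE' at this ⊢
      simp only at this ⊢; omega
  · rintro ⟨g1, ⟨g2, g3⟩, g4⟩
    refine ⟨g1, ⟨?_, g3⟩, fun p hp => ⟨?_, (g4 p hp).2⟩⟩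
    · intro q hq
      have := g2 q hq
      unfold omegaLE' at this ⊢
      simp only at this ⊢; omega
    · by_contra hn
      have hp' := (g4 p hp).1
      have hpe : p = (k, c) := by
        unfold omegaLE' at hp' hn
        ext <;> simp only at hp' hn ⊢ <;> omega
      rcases List.eq_nil_or_concat L1 with rfl | ⟨L1, r, rfl⟩
      · simp at hp
      · have hr : r = (k, c) := by
          simp only [List.concat_eq_append, List.mem_append, List.mem_singleton] at hp g1 g4
          rcases hp with hp2 | rfl
          · exact antisymm (g4 r (Or.inr rfl)).1
              (hpe ▸ (List.pairwise_append.1 g1).2.2 p hp2 r (by simp))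
          · exact hpe
        rw [List.concat_eq_append, List.map_append, wordPhi_append, hr] at h1
        simp [wordPhi, wordEps_cons, letterEps_self, letterWt_self] at h1
        omega

/-- Since raising keeps the biword sorted, forming the matrix and reading its biword again does not
reorder anything. -/
theorem matE_ofNat_succ {c : ℕ} {A B : Mat} :
    matE (Int.ofNat (c + 1)) A = some B ↔ RaiseLetters c (biword' A) (biword' B) := by
  simp only [matE, actCols, Option.map_eq_some_iff]
  constructor
  · rintro ⟨u, hu, rfl⟩
    have hl := wordE_length hu
    have h1 : RaiseLetters c (biword' A) (((biword' A).map Prod.fst).zip u) := by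
      refine ⟨List.map_fst_zip (by simpa using hl.ge), ?_⟩
      rw [List.map_snd_zip (by simpa using hl.le), hu]
    rwa [biword'_ofBiword (h1.sorted_iff.1 (biword'_sorted A))]
  · intro h
    refine ⟨_, h.2, ?_⟩
    rw [← h.1, zip_map_fst_snd, ofBiword_biword']

theorem matF_ofNat_succ {c : ℕ} {A B : Mat} :
    matF (Int.ofNat (c + 1)) B = some A ↔ RaiseLetters c (biword' A) (biword' B) := by
  simp only [matF, actCols, Option.map_eq_some_iff]
  constructor
  · rintro ⟨u, hu, rfl⟩
    have hl := wordF_length hu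
    have h1 : RaiseLetters c (((biword' B).map Prod.fst).zip u) (biword' B) := by
      refine ⟨(List.map_fst_zip (by simpa using hl.ge)).symm, ?_⟩
      rw [List.map_snd_zip (by simpa using hl.le), wordE_eq_some_iff_wordF, hu]
    rwa [biword'_ofBiword (h1.sorted_iff.2 (biword'_sorted B))]
  · intro h
    refine ⟨_, wordE_eq_some_iff_wordF.1 h.2, ?_⟩
    rw [h.1, zip_map_fst_snd, ofBiword_biword']

/-- Transposition exchanges Ω with Ω', hence rows with columns; this reduces every negative colour
to a positive one. -/
theorem actRows_eq (op : List ℕ → Option (List ℕ)) (A : Mat) :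
    actRows op A = (actCols op (transposeMat A)).map transposeMat := by
  have h : ∀ u v : List ℕ, (u.zip v).map Prod.swap = v.zip u := fun u v => List.zip_swap u v
  simp only [actRows, actCols, biword'_transposeMat, Option.map_map, List.map_map,
    Function.comp_def, Prod.snd_swap, Prod.fst_swap, transposeMat_ofBiword, h]

theorem matE_negSucc (c : ℕ) (A : Mat) : matE (Int.negSucc c) A =
    (matE (Int.ofNat (c + 1)) (transposeMat A)).map transposeMat := actRows_eq _ _

theorem matF_negSucc (c : ℕ) (A : Mat) : matF (Int.negSucc c) A =
    (matF (Int.ofNat (c + 1)) (transposeMat A)).map transposeMat := actRows_eq _ _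

theorem map_transposeMat_eq_some {o : Option Mat} {B : Mat} :
    o.map transposeMat = some B ↔ o = some (transposeMat B) := by
  rw [Option.map_eq_some_iff]
  constructor
  · rintro ⟨a, rfl, rfl⟩; simp
  · rintro rfl; exact ⟨_, rfl, by simp⟩

theorem matE_eq_some_iff_matF {i : ℤ} {A B : Mat} : matE i A = some B ↔ matF i B = some A := by
  rcases i with (_ | c) | c
  · simp only [matE, matF]
    split_ifs with h
    · simp only [Option.some.injEq, false_iff]
      rintro rfl
      simp at h
    · simp only [Option.some.injEq]
      constructor
      · rintro rfl
        refine tsub_add_cancel_of_le ?_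
        rw [Finsupp.single_le_iff]; omega
      · rintro rfl; simp
  · rw [matE_ofNat_succ, matF_ofNat_succ]
  · rw [matE_negSucc, matF_negSucc, map_transposeMat_eq_some, map_transposeMat_eq_some,
      matE_ofNat_succ, matF_ofNat_succ]

/-! ### Column words of tableaux -/

/-- The word of a tableau read column by column, from right to left and from top to bottom. -/
def colWord (T : Tab) : List ℕ := T.flatMap List.reverse

@[simp] theorem colWord_nil : colWord [] = [] := rfl
@[simp] theorem colWord_cons (C : List ℕ) (T : Tab) : colWord (C :: T) = C.reverse ++ colWord T := rfl

theorem wordEps_wt_colWord_ins (c : ℕ) (L : List (ℕ × ℕ)) :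
    wordEps c (colWord (ins (L.map Prod.snd))) = wordEps c (L.map Prod.snd) ∧
      wordWt c (colWord (ins (L.map Prod.snd))) = wordWt c (L.map Prod.snd) := by
  induction L using ins_map_snd_induction with
  | h0 => simp
  | h1 L hL ih =>
    have := wordEps_wt_peel c L
    rw [ins_of_ne_nil hL, colWord_cons, wordEps_append, wordWt_append, ih.1, ih.2,
      ← wordEps_append, ← wordWt_append]
    exact this

theorem wordPhi_colWord_ins (c : ℕ) (L : List (ℕ × ℕ)) :
    wordPhi c (colWord (ins (L.map Prod.snd))) = wordPhi c (L.map Prod.snd) := by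
  have := wordEps_wt_colWord_ins c L
  unfold wordPhi; omega

/-- The tableau `U` is obtained from `T` by the raising operator of colour `c`, acting through the
column words. -/
def RaiseTab (c : ℕ) (T U : Tab) : Prop :=
  U.map List.length = T.map List.length ∧ wordE c (colWord T) = some (colWord U)

theorem RaiseLetters.ne_nil {c : ℕ} {L M : List (ℕ × ℕ)} (h : RaiseLetters c L M) :
    L ≠ [] ∧ M ≠ [] := by
  obtain ⟨L1, k, L2, rfl, rfl, -, -⟩ := h.split
  simp

/-- The choice made at each column by `RaiseLetters.peel` is the tensor product rule for that column
followed by the rest of the tableau, because the bumped word and the column word of its tableau have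
the same `ε`. The recording tableau never changes. -/
theorem RaiseLetters.tab {c : ℕ} {L M : List (ℕ × ℕ)} (h : RaiseLetters c L M) :
    RaiseTab c (ins (L.map Prod.snd)) (ins (M.map Prod.snd)) ∧ recTab M = recTab L := by
  induction L using ins_map_snd_induction generalizing M with
  | h0 => exact absurd rfl h.ne_nil.1
  | h1 L hL ih =>
    have hM := h.ne_nil.2
    have hlen : (pcol M).length = (pcol L).length := by
      rw [← length_prec, ← length_prec, h.peel.1]
    obtain ⟨h1, ⟨h2, h3, h4⟩ | ⟨h2, h3, h4⟩⟩ := h.peel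
    · rw [ins_of_ne_nil hL, ins_of_ne_nil hM, recTab_of_ne_nil hL, recTab_of_ne_nil hM, h1, h3]
      refine ⟨⟨by simp [hlen], ?_⟩, rfl⟩
      rw [colWord_cons, colWord_cons, wordE_append, if_pos, h2, Option.map_some]
      rwa [(wordEps_wt_colWord_ins c (pout L)).1]
    · rw [ins_of_ne_nil hL, ins_of_ne_nil hM, recTab_of_ne_nil hL, recTab_of_ne_nil hM, h1, h2]
      obtain ⟨⟨i1, i2⟩, i3⟩ := ih h3
      refine ⟨⟨by simpa using i1, ?_⟩, by rw [i3]⟩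
      rw [colWord_cons, colWord_cons, wordE_append, if_neg, i2, Option.map_some]
      rw [(wordEps_wt_colWord_ins c (pout L)).1]
      omega

theorem eq_of_colWord_eq {T U : Tab} (h1 : U.map List.length = T.map List.length)
    (h2 : colWord U = colWord T) : U = T := by
  induction T generalizing U with
  | nil => simpa using h1
  | cons C T ih =>
    cases U with
    | nil => simp at h1
    | cons D U =>
      simp only [List.map_cons, List.cons.injEq] at h1
      simp only [colWord_cons] at h2
      obtain ⟨h3, h4⟩ := List.append_inj h2 (by simpa using h1.1)
      rw [ih h1.2 h4, List.reverse_inj.1 h3]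

theorem matE_ofNat_succ_eq_none {c : ℕ} {A : Mat} :
    matE (Int.ofNat (c + 1)) A = none ↔ wordEps c ((biword' A).map Prod.snd) = 0 := by
  simp only [matE, actCols, Option.map_eq_none_iff, wordE_eq_none]

theorem matF_ofNat_succ_eq_none {c : ℕ} {A : Mat} :
    matF (Int.ofNat (c + 1)) A = none ↔ wordPhi c ((biword' A).map Prod.snd) = 0 := by
  simp only [matF, actCols, Option.map_eq_none_iff, wordF_eq_none]

theorem raiseTab_kappa {c : ℕ} {A B : Mat} (h : matE (Int.ofNat (c + 1)) A = some B) :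
    RaiseTab c (kappa A).2 (kappa B).2 ∧ (kappa B).1 = (kappa A).1 := by
  rw [kappa_eq, kappa_eq]
  exact (matE_ofNat_succ.1 h).tab

/-! ## Semistandard tableaux and their row reading words -/

/-- A semistandard tableau of some anti-normal shape. -/
def Semistandard (T : Tab) : Prop :=
  (∀ C ∈ T, C ≠ [] ∧ C.Pairwise (· > ·)) ∧ T.Pairwise fun C D => ColLE D C

theorem ColLE.trans {C D E : List ℕ} (h : ColLE C D) (h' : ColLE D E) : ColLE C E := by
  intro i x hx
  obtain ⟨y, hy, hxy⟩ := h i x hx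
  obtain ⟨z, hz, hyz⟩ := h' i y hy
  exact ⟨z, hz, hxy.trans hyz⟩

theorem semistandard_nil : Semistandard [] := by simp [Semistandard]

theorem semistandard_cons {C : List ℕ} {T : Tab} : Semistandard (C :: T) ↔
    C ≠ [] ∧ C.Pairwise (· > ·) ∧ (∀ D ∈ T, ColLE D C) ∧ Semistandard T := by
  simp only [Semistandard, List.mem_cons, forall_eq_or_imp, List.pairwise_cons]
  tauto

theorem Semistandard.sublist {T U : Tab} (h : Semistandard T) (hs : U.Sublist T) :
    Semistandard U :=
  ⟨fun C hC => h.1 C (hs.subset hC), h.2.sublist hs⟩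

theorem semistandard_ins (L : List (ℕ × ℕ)) : Semistandard (ins (L.map Prod.snd)) := by
  induction L using ins_map_snd_induction with
  | h0 => exact semistandard_nil
  | h1 L hL ih =>
    rw [ins_of_ne_nil hL]
    refine semistandard_cons.2 ⟨pcol_ne_nil hL, pcol_pairwise L, ?_, ih⟩
    intro D hD
    rcases eq_or_ne (pout L) [] with h | h
    · rw [h] at hD; simp at hD
    · rw [ins_of_ne_nil h] at hD ih
      rcases List.mem_cons.1 hD with rfl | hD
      · exact pcol_pout_le L
      · exact ((semistandard_cons.1 ih).2.2.1 D hD).trans (pcol_pout_le L)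

/-- The row `i` (from the bottom) of a tableau, read from right to left. -/
def tabRow (T : Tab) (i : ℕ) : List ℕ := T.filterMap fun C => C[i]?

/-- The word of the lowest `n` rows. -/
def rowWord (n : ℕ) (T : Tab) : List ℕ := (List.range n).reverse.flatMap (tabRow T)

@[simp] theorem tabRow_append (T U : Tab) (i : ℕ) : tabRow (T ++ U) i = tabRow T i ++ tabRow U i := by
  simp [tabRow]

theorem tabRow_cons (C : List ℕ) (T : Tab) (i : ℕ) :
    tabRow (C :: T) i = C[i]?.toList ++ tabRow T i := by
  unfold tabRow
  rw [List.filterMap_cons]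
  cases C[i]? <;> simp

theorem mem_tabRow {T : Tab} {i x : ℕ} : x ∈ tabRow T i ↔ ∃ C ∈ T, C[i]? = some x := by
  simp [tabRow]

theorem rowWord_succ (n : ℕ) (T : Tab) : rowWord (n + 1) T = tabRow T n ++ rowWord n T := by
  simp [rowWord, List.range_succ]

theorem rowWord_eq {m n : ℕ} (h : m ≤ n) {T : Tab} (hT : ∀ C ∈ T, C.length ≤ m) :
    rowWord n T = rowWord m T := by
  induction n, h using Nat.le_induction with
  | base => rfl
  | succ n hn ih =>
    rw [rowWord_succ, ih]
    have : tabRow T n = [] := by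
      rw [tabRow, List.filterMap_eq_nil_iff]
      intro C hC
      have := hT C hC
      simp; omega
    rw [this, List.nil_append]

theorem Semistandard.length_le {T : Tab} (h : Semistandard T) :
    ∀ C ∈ T, C.length ≤ (T.headD []).length := by
  cases T with
  | nil => simp
  | cons D T =>
    intro C hC
    rcases List.mem_cons.1 hC with rfl | hC
    · simp
    · exact ((semistandard_cons.1 h).2.2.1 C hC).length_le

theorem readingWord_eq (T : Tab) : readingWord T = rowWord (T.headD []).length T := by
  rw [readingWord, boxes, rowWord, List.map_flatMap]
  congr 1
  funext i
  rw [List.map_map, tabRow]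
  induction T with
  | nil => simp
  | cons C T ih =>
    rw [List.length_cons, List.range_succ_eq_map, List.filter_cons, List.filterMap_cons]
    have hfin : (((List.range T.length).map Nat.succ).filter fun j =>
          decide (i < ((C :: T).getD j []).length)).map
          ((fun p : ℕ × ℕ => ((C :: T).getD p.2 []).getD p.1 0) ∘ fun j => (i, j)) =
        T.filterMap fun C => C[i]? := by
      rw [← ih, List.filter_map, List.map_map]
      simp [Function.comp_def]
    split_ifs with h1
    · simp only [List.getD_cons_zero, decide_eq_true_eq] at h1
      rw [List.getElem?_eq_getElem h1, List.map_cons, hfin]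
      simp [h1]
    · simp only [List.getD_cons_zero, decide_eq_true_eq, not_lt] at h1
      rw [List.getElem?_eq_none h1, hfin]

/-- Insertion of a weakly increasing word into a column with larger entries. -/
theorem peel_row {x : ℕ} {r : List ℕ} {L : List (ℕ × ℕ)} (hr : (x :: r).Pairwise (· ≥ ·))
    (hx : ∀ y ∈ pcol L, x < y) :
    pcol ((x :: r).map (fun a => (0, a)) ++ L) = pcol L ++ [x] ∧
      pout ((x :: r).map (fun a => (0, a)) ++ L) = r.map (fun a => (0, a)) ++ pout L := by
  induction r generalizing x with
  | nil => simp [pcol_cons, pout_cons, colInsert_of_forall_lt hx]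
  | cons y r ih =>
    obtain ⟨h1, h2⟩ := List.pairwise_cons.1 hr
    have hyx : y ≤ x := h1 y (by simp)
    obtain ⟨i1, i2⟩ := ih h2 fun z hz => lt_of_le_of_lt hyx (hx z hz)
    rw [List.map_cons, List.cons_append, pcol_cons, pout_cons, i1, i2,
      colInsert_append_cons hx hyx]
    simp

/-- Rows are inserted from the bottom upwards and each row from left to right. Within a row every
letter bumps its predecessor, so exactly the right-most entry stays in the first column and the rest
of the row is passed on to the remaining columns. -/
theorem ins_rowWord {T : Tab} (hT : Semistandard T) {n : ℕ} (hn : ∀ C ∈ T, C.length ≤ n) :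
    ins (rowWord n T) = T := by
  induction T generalizing n with
  | nil =>
    have : rowWord n [] = [] := by simp [rowWord, tabRow]
    rw [this]; rfl
  | cons C T ih =>
    obtain ⟨h1, h2, h3, h4⟩ := semistandard_cons.1 hT
    have hTC : ∀ D ∈ T, D.length ≤ C.length := fun D hD => (h3 D hD).length_le
    rw [rowWord_eq (hn C (by simp)) (T := C :: T) (by
      intro D hD
      rcases List.mem_cons.1 hD with rfl | hD
      · exact le_rfl
      · exact hTC D hD)]
    have key : ∀ m ≤ C.length, pcol ((rowWord m (C :: T)).map fun a => (0, a)) = C.take m ∧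
        pout ((rowWord m (C :: T)).map fun a => (0, a)) = (rowWord m T).map fun a => (0, a) := by
      intro m
      induction m with
      | zero => intro _; simp [rowWord]
      | succ m ihm =>
        intro hm
        obtain ⟨i1, i2⟩ := ihm (by omega)
        have hrow : tabRow (C :: T) m = C[m] :: tabRow T m := by
          rw [tabRow_cons, List.getElem?_eq_getElem (by omega)]; simp
        rw [rowWord_succ, rowWord_succ, hrow, List.map_append, List.map_append]
        have hdec : (C[m] :: tabRow T m).Pairwise (· ≥ ·) := by
          rw [← hrow, tabRow, List.pairwise_filterMap]
          refine hT.2.imp ?_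
          intro D E hDE x hx y hy
          obtain ⟨z, hz, hyz⟩ := hDE m y hy
          rw [hx, Option.some.injEq] at hz
          omega
        have hlt : ∀ y ∈ pcol ((rowWord m (C :: T)).map fun a => (0, a)), C[m] < y := by
          rw [i1]
          intro y hy
          obtain ⟨j, hj, rfl⟩ := List.mem_take_iff_getElem.1 hy
          exact List.pairwise_iff_getElem.1 h2 j m _ _ (by omega)
        obtain ⟨g1, g2⟩ := peel_row hdec hlt
        rw [g1, g2, i1, i2]
        refine ⟨?_, rfl⟩
        rw [List.take_add_one, List.getElem?_eq_getElem (by omega)]; rfl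
    obtain ⟨k1, k2⟩ := key C.length le_rfl
    have hne : (rowWord C.length (C :: T)).map (fun a => (0, a)) ≠ [] := by
      intro h0
      rw [h0] at k1
      simp at k1
      exact h1 k1
    have := ins_of_ne_nil hne
    rw [k1, k2, List.map_map, List.map_map] at this
    simp only [Function.comp_def, List.map_id', List.take_length] at this
    rw [this, ih h4 hTC]

/-- The row word inserts to the tableau, and a word agrees in `ε` and `φ` with the column word of
its insertion tableau. -/
theorem wordEps_rowWord (c : ℕ) {T : Tab} (hT : Semistandard T) {n : ℕ}
    (hn : ∀ C ∈ T, C.length ≤ n) :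
    wordEps c (rowWord n T) = wordEps c (colWord T) ∧
      wordPhi c (rowWord n T) = wordPhi c (colWord T) := by
  have h1 := wordEps_wt_colWord_ins c ((rowWord n T).map fun a => (0, a))
  have h2 := wordPhi_colWord_ins c ((rowWord n T).map fun a => (0, a))
  simp only [List.map_map, Function.comp_def, List.map_id'] at h1 h2
  rw [ins_rowWord hT hn] at h1 h2
  exact ⟨h1.1.symm, h2.symm⟩

theorem ne_of_wordPhi_eq_zero {c : ℕ} {u : List ℕ} (hu : u.Pairwise (· < ·))
    (hc : ∀ x ∈ u, x ≤ c) (h : wordPhi c u = 0) : ∀ x ∈ u, x < c := by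
  intro x hx
  refine lt_of_le_of_ne (hc x hx) ?_
  rintro rfl
  obtain ⟨a, b, rfl⟩ := List.append_of_mem hx
  have hb : Inert x b := by
    intro z hz
    have h1 := hc z (by simp [hz])
    have h2 := (List.pairwise_cons.1 (List.pairwise_append.1 hu).2.1).1 z hz
    omega
  rw [wordPhi_append, wordPhi_cons, letterPhi_self, hb.eps_wt.2] at h
  omega

theorem colWord_append (T U : Tab) : colWord (T ++ U) = colWord T ++ colWord U := by
  simp [colWord]

theorem colWord_eq_append_cons {T : Tab} {u v : List ℕ} {x : ℕ} (h : colWord T = u ++ x :: v) :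
    ∃ T1 lo hi T2, T = T1 ++ (lo ++ x :: hi) :: T2 ∧ u = colWord T1 ++ hi.reverse ∧
      v = lo.reverse ++ colWord T2 := by
  induction T generalizing u with
  | nil => simp at h
  | cons C T ih =>
    rw [colWord_cons] at h
    rcases List.append_eq_append_iff.1 h with ⟨a, ha, ha'⟩ | ⟨a, ha, ha'⟩
    · obtain ⟨T1, lo, hi, T2, rfl, rfl, rfl⟩ := ih ha'
      exact ⟨C :: T1, lo, hi, T2, rfl, by simp [ha], rfl⟩
    · cases a with
      | nil =>
        simp only [List.nil_append] at ha'
        simp only [List.append_nil] at ha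
        obtain ⟨T1, lo, hi, T2, rfl, h1, rfl⟩ := ih (u := []) ha'.symm
        exact ⟨C :: T1, lo, hi, T2, rfl, by rw [← ha, colWord_cons, List.append_assoc, ← h1]; simp,
          rfl⟩
      | cons y a =>
        simp only [List.cons_append, List.cons.injEq] at ha'
        obtain ⟨rfl, rfl⟩ := ha'
        refine ⟨[], a.reverse, u.reverse, T, ?_, by simp, by simp⟩
        have := congrArg List.reverse ha
        simp at this
        simp [this]

theorem filter_flatMap_congr {c : ℕ} {A : List ℕ} {f g : ℕ → List ℕ}
    (h : ∀ a ∈ A, (f a).filter (fun x => x = c ∨ x = c + 1) =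
      (g a).filter (fun x => x = c ∨ x = c + 1)) :
    (A.flatMap f).filter (fun x => x = c ∨ x = c + 1) =
      (A.flatMap g).filter (fun x => x = c ∨ x = c + 1) := by
  induction A with
  | nil => rfl
  | cons a A ih =>
    rw [List.flatMap_cons, List.flatMap_cons, List.filter_append, List.filter_append,
      h a (by simp), ih fun b hb => h b (by simp [hb])]

theorem Inert.filter {c : ℕ} {u : List ℕ} (h : Inert c u) :
    u.filter (fun x => x = c ∨ x = c + 1) = [] := by
  simp only [List.filter_eq_nil_iff, decide_eq_true_eq, not_or]
  exact h

theorem inert_flatMap {c : ℕ} {A : List ℕ} {f : ℕ → List ℕ} (h : ∀ a ∈ A, Inert c (f a)) :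
    Inert c (A.flatMap f) := by
  intro x hx
  obtain ⟨a, ha, hx⟩ := List.mem_flatMap.1 hx
  exact h a ha x hx

/-- The raising operators can be computed through the row or through the column reading. -/
theorem RaiseTab.rowWord {c n : ℕ} {T U : Tab} (h : RaiseTab c T U) (hT : Semistandard T)
    (hn : ∀ C ∈ T, C.length ≤ n) : wordE c (rowWord n T) = some (rowWord n U) := by
  obtain ⟨hlen, h⟩ := h
  obtain ⟨u, v, h1, h2, h3, h4⟩ := wordE_eq_some.1 h
  obtain ⟨R, lo, hi, S, rfl, rfl, rfl⟩ := colWord_eq_append_cons h1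
  obtain rfl : U = R ++ (lo ++ c :: hi) :: S := by
    refine eq_of_colWord_eq ?_ ?_
    · rw [hlen]; simp
    · rw [h2]; simp [colWord_append]
  clear h1 h2 h hlen
  have hR : Semistandard R := hT.sublist (by simp)
  have hS : Semistandard S := hT.sublist (by simp)
  have hnR : ∀ C ∈ R, C.length ≤ n := fun C hC => hn C (by simp [hC])
  have hnS : ∀ C ∈ S, C.length ≤ n := fun C hC => hn C (by simp [hC])
  have hC := (hT.1 (lo ++ (c + 1) :: hi) (by simp)).2
  obtain ⟨c1, c2, c3⟩ := List.pairwise_append.1 hC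
  obtain ⟨c4, c5⟩ := List.pairwise_cons.1 c2
  obtain ⟨-, d2, d3⟩ := List.pairwise_append.1 hT.2
  have d4 := (List.pairwise_cons.1 d2).1
  have hhi : ∀ x ∈ hi, x < c := by
    have hphi : wordPhi c hi.reverse = 0 := by
      rw [wordPhi_append] at h3
      have := wordPhi_nonneg c hi.reverse
      omega
    have := ne_of_wordPhi_eq_zero (u := hi.reverse) (by rwa [List.pairwise_reverse])
      (fun x hx => by have := c4 x (by simpa using hx); omega) hphi
    intro x hx
    exact this x (by simpa using hx)
  have hlo : ∀ x ∈ lo, c + 1 < x := fun x hx => c3 x hx (c + 1) (by simp)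
  have ihi : Inert c hi.reverse := (inert_of_lt hhi).reverse
  have ilo : Inert c lo.reverse := (inert_of_gt hlo).reverse
  have hphiR : wordPhi c (colWord R) = 0 := by
    rw [wordPhi_append, ihi.eps_wt.2] at h3
    have := wordPhi_nonneg c (colWord R)
    omega
  have hepsS : wordEps c (colWord S) = 0 := by
    rw [wordEps_append, ilo.eps_wt.2] at h4
    have := wordEps_nonneg c (colWord S)
    omega
  have hlen := hn (lo ++ (c + 1) :: hi) (by simp)
  simp only [List.length_append, List.length_cons] at hlen
  obtain ⟨A, B, hAB⟩ := List.append_of_mem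
    (show lo.length ∈ (List.range n).reverse by simp; omega)
  have hpw : (A ++ lo.length :: B).Pairwise (· > ·) := by
    rw [← hAB, List.pairwise_reverse]; exact List.pairwise_lt_range
  have hA : ∀ a ∈ A, lo.length < a := fun a ha =>
    (List.pairwise_append.1 hpw).2.2 a ha lo.length (by simp)
  have hB : ∀ b ∈ B, b < lo.length := fun b hb =>
    (List.pairwise_cons.1 (List.pairwise_append.1 hpw).2.1).1 b hb
  -- the boxes in the rows above or below that are on the wrong side do not matter
  have hCa : ∀ a, lo.length < a → ∀ y, ∀ x, (lo ++ y :: hi)[a]? = some x → x < c := by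
    intro a ha y x hx
    obtain ⟨m, hm⟩ : ∃ m, a - lo.length = m + 1 := ⟨a - lo.length - 1, by omega⟩
    rw [List.getElem?_append_right ha.le, hm, List.getElem?_cons_succ] at hx
    exact hhi x (List.mem_of_getElem? hx)
  have hCb : ∀ b, b < lo.length → ∀ y, ∀ x, (lo ++ y :: hi)[b]? = some x → c + 1 < x := by
    intro b hb y x hx
    rw [List.getElem?_append_left hb] at hx
    exact hlo x (List.mem_of_getElem? hx)
  have hSa : ∀ a, lo.length < a → Inert c (tabRow S a) := by
    intro a ha
    refine inert_of_lt fun x hx => ?_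
    obtain ⟨D, hD, hx⟩ := mem_tabRow.1 hx
    obtain ⟨y, hy, hxy⟩ := d4 D hD a x hx
    exact lt_of_le_of_lt hxy (hCa a ha _ y hy)
  have hRb : ∀ b, b < lo.length → Inert c (tabRow R b) := by
    intro b hb
    refine inert_of_gt fun x hx => ?_
    obtain ⟨D, hD, hx⟩ := mem_tabRow.1 hx
    obtain ⟨y, hy, hxy⟩ := d3 D hD _ (List.mem_cons_self) lo.length (c + 1) (by simp)
    have hDp := (hR.1 D hD).2
    obtain ⟨e1, e2⟩ := List.getElem?_eq_some_iff.1 hx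
    obtain ⟨e3, e4⟩ := List.getElem?_eq_some_iff.1 hy
    have := List.pairwise_iff_getElem.1 hDp b lo.length e1 e3 hb
    omega
  have hrow : ∀ y i, tabRow (R ++ (lo ++ y :: hi) :: S) i =
      tabRow R i ++ ((lo ++ y :: hi)[i]?.toList ++ tabRow S i) := by
    intro y i; rw [tabRow_append, tabRow_cons]
  have hsame : ∀ i, i ≠ lo.length → tabRow (R ++ (lo ++ c :: hi) :: S) i =
      tabRow (R ++ (lo ++ (c + 1) :: hi) :: S) i := by
    intro i hi'
    rw [hrow, hrow]
    congr 3
    rcases lt_or_gt_of_ne hi' with hlt | hlt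
    · rw [List.getElem?_append_left hlt, List.getElem?_append_left hlt]
    · obtain ⟨m, hm⟩ : ∃ m, i - lo.length = m + 1 := ⟨i - lo.length - 1, by omega⟩
      rw [List.getElem?_append_right hlt.le, List.getElem?_append_right hlt.le, hm,
        List.getElem?_cons_succ, List.getElem?_cons_succ]
  have hmid : ∀ y, tabRow (R ++ (lo ++ y :: hi) :: S) lo.length =
      tabRow R lo.length ++ y :: tabRow S lo.length := by
    intro y; rw [hrow]; simp
  -- Row reading is split at the same box. For the colour `c` the prefix counts like the row word of
  -- `R`, since in the rows above the box its column and the columns `S` have only letters below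
  -- `c`. Dually, the suffix counts like the row word of `S`, since below the box the other columns
  -- have only letters above `c + 1`.
  refine wordE_eq_some.2 ⟨A.flatMap (tabRow (R ++ (lo ++ (c + 1) :: hi) :: S)) ++
      tabRow R lo.length, tabRow S lo.length ++
      B.flatMap (tabRow (R ++ (lo ++ (c + 1) :: hi) :: S)), ?_, ?_, ?_, ?_⟩
  · rw [FlaggedRSK.rowWord, hAB, List.flatMap_append, List.flatMap_cons, hmid]; simp
  · rw [FlaggedRSK.rowWord, hAB, List.flatMap_append, List.flatMap_cons, hmid]
    rw [List.flatMap_congr (g := tabRow (R ++ (lo ++ (c + 1) :: hi) :: S)) (l := A)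
        fun a ha => hsame a (hA a ha).ne',
      List.flatMap_congr (g := tabRow (R ++ (lo ++ (c + 1) :: hi) :: S)) (l := B)
        fun b hb => hsame b (hB b hb).ne]
    simp
  · rw [← hphiR, ← (wordEps_rowWord c hR hnR).2]
    refine (wordEps_eq_of_filter ?_).2
    rw [FlaggedRSK.rowWord, hAB, List.flatMap_append, List.flatMap_cons, List.filter_append,
      List.filter_append, List.filter_append, (inert_flatMap fun b hb => hRb b (hB b hb)).filter,
      List.append_nil]
    congr 1
    refine filter_flatMap_congr fun a ha => ?_
    rw [hrow, List.filter_append, List.filter_append, (hSa a (hA a ha)).filter]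
    have : Inert c ((lo ++ (c + 1) :: hi)[a]?.toList) :=
      inert_of_lt fun x hx => hCa a (hA a ha) _ x (by simpa using hx)
    rw [this.filter]; simp
  · rw [← hepsS, ← (wordEps_rowWord c hS hnS).1]
    refine (wordEps_eq_of_filter ?_).1
    rw [FlaggedRSK.rowWord, hAB, List.flatMap_append, List.flatMap_cons, List.filter_append,
      List.filter_append, List.filter_append, (inert_flatMap fun a ha => hSa a (hA a ha)).filter,
      List.nil_append]
    congr 1
    refine filter_flatMap_congr fun b hb => ?_
    rw [hrow, List.filter_append, List.filter_append, (hRb b (hB b hb)).filter]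
    have : Inert c ((lo ++ (c + 1) :: hi)[b]?.toList) :=
      inert_of_gt fun x hx => hCb b (hB b hb) _ x (by simpa using hx)
    rw [this.filter]; simp

/-! ### Raising operators on tableaux and their compatibility with κ -/

theorem boxes_congr {T U : Tab} (h : U.map List.length = T.map List.length) : boxes U = boxes T := by
  have h1 : ∀ j, (U.getD j []).length = (T.getD j []).length := by
    intro j
    have := congrArg (fun l => l[j]?) h
    simp only [List.getElem?_map] at this
    rw [List.getD_eq_getElem?_getD, List.getD_eq_getElem?_getD]
    cases h1 : U[j]? <;> cases h2 : T[j]? <;> rw [h1, h2] at this <;> simp at this ⊢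
    exact this
  have h2 : U.length = T.length := by simpa using congrArg List.length h
  have h3 : (U.headD []).length = (T.headD []).length := by
    have := h1 0
    cases U <;> cases T <;> simpa using this
  simp only [boxes, h1, h2, h3]

theorem refill_readingWord {T U : Tab} (h : U.map List.length = T.map List.length)
    (hT : ∀ C ∈ T, C.length ≤ (T.headD []).length) : refill T (readingWord U) = U := by
  have h2 : U.length = T.length := by simpa using congrArg List.length h
  apply List.ext_getElem
  · simp [refill, h2]
  intro j hj1 hj2
  have hjT : j < T.length := by omega
  have hlen : U[j].length = T[j].length := by
    have := congrArg (fun l => l[j]?) h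
    simpa [hj2, hjT] using this
  apply List.ext_getElem
  · simp [refill, hlen]
  intro i hi1 hi2
  simp only [refill, List.getElem_mapIdx]
  have hmem : (i, j) ∈ boxes T := by
    simp only [boxes, List.mem_flatMap, List.mem_reverse, List.mem_range, List.mem_map,
      List.mem_filter, decide_eq_true_eq, Prod.mk.injEq]
    refine ⟨i, ?_, j, ⟨hjT, ?_⟩, rfl, rfl⟩
    · have := hT T[j] (List.getElem_mem _); omega
    · rw [List.getD_eq_getElem _ _ hjT]; omega
  have hidx := List.idxOf_lt_length_iff.2 hmem
  rw [readingWord, boxes_congr h, List.getD_eq_getElem _ _ (by simpa using hidx), List.getElem_map,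
    List.getElem_idxOf hidx]
  simp [hj2, hi2]

theorem RaiseTab.tabE {c : ℕ} {T U : Tab} (h : RaiseTab c T U) (hT : Semistandard T) :
    tabE c T = some U := by
  have hhead : (U.headD []).length = (T.headD []).length := by
    have := h.1
    cases U <;> cases T <;> simp at this ⊢
    exact this.1
  rw [FlaggedRSK.tabE, readingWord_eq, h.rowWord hT hT.length_le, Option.map_some, ← hhead,
    ← readingWord_eq, refill_readingWord h.1 hT.length_le]

theorem tabE_eq_none {c : ℕ} {T : Tab} (hT : Semistandard T) (h : wordEps c (colWord T) = 0) :
    tabE c T = none := by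
  rw [tabE, readingWord_eq, Option.map_eq_none_iff, wordE_eq_none,
    (wordEps_rowWord c hT hT.length_le).1, h]

theorem tabE_kappa (c : ℕ) (A : Mat) :
    bitabE (Int.ofNat (c + 1)) (kappa A) = (matE (Int.ofNat (c + 1)) A).map kappa := by
  have hT : Semistandard (kappa A).2 := by rw [kappa_eq]; exact semistandard_ins _
  cases h : matE (Int.ofNat (c + 1)) A with
  | none =>
    have h0 : wordEps c (colWord (kappa A).2) = 0 := by
      rw [kappa_eq, (wordEps_wt_colWord_ins c _).1, ← matE_ofNat_succ_eq_none, h]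
    simp [bitabE, tabE_eq_none hT h0]
  | some B =>
    obtain ⟨h1, h2⟩ := raiseTab_kappa h
    simp [bitabE, h1.tabE hT, ← h2]

theorem tabE_kappa_neg (c : ℕ) (A : Mat) :
    bitabE (Int.negSucc c) (kappa A) = (matE (Int.negSucc c) A).map kappa := by
  have h := tabE_kappa c (transposeMat A)
  rw [matE_negSucc]
  cases hm : matE (Int.ofNat (c + 1)) (transposeMat A) with
  | none =>
    rw [hm, kappa_transposeMat] at h
    simp [bitabE] at h ⊢
    exact h
  | some B =>
    rw [hm, kappa_transposeMat] at h
    simp only [bitabE, Option.map_some, Option.map_eq_some_iff, Prod.snd_swap, Prod.fst_swap] at h ⊢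
    obtain ⟨U, h1, h2⟩ := h
    refine ⟨U, h1, ?_⟩
    rw [kappa_transposeMat, ← h2]; rfl

/-! ## The operator of colour zero -/

/-- As insertion starts at the end of the biword, the copies of the first position are inserted
after all later rows and before the rest of the first row. -/
theorem exists_zero_split {L : List (ℕ × ℕ)} (hL : L.Pairwise omegaLE') :
    ∃ X a Y, L = X ++ (List.replicate a (0, 0) ++ Y) ∧ (∀ q ∈ X, q.1 = 0 ∧ 0 < q.2) ∧
      ∀ q ∈ Y, 0 < q.1 := by
  induction L with
  | nil => exact ⟨[], 0, [], rfl, by simp, by simp⟩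
  | cons p L ih =>
    obtain ⟨h1, h2⟩ := List.pairwise_cons.1 hL
    obtain ⟨X, a, Y, rfl, h3, h4⟩ := ih h2
    by_cases hp : 0 < p.1
    · refine ⟨[], 0, p :: (X ++ (List.replicate a (0, 0) ++ Y)), rfl, by simp, ?_⟩
      intro q hq
      rcases List.mem_cons.1 hq with rfl | hq
      · exact hp
      · have := h1 q hq; unfold omegaLE' at this; omega
    · by_cases hp2 : 0 < p.2
      · refine ⟨p :: X, a, Y, rfl, ?_, h4⟩
        intro q hq
        rcases List.mem_cons.1 hq with rfl | hq
        · omega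
        · exact h3 q hq
      · have hX : X = [] := by
          cases X with
          | nil => rfl
          | cons q X =>
            have h5 := h1 q (by simp)
            have h6 := h3 q (by simp)
            unfold omegaLE' at h5; omega
        subst hX
        refine ⟨[], a + 1, Y, ?_, by simp, h4⟩
        have : p = (0, 0) := Prod.ext (by simp; omega) (by simp; omega)
        rw [this, List.replicate_succ]; rfl

theorem peel_append_congr {M N : List (ℕ × ℕ)} (h1 : pcol M = pcol N) (h2 : prec M = prec N)
    (X : List (ℕ × ℕ)) : pcol (X ++ M) = pcol (X ++ N) ∧ prec (X ++ M) = prec (X ++ N) ∧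
      ∃ W, pout (X ++ M) = W ++ pout M ∧ pout (X ++ N) = W ++ pout N := by
  induction X with
  | nil => exact ⟨h1, h2, [], rfl, rfl⟩
  | cons q X ih =>
    obtain ⟨i1, i2, W, i3, i4⟩ := ih
    simp only [List.cons_append, pcol_cons, prec_cons, pout_cons, i1, i2, i3, i4]
    exact ⟨trivial, trivial, _, (List.append_assoc _ _ _).symm, (List.append_assoc _ _ _).symm⟩

theorem peel_zeros_of_last {Y : List (ℕ × ℕ)} {D : List ℕ} (h : pcol Y = D ++ [0]) (a : ℕ) :
    pcol (List.replicate a (0, 0) ++ Y) = pcol Y ∧ prec (List.replicate a (0, 0) ++ Y) = prec Y ∧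
      pout (List.replicate a (0, 0) ++ Y) = List.replicate a (0, 0) ++ pout Y := by
  have hD : ∀ x ∈ D, 0 < x := by
    have := pcol_pairwise Y
    rw [h] at this
    exact fun x hx => (List.pairwise_append.1 this).2.2 x hx 0 (by simp)
  have hins : colInsert 0 (D ++ [0]) = (D ++ [0], some 0) := colInsert_append_cons hD le_rfl
  induction a with
  | zero => simp
  | succ a ih =>
    rw [List.replicate_succ, List.cons_append, pcol_cons, prec_cons, pout_cons, ih.1, ih.2.1,
      ih.2.2, h]
    simp [hins]

theorem peel_zeros_of_pos {Y : List (ℕ × ℕ)} (h : ∀ x ∈ pcol Y, 0 < x) (a : ℕ) :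
    pcol (List.replicate (a + 1) (0, 0) ++ Y) = pcol Y ++ [0] ∧
      prec (List.replicate (a + 1) (0, 0) ++ Y) = prec Y ++ [0] ∧
      pout (List.replicate (a + 1) (0, 0) ++ Y) = List.replicate a (0, 0) ++ pout Y := by
  have h1 : pcol ((0, 0) :: Y) = pcol Y ++ [0] := by rw [pcol_cons, colInsert_of_forall_lt h]
  have h2 : prec ((0, 0) :: Y) = prec Y ++ [0] := by
    rw [prec_cons, colInsert_of_forall_lt h]; simp
  have h3 : pout ((0, 0) :: Y) = pout Y := by
    rw [pout_cons, colInsert_of_forall_lt h]; simp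
  obtain ⟨g1, g2, g3⟩ := peel_zeros_of_last h1 a
  have : List.replicate (a + 1) (0, 0) ++ Y = List.replicate a (0, 0) ++ ((0, 0) :: Y) := by
    rw [List.replicate_succ']; simp
  rw [this, g1, g2, g3, h1, h2, h3]
  exact ⟨rfl, rfl, rfl⟩

theorem peel_tail_of_pos {X M : List (ℕ × ℕ)} (hX : ∀ q ∈ X, 0 < q.2) (hM : ∀ x ∈ pcol M, 0 < x) :
    (∀ x ∈ pcol (X ++ M), 0 < x) ∧ (pout (X ++ M)).count (0, 0) = (pout M).count (0, 0) := by
  induction X with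
  | nil => exact ⟨hM, rfl⟩
  | cons q X ih =>
    obtain ⟨i1, i2⟩ := ih fun r hr => hX r (by simp [hr])
    have hq := hX q (by simp)
    rw [List.cons_append, pcol_cons, pout_cons]
    rcases colInsert_cases q.2 (pcol (X ++ M)) with ⟨h1, h2⟩ | ⟨C1, b, C2, h1, h2, h3, h4⟩
    · rw [h2]
      refine ⟨?_, by simpa using i2⟩
      intro x hx
      rcases List.mem_append.1 hx with hx | hx
      · exact i1 x hx
      · simp at hx; omega
    · rw [h4]
      rw [h1] at i1
      have hb := i1 b (by simp)
      refine ⟨?_, ?_⟩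
      · intro x hx
        simp only [List.mem_append, List.mem_cons] at hx i1
        rcases hx with hx | rfl | hx
        · exact i1 x (by simp [hx])
        · exact hq
        · exact i1 x (by simp [hx])
      · simp only [Option.toList_some, List.map_cons, List.map_nil, List.singleton_append]
        rw [List.count_cons_of_ne (by simp; omega), i2]

/-- The letters of `X` are inserted in weakly increasing order and the top entry never exceeds the
next one. So the column does not grow, and the zero on its top is bumped at most once, at time zero.
-/
theorem peel_tail_of_last {X M : List (ℕ × ℕ)} {D : List ℕ}
    (hX : (X ++ M).Pairwise omegaLE') (hX0 : ∀ q ∈ X, q.1 = 0 ∧ 0 < q.2) (hM : pcol M = D ++ [0]) :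
    prec (X ++ M) = prec M ∧ ∃ D' z, pcol (X ++ M) = D' ++ [z] ∧
      ((z = 0 ∧ (pout (X ++ M)).count (0, 0) = (pout M).count (0, 0)) ∨
        ((∃ r ∈ X, r.2 = z) ∧ (pout (X ++ M)).count (0, 0) = (pout M).count (0, 0) + 1)) := by
  induction X with
  | nil => exact ⟨rfl, D, 0, hM, Or.inl ⟨rfl, rfl⟩⟩
  | cons q X ih =>
    rw [List.cons_append] at hX ⊢
    obtain ⟨hq, hX'⟩ := List.pairwise_cons.1 hX
    obtain ⟨i1, D', z, i2, i3⟩ := ih hX' fun r hr => hX0 r (by simp [hr])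
    have hq0 := hX0 q (by simp)
    have hzq : z ≤ q.2 := by
      rcases i3 with ⟨rfl, -⟩ | ⟨⟨r, hr, rfl⟩, -⟩
      · omega
      · have h1 := hq r (by simp [hr])
        have h2 := hX0 r (by simp [hr])
        unfold omegaLE' at h1; omega
    have hpw := pcol_pairwise (X ++ M)
    rw [i2] at hpw
    rw [pcol_cons, prec_cons, pout_cons, i1, i2]
    rcases colInsert_cases q.2 (D' ++ [z]) with ⟨h1, h2⟩ | ⟨C1, b, C2, h1, h2, h3, h4⟩
    · have := h1 z (by simp); omega
    · rw [h4]
      refine ⟨by simp, ?_⟩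
      simp only [Option.toList_some, List.map_cons, List.map_nil, List.singleton_append]
      rcases List.eq_nil_or_concat C2 with rfl | ⟨C2, z', rfl⟩
      · obtain ⟨rfl, hb⟩ := List.append_inj' h1 rfl
        obtain rfl : z = b := by simpa using hb
        refine ⟨D', q.2, rfl, Or.inr ⟨⟨q, by simp, rfl⟩, ?_⟩⟩
        rcases i3 with ⟨rfl, i3⟩ | ⟨⟨r, hr, rfl⟩, i3⟩
        · rw [hq0.1, List.count_cons_self, i3]
        · have h2 := hX0 r (by simp [hr])
          rw [List.count_cons_of_ne (by simp; omega), i3]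
      · rw [List.concat_eq_append, ← List.cons_append, ← List.append_assoc] at h1
        obtain ⟨rfl, hb⟩ := List.append_inj' h1 rfl
        obtain rfl : z = z' := by simpa using hb
        have hbz : z < b := (List.pairwise_append.1 hpw).2.2 b (by simp) z (by simp)
        refine ⟨C1 ++ q.2 :: C2, z, by simp, ?_⟩
        rw [List.count_cons_of_ne (by simp; omega)]
        rcases i3 with ⟨rfl, i3⟩ | ⟨⟨r, hr, rfl⟩, i3⟩
        · exact Or.inl ⟨rfl, i3⟩
        · exact Or.inr ⟨⟨r, by simp [hr], rfl⟩, i3⟩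

theorem pcol_last_cases (Y : List (ℕ × ℕ)) : (∃ D, pcol Y = D ++ [0]) ∨ ∀ x ∈ pcol Y, 0 < x := by
  rcases List.eq_nil_or_concat (pcol Y) with h | ⟨D, z, h⟩
  · right; rw [h]; simp
  · rw [List.concat_eq_append] at h
    rcases Nat.eq_zero_or_pos z with rfl | hz
    · exact Or.inl ⟨D, h⟩
    · right
      have := pcol_pairwise Y
      rw [h] at this ⊢
      intro x hx
      rcases List.mem_append.1 hx with hx | hx
      · have := (List.pairwise_append.1 this).2.2 x hx z (by simp); omega
      · simp at hx; omega

theorem getLast?_ne_zero {C : List ℕ} (h : ∀ x ∈ C, 0 < x) : C.getLast? ≠ some 0 := by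
  intro h0
  have := h 0 (List.mem_of_getLast? h0)
  omega

theorem count_zero_of_pos {Y : List (ℕ × ℕ)} (h : ∀ q ∈ Y, 0 < q.1) : Y.count (0, 0) = 0 := by
  rw [List.count_eq_zero]
  intro h0
  have := h _ h0
  simp at this

/-- The multiplicity of the first position changes by the sign of the first columns. -/
theorem count_pout {L : List (ℕ × ℕ)} (hL : L.Pairwise omegaLE') :
    ((prec L).getLast? = some 0 ∧ (pcol L).getLast? = some 0 →
        L.count (0, 0) = (pout L).count (0, 0) + 1) ∧
      ((prec L).getLast? ≠ some 0 ∧ (pcol L).getLast? ≠ some 0 →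
        L.count (0, 0) = (pout L).count (0, 0) - 1) ∧
      (¬ ((prec L).getLast? = some 0 ↔ (pcol L).getLast? = some 0) →
        L.count (0, 0) = (pout L).count (0, 0)) := by
  obtain ⟨X, a, Y, rfl, h1, h2⟩ := exists_zero_split hL
  have hX : X.count (0, 0) = 0 := by
    rw [List.count_eq_zero]
    intro h0
    have := h1 _ h0
    simp at this
  have hYc : Y.count (0, 0) = 0 := count_zero_of_pos h2
  have hYp : (pout Y).count (0, 0) = 0 := by
    refine count_zero_of_pos fun q hq => ?_
    obtain ⟨p, hp, hpq⟩ := mem_pout_fst hq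
    rw [← hpq]; exact h2 p hp
  have hYr : (prec Y).getLast? ≠ some 0 := by
    refine getLast?_ne_zero fun x hx => ?_
    obtain ⟨p, hp, rfl⟩ := mem_prec hx
    exact h2 p hp
  have hcount : (X ++ (List.replicate a (0, 0) ++ Y)).count (0, 0) = a := by
    simp [List.count_append, hX, hYc]
  rw [hcount]
  rcases pcol_last_cases Y with ⟨D, hD⟩ | hpos
  · obtain ⟨g1, g2, g3⟩ := peel_zeros_of_last hD a
    rw [hD] at g1
    obtain ⟨e1, D', z, e2, ⟨rfl, e3⟩ | ⟨⟨r, hr, rfl⟩, e3⟩⟩ := peel_tail_of_last hL h1 g1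
    · rw [e1, e2, e3, g2, g3]
      simp [hYr, List.count_append, hYp]
    · have := (h1 r hr).2
      rw [e1, e2, e3, g2, g3]
      simp [hYr, List.count_append, hYp, this.ne']
  -- Without any copy of the first position the first columns may still have sign `+` while no copy
  -- is bumped. The truncated subtraction in the claim covers this case, in which the `+` stays
  -- uncancelled.
  · cases a with
    | zero =>
      obtain ⟨e1, e2⟩ := peel_tail_of_pos (X := X) (M := Y) (fun q hq => (h1 q hq).2) hpos
      have e3 := getLast?_ne_zero e1
      rw [List.replicate_zero, List.nil_append, e2, hYp]
      simp [e3]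
    | succ a =>
      obtain ⟨g1, g2, g3⟩ := peel_zeros_of_pos hpos a
      obtain ⟨e1, D', z, e2, ⟨rfl, e3⟩ | ⟨⟨r, hr, rfl⟩, e3⟩⟩ := peel_tail_of_last hL h1 g1
      · rw [e1, e2, e3, g2, g3]
        simp [List.count_append, hYp]
      · have := (h1 r hr).2
        rw [e1, e2, e3, g2, g3]
        simp [List.count_append, hYp, this.ne']

/-- A copy of the first position either runs through the first column unnoticed, so that erasing it
erases a copy from the bumped biword, or it is the only copy and its whole effect is one more box on
top of both first columns. -/
theorem peel_erase_zero {L : List (ℕ × ℕ)} (hL : L.Pairwise omegaLE') (h0 : (0, 0) ∈ L) :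
    (pcol (L.erase (0, 0)) = pcol L ∧ prec (L.erase (0, 0)) = prec L ∧
        (0, 0) ∈ pout L ∧ pout (L.erase (0, 0)) = (pout L).erase (0, 0)) ∨
      (pcol L = pcol (L.erase (0, 0)) ++ [0] ∧ prec L = prec (L.erase (0, 0)) ++ [0] ∧
        pout L = pout (L.erase (0, 0)) ∧ (pout L).count (0, 0) = 0) := by
  have hsort : (L.erase (0, 0)).Pairwise omegaLE' := hL.sublist List.erase_sublist
  have hrel := (count_pout hL).1
  suffices H : (pcol (L.erase (0, 0)) = pcol L ∧ prec (L.erase (0, 0)) = prec L ∧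
        (pout L).Perm ((0, 0) :: pout (L.erase (0, 0)))) ∨
      (pcol L = pcol (L.erase (0, 0)) ++ [0] ∧ prec L = prec (L.erase (0, 0)) ++ [0] ∧
        pout L = pout (L.erase (0, 0)) ∧ L.count (0, 0) = 1) by
    rcases H with ⟨e1, e2, e3⟩ | ⟨e1, e2, e3, e4⟩
    · refine Or.inl ⟨e1, e2, e3.symm.subset (by simp), ?_⟩
      refine omegaLE'_sorted_perm_eq (pout_sorted hsort)
        ((pout_sorted hL).sublist List.erase_sublist) ?_
      have := e3.erase (0, 0)
      rw [List.erase_cons_head] at this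
      exact this.symm
    · refine Or.inr ⟨e1, e2, e3, ?_⟩
      have := hrel ⟨by rw [e2]; simp, by rw [e1]; simp⟩
      omega
  clear hrel hsort
  obtain ⟨X, a, Y, rfl, h1, h2⟩ := exists_zero_split hL
  have hX : (0, 0) ∉ X := fun h => by have := h1 _ h; simp at this
  have hY : (0, 0) ∉ Y := fun h => by have := h2 _ h; simp at this
  cases a with
  | zero => simp [hX, hY] at h0
  | succ a =>
    have herase : (X ++ (List.replicate (a + 1) (0, 0) ++ Y)).erase (0, 0) =
        X ++ (List.replicate a (0, 0) ++ Y) := by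
      rw [List.erase_append_right _ hX, List.replicate_succ, List.cons_append,
        List.erase_cons_head]
    have hcount : (X ++ (List.replicate (a + 1) (0, 0) ++ Y)).count (0, 0) = a + 1 := by
      simp [List.count_append, List.count_eq_zero.2 hX, List.count_eq_zero.2 hY]
    rw [herase, hcount]
    -- if the state before the last tail is the same up to one bumped zero, so is the final one
    have same : pcol (List.replicate a (0, 0) ++ Y) = pcol (List.replicate (a + 1) (0, 0) ++ Y) →
        prec (List.replicate a (0, 0) ++ Y) = prec (List.replicate (a + 1) (0, 0) ++ Y) →
        pout (List.replicate (a + 1) (0, 0) ++ Y) =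
          (0, 0) :: pout (List.replicate a (0, 0) ++ Y) →
        (pcol (X ++ (List.replicate a (0, 0) ++ Y)) =
            pcol (X ++ (List.replicate (a + 1) (0, 0) ++ Y)) ∧
          prec (X ++ (List.replicate a (0, 0) ++ Y)) =
            prec (X ++ (List.replicate (a + 1) (0, 0) ++ Y)) ∧
          (pout (X ++ (List.replicate (a + 1) (0, 0) ++ Y))).Perm
            ((0, 0) :: pout (X ++ (List.replicate a (0, 0) ++ Y)))) := by
      intro g1 g2 g3
      obtain ⟨e1, e2, W, e3, e4⟩ := peel_append_congr g1 g2 X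
      refine ⟨e1, e2, ?_⟩
      rw [e3, e4, g3]
      exact List.perm_middle
    rcases pcol_last_cases Y with ⟨D, hD⟩ | hpos
    · obtain ⟨g1, g2, g3⟩ := peel_zeros_of_last hD a
      obtain ⟨g4, g5, g6⟩ := peel_zeros_of_last hD (a + 1)
      exact Or.inl (same (by rw [g1, g4]) (by rw [g2, g5]) (by rw [g3, g6]; rfl))
    · cases a with
      | succ a =>
        obtain ⟨g1, g2, g3⟩ := peel_zeros_of_pos hpos a
        obtain ⟨g4, g5, g6⟩ := peel_zeros_of_pos hpos (a + 1)
        exact Or.inl (same (by rw [g1, g4]) (by rw [g2, g5]) (by rw [g3, g6]; rfl))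
      | zero =>
        simp only [zero_add, List.replicate_zero, List.nil_append, List.replicate_one,
          List.singleton_append]
        rcases peel_insert_point (t := 0) (k := 0) (M1 := X) (M2 := Y) (by simp) hpos with
          ⟨e1, e2, e3, e4⟩ | ⟨t', R1, ⟨q, hq, rfl⟩, e1, e2, e3, e4⟩
        · exact Or.inr ⟨e1, by rw [e3, e2], e4, trivial⟩
        · rw [(h1 q hq).1] at e2 e4
          exact Or.inl ⟨e1.symm, by rw [e2, e3], e4⟩

theorem ne_nil_of_mem_recTab {L : List (ℕ × ℕ)} {C : List ℕ} (h : C ∈ recTab L) : C ≠ [] := by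
  induction L using ins_map_snd_induction with
  | h0 => simp at h
  | h1 L hL ih =>
    rw [recTab_of_ne_nil hL] at h
    rcases List.mem_cons.1 h with rfl | h
    · intro h0
      have := length_prec L
      rw [h0] at this
      exact pcol_ne_nil hL (List.length_eq_zero_iff.1 this.symm)
    · exact ih h

theorem removeTop_succ {C : List ℕ} (hC : C ≠ []) (j : ℕ) (T : Tab) :
    removeTop (j + 1) (C :: T) = C :: removeTop j T := by
  simp [removeTop, hC]

theorem removeTop_zero {C : List ℕ} {x : ℕ} {T : Tab} (hT : ∀ D ∈ T, D ≠ []) :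
    removeTop 0 ((C ++ [x]) :: T) = if C = [] then T else C :: T := by
  have : T.filter (fun c => c ≠ []) = T := List.filter_eq_self.2 (by simpa using hT)
  unfold removeTop
  rw [List.modify_zero_cons, List.dropLast_concat, List.filter_cons, this]
  split_ifs <;> simp_all

theorem signature_cons (k : ℕ) (c c' : List ℕ) (l : List (List ℕ × List ℕ))
    (acc : List (Bool × ℕ)) : signature k ((c, c') :: l) acc =
      if c.getLast? = some 0 ∧ c'.getLast? = some 0 then
        match acc with
        | (true, _) :: acc' => signature (k + 1) l acc'
        | acc' => signature (k + 1) l ((false, k) :: acc')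
      else if c.getLast? ≠ some 0 ∧ c'.getLast? ≠ some 0 then
        signature (k + 1) l ((true, k) :: acc)
      else signature (k + 1) l acc := by
  rcases acc with _ | ⟨⟨_ | _, _⟩, _⟩ <;> simp only [signature]

/-- Reading columns from the right, the uncancelled signs always form a stack with the `+` signs `P`
above the `-` signs `M`. By `count_pout`, the remaining columns exhaust `P` and leave a `-` exactly
if the multiplicity of the first position exceeds the length of `P`, and the left-most such `-` is
in the column that changes when one copy is erased. -/
theorem find_signature {L : List (ℕ × ℕ)} (hL : L.Pairwise omegaLE') (k : ℕ) (P M : List ℕ) :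
    (L.count (0, 0) ≤ P.length →
      (signature k ((recTab L).zip (ins (L.map Prod.snd)))
        (P.map (Prod.mk true) ++ M.map (Prod.mk false))).find? (fun s => s.1 = false) =
          (M.map (Prod.mk false)).head?) ∧
    (P.length < L.count (0, 0) → ∃ j,
      (signature k ((recTab L).zip (ins (L.map Prod.snd)))
        (P.map (Prod.mk true) ++ M.map (Prod.mk false))).find? (fun s => s.1 = false) =
          some (false, k + j) ∧
      removeTop j (recTab L) = recTab (L.erase (0, 0)) ∧
      removeTop j (ins (L.map Prod.snd)) = ins ((L.erase (0, 0)).map Prod.snd)) := by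
  induction L using ins_map_snd_induction generalizing k P M with
  | h0 =>
    refine ⟨fun _ => ?_, fun h => by simp at h⟩
    simp only [recTab_nil, List.map_nil, List.zip_nil_left, signature, List.find?_append]
    have : (P.map (Prod.mk true)).find? (fun s => s.1 = false) = none := by simp
    rw [this]
    cases M <;> simp
  | h1 L hL0 ih =>
    have ih := ih (pout_sorted hL)
    obtain ⟨n1, n2, n3⟩ := count_pout hL
    have hc := pcol_ne_nil hL0
    have hr : prec L ≠ [] := by
      have := length_prec L
      have := List.length_pos_iff.2 hc
      exact List.length_pos_iff.1 (by omega)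
    -- if the first columns are not touched
    have step : ∀ (f : Option (Bool × ℕ)), (0, 0) ∈ L →
        (0 < (pout L).count (0, 0) ∨ ¬ ((prec L).getLast? = some 0 ∧ (pcol L).getLast? = some 0)) →
        (∃ j, f = some (false, k + 1 + j) ∧
          removeTop j (recTab (pout L)) = recTab ((pout L).erase (0, 0)) ∧
          removeTop j (ins ((pout L).map Prod.snd)) =
            ins (((pout L).erase (0, 0)).map Prod.snd)) →
        ∃ j, f = some (false, k + j) ∧ removeTop j (recTab L) = recTab (L.erase (0, 0)) ∧
          removeTop j (ins (L.map Prod.snd)) = ins ((L.erase (0, 0)).map Prod.snd) := by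
      rintro f h0 hcase ⟨j, rfl, j1, j2⟩
      refine ⟨j + 1, by simp; omega, ?_⟩
      rcases peel_erase_zero hL h0 with ⟨e1, e2, e3, e4⟩ | ⟨e1, e2, e3, e4⟩
      · have hne : L.erase (0, 0) ≠ [] := by
          intro h
          rw [h] at e1
          exact hc e1.symm
        rw [recTab_of_ne_nil hL0, ins_of_ne_nil hL0, removeTop_succ hr, removeTop_succ hc, j1, j2,
          recTab_of_ne_nil hne, ins_of_ne_nil hne, e1, e2, e4]
        exact ⟨rfl, rfl⟩
      · exfalso
        rcases hcase with h | h
        · omega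
        · exact h ⟨by rw [e2]; simp, by rw [e1]; simp⟩
    rw [recTab_of_ne_nil hL0, ins_of_ne_nil hL0, List.zip_cons_cons, signature_cons]
    rw [recTab_of_ne_nil hL0, ins_of_ne_nil hL0] at step
    have hmem : 0 < L.count (0, 0) → (0, 0) ∈ L := List.count_pos_iff.1
    split_ifs with h1 h2
    · have h3 := n1 h1
      cases P with
      | nil =>
        have hacc : (([] : List ℕ).map (Prod.mk true) ++ M.map (Prod.mk false)) =
            M.map (Prod.mk false) := rfl
        have hsig : (match (([] : List ℕ).map (Prod.mk true) ++ M.map (Prod.mk false)) with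
            | (true, _) :: acc' => signature (k + 1)
                ((recTab (pout L)).zip (ins ((pout L).map Prod.snd))) acc'
            | acc' => signature (k + 1)
                ((recTab (pout L)).zip (ins ((pout L).map Prod.snd))) ((false, k) :: acc')) =
            signature (k + 1) ((recTab (pout L)).zip (ins ((pout L).map Prod.snd)))
              (([] : List ℕ).map (Prod.mk true) ++ (k :: M).map (Prod.mk false)) := by
          cases M <;> rfl
        rw [hsig]
        obtain ⟨i1, i2⟩ := ih (k + 1) [] (k :: M)
        refine ⟨fun h => by simp at h; omega, fun _ => ?_⟩
        -- If no copy was bumped, the `-` of this column is the left-most one to survive and its top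
        -- boxes are the ones removed; otherwise the relevant column is further left.
        rcases Nat.eq_zero_or_pos ((pout L).count (0, 0)) with hz | hz
        · refine ⟨0, i1 (by simp [hz]), ?_⟩
          rcases peel_erase_zero hL (hmem (by omega)) with ⟨e1, e2, e3, e4⟩ | ⟨e1, e2, e3, e4⟩
          · exact absurd (List.count_pos_iff.2 e3) (by omega)
          · rw [e1, e2, removeTop_zero fun D hD => ne_nil_of_mem_recTab hD,
              removeTop_zero fun D hD => ((semistandard_ins _).1 D hD).1]
            by_cases hn : L.erase (0, 0) = []
            · rw [hn] at e3
              rw [hn, e3]; simp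
            · have hn2 := pcol_ne_nil hn
              have hn3 : prec (L.erase (0, 0)) ≠ [] := by
                have := length_prec (L.erase (0, 0))
                have := List.length_pos_iff.2 hn2
                exact List.length_pos_iff.1 (by omega)
              rw [if_neg hn2, if_neg hn3, recTab_of_ne_nil hn, ins_of_ne_nil hn, e3]
              exact ⟨rfl, rfl⟩
        · exact step _ (hmem (by omega)) (Or.inl hz) (i2 (by simpa using hz))
      | cons x P =>
        simp only [List.map_cons, List.cons_append]
        obtain ⟨i1, i2⟩ := ih (k + 1) P M
        refine ⟨fun h => i1 (by simp at h; omega), fun h => ?_⟩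
        simp only [List.length_cons] at h
        exact step _ (hmem (by omega)) (Or.inl (by omega)) (i2 (by omega))
    · have h3 := n2 h2
      obtain ⟨i1, i2⟩ := ih (k + 1) (k :: P) M
      simp only [List.map_cons, List.cons_append, List.length_cons] at i1 i2
      refine ⟨fun h => i1 (by omega), fun h => ?_⟩
      exact step _ (hmem (by omega)) (Or.inr h1) (i2 (by omega))
    · have h3 := n3 (by tauto)
      obtain ⟨i1, i2⟩ := ih (k + 1) P M
      refine ⟨fun h => i1 (by omega), fun h => ?_⟩
      exact step _ (hmem (by omega)) (Or.inr h1) (i2 (by omega))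

/-! ### Compatibility of κ with all raising operators -/

theorem ofBiword_apply (L : List (ℕ × ℕ)) (p : ℕ × ℕ) : ofBiword L p = L.count p := by
  rw [ofBiword, Multiset.toFinsupp_apply, Multiset.coe_count]
  congr 1
  exact lawful_beq_subsingleton _ _

theorem count_biword' (A : Mat) (p : ℕ × ℕ) : (biword' A).count p = A p := by
  rw [← ofBiword_apply, ofBiword_biword']

theorem biword'_sub_single {A : Mat} (p : ℕ × ℕ) :
    biword' (A - Finsupp.single p 1) = (biword' A).erase p := by
  have : A - Finsupp.single p 1 = ofBiword ((biword' A).erase p) := by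
    ext q
    rw [ofBiword_apply, Finsupp.tsub_apply, Finsupp.single_apply, List.count_erase, count_biword']
    by_cases h : p = q <;> simp [h]
  rw [this, biword'_ofBiword ((biword'_sorted A).sublist List.erase_sublist)]

theorem bitabE0_kappa (A : Mat) : bitabE 0 (kappa A) = (matE 0 A).map kappa := by
  obtain ⟨h1, h2⟩ := find_signature (biword'_sorted A) 0 [] []
  simp only [List.length_nil, Nat.le_zero, count_biword', List.map_nil, List.append_nil,
    List.head?_nil] at h1 h2
  change bitabE0 (kappa A) =
    (if A (0, 0) = 0 then none else some (A - Finsupp.single (0, 0) 1)).map kappa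
  rw [bitabE0, kappa_eq]
  split_ifs with h
  · rw [h1 h]; rfl
  · obtain ⟨j, j1, j2, j3⟩ := h2 (Nat.pos_of_ne_zero h)
    rw [j1, Option.map_some, Option.map_some, kappa_eq, biword'_sub_single, ← j2, ← j3]
    simp

/-- The map `κ` is a morphism of crystals. -/
theorem bitabE_kappa (i : ℤ) (A : Mat) : bitabE i (kappa A) = (matE i A).map kappa := by
  rcases i with (_ | c) | c
  · exact bitabE0_kappa A
  · exact tabE_kappa c A
  · exact tabE_kappa_neg c A

/-! ## Highest weight tableaux -/

theorem wordWt_range (c n : ℕ) : wordWt c (List.range n) = if n = c + 1 then 1 else 0 := by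
  induction n with
  | zero => simp
  | succ n ih =>
    rw [List.range_succ, wordWt_append, ih, wordWt_cons, wordWt_nil]
    unfold letterWt letterPhi letterEps
    split_ifs <;> omega

theorem eq_range_reverse_or {C : List ℕ} (hC : C.Pairwise (· > ·)) :
    C = (List.range C.length).reverse ∨ ∃ c, c + 1 ∈ C ∧ c ∉ C := by
  induction C with
  | nil => left; rfl
  | cons x D ih =>
    obtain ⟨h1, h2⟩ := List.pairwise_cons.1 hC
    rcases ih h2 with h | ⟨c, hc, hc'⟩
    · have hmem : ∀ y, y ∈ D ↔ y < D.length := by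
        intro y
        conv_lhs => rw [h]
        simp
      have hx : D.length ≤ x := by
        by_contra hlt
        have := h1 x ((hmem x).2 (by omega))
        omega
      rcases hx.eq_or_lt with rfl | hx
      · left
        rw [List.length_cons, List.range_succ, List.reverse_append, ← h]; rfl
      · right
        refine ⟨x - 1, ?_, ?_⟩
        · rw [Nat.sub_add_cancel (by omega)]; simp
        · rw [List.mem_cons, hmem]; omega
    · right
      refine ⟨c, by simp [hc], ?_⟩
      have := h1 _ hc
      rw [List.mem_cons, not_or]
      exact ⟨by omega, hc'⟩

theorem one_le_wordEps_reverse {c : ℕ} {C : List ℕ} (hC : C.Pairwise (· > ·)) (h1 : c + 1 ∈ C)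
    (h2 : c ∉ C) : 1 ≤ wordEps c C.reverse := by
  obtain ⟨lo, hi, rfl⟩ := List.append_of_mem h1
  have hin : Inert c hi.reverse := by
    refine inert_of_lt fun x hx => ?_
    rw [List.mem_reverse] at hx
    have h3 := (List.pairwise_cons.1 (List.pairwise_append.1 hC).2.1).1 x hx
    have : x ≠ c := by rintro rfl; exact h2 (by simp [hx])
    omega
  rw [List.reverse_append, List.reverse_cons, List.append_assoc, wordEps_append, hin.eps_wt.2,
    List.singleton_append, wordEps_cons, letterEps_succ]
  omega

/-- A gap `c + 1 ∈ C`, `c ∉ C` gives the column positive `ε`, and the columns already read do not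
compensate, since their weight for the colour `c` vanishes. That stays true: a column `0, …, n - 1`
has nonzero weight only for the colour `n - 1`, and all entries further left are below `n`. -/
theorem columns_of_wordEps_eq_zero {T : Tab} (hT : Semistandard T) (u : List ℕ)
    (hu : ∀ c, (∃ C ∈ T, ∃ x ∈ C, c + 1 ≤ x) → wordWt c u = 0)
    (h : ∀ c, wordEps c (u ++ colWord T) = 0) : ∀ C ∈ T, C = (List.range C.length).reverse := by
  induction T generalizing u with
  | nil => simp
  | cons C T ih =>
    obtain ⟨h1, h2, h3, h4⟩ := semistandard_cons.1 hT
    have hC : C = (List.range C.length).reverse := by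
      rcases eq_range_reverse_or h2 with hC | ⟨c, hc, hc'⟩
      · exact hC
      · exfalso
        have e1 := one_le_wordEps_reverse h2 hc hc'
        have e2 := h c
        rw [colWord_cons, wordEps_append, wordEps_append,
          hu c ⟨C, by simp, _, hc, le_rfl⟩] at e2
        omega
    intro D hD
    rcases List.mem_cons.1 hD with rfl | hD
    · exact hC
    · refine ih h4 (u ++ C.reverse) ?_ (fun c => ?_) D hD
      · rintro c ⟨D, hD, x, hx, hcx⟩
        obtain ⟨i, hi⟩ := List.getElem?_of_mem hx
        obtain ⟨y, hy, hxy⟩ := h3 D hD i x hi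
        have hyC := List.mem_of_getElem? hy
        have hlt : y < C.length := by
          rw [hC] at hyC; simpa using hyC
        rw [wordWt_append, hu c ⟨C, by simp, y, hyC, by omega⟩, hC, List.reverse_reverse,
          wordWt_range, if_neg (by omega), zero_add]
      · have := h c
        rwa [colWord_cons, ← List.append_assoc] at this

/-! ## Diagonal matrices -/

theorem peel_replicate {M : List (ℕ × ℕ)} {k : ℕ} (h : ∀ x ∈ pcol M, k < x) (t a : ℕ) :
    pcol (List.replicate (a + 1) (t, k) ++ M) = pcol M ++ [k] ∧
      prec (List.replicate (a + 1) (t, k) ++ M) = prec M ++ [t] ∧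
      pout (List.replicate (a + 1) (t, k) ++ M) = List.replicate a (t, k) ++ pout M := by
  induction a with
  | zero => simp [pcol_cons, prec_cons, pout_cons, colInsert_of_forall_lt h]
  | succ a ih =>
    rw [List.replicate_succ, List.cons_append, pcol_cons, prec_cons, pout_cons, ih.1, ih.2.1,
      ih.2.2, colInsert_append_cons h le_rfl]
    simp [List.replicate_succ]

/-- The biword of the diagonal matrix with entries `a i`, for `s ≤ i < s + k`. -/
def diagWord (a : ℕ → ℕ) (s k : ℕ) : List (ℕ × ℕ) :=
  (List.range' s k).flatMap fun i => List.replicate (a i) (i, i)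

theorem diagWord_succ (a : ℕ → ℕ) (s k : ℕ) :
    diagWord a s (k + 1) = List.replicate (a s) (s, s) ++ diagWord a (s + 1) k := by
  simp [diagWord, List.range'_succ]

theorem diagWord_sorted (a : ℕ → ℕ) (s k : ℕ) : (diagWord a s k).Pairwise omegaLE' ∧
    ∀ p ∈ diagWord a s k, s ≤ p.1 := by
  induction k generalizing s with
  | zero => simp [diagWord]
  | succ k ih =>
    rw [diagWord_succ]
    obtain ⟨i1, i2⟩ := ih (s + 1)
    refine ⟨List.pairwise_append.2 ⟨List.pairwise_replicate.2 (Or.inr (refl _)), i1, ?_⟩, ?_⟩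
    · intro p hp q hq
      rw [List.eq_of_mem_replicate hp]
      exact Or.inl (i2 q hq)
    · intro p hp
      rcases List.mem_append.1 hp with hp | hp
      · rw [List.eq_of_mem_replicate hp]
      · exact (Nat.le_succ s).trans (i2 p hp)

/-- Insertion goes from large to small letters, so the first copy of each diagonal position makes
both columns grow and each further copy bumps an equal letter. Peeling lowers every nonzero diagonal
entry by one. -/
theorem peel_diagWord {a b : ℕ → ℕ} {n : ℕ} (h1 : ∀ i < n, a i = b i + 1)
    (h2 : ∀ i, n ≤ i → a i = 0 ∧ b i = 0) (s k : ℕ) :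
    pcol (diagWord a s k) = ((List.range' s k).filter (· < n)).reverse ∧
      prec (diagWord a s k) = ((List.range' s k).filter (· < n)).reverse ∧
      pout (diagWord a s k) = diagWord b s k := by
  induction k generalizing s with
  | zero => exact ⟨rfl, rfl, rfl⟩
  | succ k ih =>
    obtain ⟨i1, i2, i3⟩ := ih (s + 1)
    rw [diagWord_succ, diagWord_succ, List.range'_succ, List.filter_cons]
    by_cases hs : s < n
    · obtain ⟨j1, j2, j3⟩ := peel_replicate (M := diagWord a (s + 1) k) (k := s) (by
        rw [i1]
        intro x hx
        simp only [List.mem_reverse, List.mem_filter, List.mem_range'_1] at hx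
        omega) s (b s)
      rw [h1 s hs, j1, j2, j3, i1, i2, i3]
      simp [hs]
    · obtain ⟨e1, e2⟩ := h2 s (by omega)
      simp [e1, e2, hs, i1, i2, i3]

theorem filter_range'_lt {n D : ℕ} (h : n ≤ D) :
    (List.range' 0 D).filter (· < n) = List.range n := by
  obtain ⟨m, rfl⟩ := Nat.exists_eq_add_of_le h
  rw [← List.range_eq_range', List.range_add, List.filter_append, List.filter_eq_self.2 (by simp),
    List.filter_eq_nil_iff.2 (by simp), List.append_nil]

/-- The `i`-th diagonal entry counts the columns longer than `i`, that is, the diagonal is the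
conjugate partition; it is built up by one column at a time. -/
theorem exists_diagWord {l : List ℕ} (hl : l.Pairwise (· ≥ ·)) (h0 : ∀ n ∈ l, 0 < n) {D : ℕ}
    (hD : ∀ n ∈ l, n ≤ D) : ∃ a : ℕ → ℕ, (∀ i, (∀ n ∈ l, n ≤ i) → a i = 0) ∧
      recTab (diagWord a 0 D) = l.map (fun n => (List.range n).reverse) ∧
      ins ((diagWord a 0 D).map Prod.snd) = l.map (fun n => (List.range n).reverse) := by
  induction l with
  | nil =>
    refine ⟨fun _ => 0, by simp, ?_⟩
    have : diagWord (fun _ => 0) 0 D = [] := by simp [diagWord]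
    simp [this]
  | cons n l ih =>
    obtain ⟨h1, h2⟩ := List.pairwise_cons.1 hl
    obtain ⟨b, b1, b2, b3⟩ := ih h2 (fun m hm => h0 m (by simp [hm])) fun m hm => hD m (by simp [hm])
    have hnD := hD n (by simp)
    have hn0 := h0 n (by simp)
    have key := peel_diagWord (a := fun i => if i < n then b i + 1 else 0) (b := b) (n := n)
      (fun i hi => if_pos hi)
      (fun i hi => ⟨if_neg (by omega), b1 i fun m hm => (h1 m hm).trans hi⟩) 0 D
    rw [filter_range'_lt hnD] at key
    refine ⟨fun i => if i < n then b i + 1 else 0, fun i hi => if_neg ?_, ?_⟩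
    · have := hi n (by simp); omega
    · have hne : diagWord (fun i => if i < n then b i + 1 else 0) 0 D ≠ [] := by
        intro h
        rw [h] at key
        have := congrArg List.length key.1
        simp [pcol, peel] at this
        omega
      rw [recTab_of_ne_nil hne, ins_of_ne_nil hne, key.1, key.2.1, key.2.2, b2, b3]
      exact ⟨rfl, rfl⟩

/-! ## Bijectivity -/

theorem length_recTab (L : List (ℕ × ℕ)) :
    (recTab L).map List.length = (ins (L.map Prod.snd)).map List.length := by
  induction L using ins_map_snd_induction with
  | h0 => simp
  | h1 L hL ih =>
    rw [recTab_of_ne_nil hL, ins_of_ne_nil hL, List.map_cons, List.map_cons, ih, length_prec]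

theorem kappa_semistandard (A : Mat) : Semistandard (kappa A).1 ∧ Semistandard (kappa A).2 ∧
    (kappa A).1.map List.length = (kappa A).2.map List.length := by
  have h : ∀ A : Mat, Semistandard (kappa A).2 := fun A => by
    rw [kappa_eq]; exact semistandard_ins _
  refine ⟨?_, h A, ?_⟩
  · have := h (transposeMat A)
    rwa [kappa_transposeMat] at this
  · rw [kappa_eq]; exact length_recTab _

theorem RaiseTab.unique {c : ℕ} {T T' U : Tab} (h : RaiseTab c T U) (h' : RaiseTab c T' U) :
    T = T' := by
  refine eq_of_colWord_eq (by rw [← h.1, h'.1]) ?_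
  have h1 := wordE_eq_some_iff_wordF.1 h.2
  rw [wordE_eq_some_iff_wordF.1 h'.2] at h1
  exact (Option.some.inj h1).symm

/-- Raising the row word and inserting the result gives the raised tableau, which is semistandard
because it is an insertion tableau. -/
theorem exists_raiseTab {T : Tab} (hT : Semistandard T) {c : ℕ} (h : wordEps c (colWord T) ≠ 0) :
    ∃ U, Semistandard U ∧ RaiseTab c T U := by
  have h1 : wordEps c (rowWord (T.headD []).length T) ≠ 0 := by
    rwa [(wordEps_rowWord c hT hT.length_le).1]
  obtain ⟨v, hv⟩ := Option.ne_none_iff_exists'.1 (fun h2 => h1 (wordE_eq_none.1 h2))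
  have hlen := wordE_length hv
  set u := rowWord (T.headD []).length T with hu
  have hr : RaiseLetters c (u.map fun x => (0, x)) (v.map fun x => (0, x)) := by
    refine ⟨?_, ?_⟩
    · simp [List.map_map, Function.comp_def, hlen]
    · simpa [List.map_map, Function.comp_def] using hv
  refine ⟨ins v, ?_, ?_⟩
  · have := semistandard_ins (v.map fun x => (0, x))
    simpa [List.map_map, Function.comp_def] using this
  · have := hr.tab.1
    simp only [List.map_map, Function.comp_def, List.map_id'] at this
    rwa [hu, ins_rowWord hT hT.length_le] at this

theorem RaiseTab.sum_lt {c : ℕ} {T U : Tab} (h : RaiseTab c T U) :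
    (colWord U).sum < (colWord T).sum := by
  obtain ⟨u, v, h1, h2, -, -⟩ := wordE_eq_some.1 h.2
  rw [h1, h2]; simp

/-- Lowering of `A` is possible since `φ` of its word is that of `U`. The lowered matrix keeps the
first tableau, and its second tableau has the same raising as `T`, hence equals `T`. -/
theorem exists_kappa_of_raiseTab {c : ℕ} {T U : Tab} {A : Mat} (h : RaiseTab c T U)
    (hA : (kappa A).2 = U) : ∃ B, kappa B = ((kappa A).1, T) := by
  have h1 : wordPhi c (colWord U) ≠ 0 := by
    rw [Ne, ← wordF_eq_none, wordE_eq_some_iff_wordF.1 h.2]; simp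
  have h2 : matF (Int.ofNat (c + 1)) A ≠ none := by
    rw [Ne, matF_ofNat_succ_eq_none, ← wordPhi_colWord_ins]
    rw [kappa_eq] at hA
    dsimp only at hA
    rwa [hA]
  obtain ⟨B, hB⟩ := Option.ne_none_iff_exists'.1 h2
  obtain ⟨h3, h4⟩ := raiseTab_kappa (matE_eq_some_iff_matF.2 hB)
  rw [hA] at h3
  exact ⟨B, Prod.ext h4.symm (h3.unique h)⟩

theorem Semistandard.length_pairwise {T : Tab} (h : Semistandard T) :
    (T.map List.length).Pairwise (· ≥ ·) :=
  List.pairwise_map.2 (h.2.imp fun h => h.length_le)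

/-- Raising either tableau lowers the sum of the entries, and preimages are pulled back by lowering.
When nothing can be raised, the columns are initial intervals and a diagonal matrix is the preimage.
-/
theorem exists_kappa_eq {S T : Tab} (hS : Semistandard S) (hT : Semistandard T)
    (h : S.map List.length = T.map List.length) : ∃ A, kappa A = (S, T) := by
  induction hn : (colWord S).sum + (colWord T).sum using Nat.strong_induction_on
    generalizing S T with
  | _ n ih =>
    by_cases h1 : ∃ c, wordEps c (colWord T) ≠ 0
    · obtain ⟨c, hc⟩ := h1
      obtain ⟨U, hU, hr⟩ := exists_raiseTab hT hc
      obtain ⟨A, hA⟩ := ih _ (by have := hr.sum_lt; omega) hS hU (h.trans hr.1.symm) rfl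
      obtain ⟨B, hB⟩ := exists_kappa_of_raiseTab (A := A) hr (by rw [hA])
      exact ⟨B, by rw [hB, hA]⟩
    by_cases h2 : ∃ c, wordEps c (colWord S) ≠ 0
    · obtain ⟨c, hc⟩ := h2
      obtain ⟨U, hU, hr⟩ := exists_raiseTab hS hc
      obtain ⟨A, hA⟩ := ih _ (by have := hr.sum_lt; omega) hU hT (hr.1.trans h) rfl
      obtain ⟨B, hB⟩ := exists_kappa_of_raiseTab (A := transposeMat A) hr
        (by rw [kappa_transposeMat, hA]; rfl)
      refine ⟨transposeMat B, ?_⟩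
      rw [kappa_transposeMat, hB, kappa_transposeMat, hA]; rfl
    · push Not at h1 h2
      have high : ∀ {T : Tab}, Semistandard T → (∀ c, wordEps c (colWord T) = 0) →
          T = (T.map List.length).map fun n => (List.range n).reverse := by
        intro T hT hz
        have := columns_of_wordEps_eq_zero hT [] (fun _ _ => rfl) hz
        rw [List.map_map]
        conv_lhs => rw [← List.map_id T]
        exact List.map_congr_left this
      obtain ⟨a, -, a1, a2⟩ := exists_diagWord (l := T.map List.length) hT.length_pairwise
        (by
          intro n hn
          obtain ⟨C, hC, rfl⟩ := List.mem_map.1 hn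
          exact List.length_pos_iff.2 (hT.1 C hC).1) (D := (T.map List.length).sum)
        (fun n hn => List.le_sum_of_mem hn)
      refine ⟨ofBiword (diagWord a 0 (T.map List.length).sum), ?_⟩
      rw [kappa_eq, biword'_ofBiword (diagWord_sorted _ _ _).1, a1, a2, ← high hT h1]
      rw [high hS h2, h, ← high hT h1]

/-! ### Injectivity -/

/-- A positive weight which is decreased by the raising operators. -/
noncomputable def matWeight (A : Mat) : ℕ := ((biword' A).map fun p => p.1 + p.2 + 1).sum

theorem matWeight_transposeMat (A : Mat) : matWeight (transposeMat A) = matWeight A := by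
  have h : (biword' (transposeMat A)).Perm ((biword' A).map Prod.swap) := by
    rw [biword'_transposeMat]
    refine List.Perm.map _ (Multiset.coe_eq_coe.1 ?_)
    rw [coe_biword, coe_biword']
  rw [matWeight, matWeight, (h.map _).sum_eq, List.map_map]
  congr 1
  refine List.map_congr_left fun p _ => ?_
  simp; omega

theorem matWeight_lt_of_matE {i : ℤ} {A B : Mat} (h : matE i A = some B) :
    matWeight B < matWeight A := by
  have pos : ∀ (c : ℕ) {A B : Mat}, matE (Int.ofNat (c + 1)) A = some B →
      matWeight B < matWeight A := by
    intro c A B h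
    obtain ⟨L1, k, L2, h1, h2, -, -⟩ := (matE_ofNat_succ.1 h).split
    rw [matWeight, matWeight, h1, h2]
    simp
  rcases i with (_ | c) | c
  · simp only [matE] at h
    split_ifs at h with h0
    obtain rfl := Option.some.inj h
    rw [matWeight, matWeight, biword'_sub_single]
    have hm : (0, 0) ∈ biword' A := List.count_pos_iff.1 (by rw [count_biword']; omega)
    rw [((List.perm_cons_erase hm).map _).sum_eq]
    simp
  · exact pos c h
  · rw [matE_negSucc, map_transposeMat_eq_some] at h
    have := pos c h
    rwa [matWeight_transposeMat, matWeight_transposeMat] at this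

theorem biword'_eq_nil {A : Mat} : biword' A = [] ↔ A = 0 := by
  constructor
  · intro h
    ext p
    rw [← count_biword', h]; simp
  · rintro rfl
    rw [List.eq_nil_iff_forall_not_mem]
    intro p hp
    have := List.count_pos_iff.2 hp
    rw [count_biword'] at this
    simp at this

/-- A word with positive first letter `c + 1` can be raised in the colour `c`. If the words of rows
and of columns both start with zero, then the first column is occupied and its last occupied row is
the first one, so the entry at the first position is nonzero. -/
theorem exists_matE_eq_some {A : Mat} (hA : A ≠ 0) : ∃ i B, matE i A = some B := by
  have pos : ∀ {A : Mat} {p : ℕ × ℕ} {L : List (ℕ × ℕ)}, biword' A = p :: L → 0 < p.2 →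
      ∃ c B, matE (Int.ofNat (c + 1)) A = some B := by
    intro A p L hL hp
    obtain ⟨c, hc⟩ := Nat.exists_eq_succ_of_ne_zero hp.ne'
    refine ⟨c, Option.ne_none_iff_exists'.1 fun h => ?_⟩
    rw [matE_ofNat_succ_eq_none, hL, List.map_cons, wordEps_cons, hc, letterEps_succ] at h
    omega
  have hA' : transposeMat A ≠ 0 := by
    intro h
    apply hA
    ext ⟨i, j⟩
    rw [← transposeMat_apply, h]; rfl
  cases h1 : biword' A with
  | nil => exact absurd (biword'_eq_nil.1 h1) hA
  | cons p L =>
    cases h2 : biword' (transposeMat A) with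
    | nil => exact absurd (biword'_eq_nil.1 h2) hA'
    | cons q M =>
      rcases Nat.eq_zero_or_pos p.2 with hp | hp
      · rcases Nat.eq_zero_or_pos q.2 with hq | hq
        · have hp' : (0, p.1) ∈ biword' (transposeMat A) := by
            refine List.count_pos_iff.1 ?_
            rw [count_biword', transposeMat_apply, show (p.1, 0) = p from Prod.ext rfl hp.symm,
              ← count_biword', h1, List.count_cons_self]
            omega
          have hq' : q ∈ biword' (transposeMat A) := by rw [h2]; simp
          have hle : q.1 = 0 := by
            have hs := biword'_sorted (transposeMat A)
            rw [h2] at hs hp'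
            rcases List.mem_cons.1 hp' with h | h
            · rw [← h]
            · have := (List.pairwise_cons.1 hs).1 _ h
              unfold omegaLE' at this
              simp only at this; omega
          have h0 : A (0, 0) ≠ 0 := by
            have := List.count_pos_iff.2 hq'
            rw [count_biword', show q = (0, 0) from Prod.ext hle hq, transposeMat_apply] at this
            omega
          exact ⟨0, _, if_neg h0⟩
        · obtain ⟨c, B, hB⟩ := pos h2 hq
          exact ⟨Int.negSucc c, transposeMat B, by rw [matE_negSucc, hB]; rfl⟩
      · obtain ⟨c, hB⟩ := pos h1 hp
        exact ⟨_, hB⟩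

/-- A raising operator that acts on `A` acts on every `B` with the same image, since κ is a
morphism; induction identifies the raised matrices, and lowering recovers `A` and `B`. -/
theorem kappa_injective : Function.Injective kappa := by
  intro A
  induction hn : matWeight A using Nat.strong_induction_on generalizing A with
  | _ n ih =>
    intro B h
    by_cases hA : A = 0
    · subst hA
      have h1 := congrArg Prod.snd h
      rw [kappa_eq, kappa_eq, biword'_eq_nil.2 rfl] at h1
      by_contra hB
      have hne : biword' B ≠ [] := fun h => hB (biword'_eq_nil.1 h).symm
      simp [ins_of_ne_nil hne] at h1
    · obtain ⟨i, A', hA'⟩ := exists_matE_eq_some hA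
      have h1 := bitabE_kappa i A
      rw [h, bitabE_kappa i B, hA', Option.map_some, Option.map_eq_some_iff] at h1
      obtain ⟨B', hB', hk⟩ := h1
      obtain rfl := ih _ (hn ▸ matWeight_lt_of_matE hA') rfl hk.symm
      rw [matE_eq_some_iff_matF] at hA' hB'
      rw [hA'] at hB'
      exact Option.some.inj hB'

/-! ### Semistandard tableaux of given shape -/

theorem isSST_iff {ν : YoungDiagram} {T : Tab} :
    IsSST ν T ↔ Semistandard T ∧ T.map List.length = ν.transpose.rowLens := by
  constructor
  · rintro ⟨h1, h2, h3⟩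
    refine ⟨⟨fun C hC => ⟨?_, h2 C hC⟩, ?_⟩, h1⟩
    · have : C.length ∈ ν.transpose.rowLens := by rw [← h1]; exact List.mem_map_of_mem hC
      exact List.length_pos_iff.1 (YoungDiagram.pos_of_mem_rowLens _ _ this)
    · have hs := ν.transpose.rowLens_sorted.pairwise
      rw [← h1] at hs
      have : IsTrans (List ℕ) (fun C D => ColLE D C) := ⟨fun _ _ _ h h' => h'.trans h⟩
      refine List.isChain_iff_pairwise.1 (List.isChain_iff_getElem.2 fun j hj => ?_)
      intro i x hx
      have hlen := List.pairwise_iff_getElem.1 hs j (j + 1) (by simp; omega) (by simpa using hj)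
        (by omega)
      simp only [List.getElem_map] at hlen
      have hi := (List.getElem?_eq_some_iff.1 hx).1
      have hi' : i < T[j].length := by omega
      exact ⟨T[j][i], List.getElem?_eq_getElem hi',
        h3 i j _ _ _ _ (List.getElem?_eq_getElem (by omega)) (List.getElem?_eq_getElem hj)
          (List.getElem?_eq_getElem hi') hx⟩
  · rintro ⟨h1, h2⟩
    refine ⟨h2, fun C hC => (h1.1 C hC).2, ?_⟩
    intro i j C D x y hC hD hx hy
    obtain ⟨hj, rfl⟩ := List.getElem?_eq_some_iff.1 hC
    obtain ⟨hj', rfl⟩ := List.getElem?_eq_some_iff.1 hD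
    obtain ⟨z, hz, hyz⟩ := List.pairwise_iff_getElem.1 h1.2 j (j + 1) hj hj' (by omega) i y hy
    rw [hz] at hx
    obtain rfl := Option.some.inj hx
    exact hyz

theorem Semistandard.exists_isSST {T : Tab} (h : Semistandard T) : ∃ ν, IsSST ν T := by
  have hs : (T.map List.length).SortedGE := h.length_pairwise.sortedGE
  refine ⟨(YoungDiagram.ofRowLens _ hs).transpose, isSST_iff.2 ⟨h, ?_⟩⟩
  rw [YoungDiagram.transpose_transpose, YoungDiagram.rowLens_ofRowLens_eq_self]
  intro n hn
  obtain ⟨C, hC, rfl⟩ := List.mem_map.1 hn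
  exact List.length_pos_iff.2 (h.1 C hC).1

/-! ## Corners of a support and first columns -/

/-- The point `p` is the first of `k + 1` points of `S` with strictly increasing coordinates. -/
def StartsChain (S : Set (ℕ × ℕ)) : ℕ → ℕ × ℕ → Prop
  | 0, p => p ∈ S
  | k + 1, p => p ∈ S ∧ ∃ q, StartsChain S k q ∧ p.1 < q.1 ∧ p.2 < q.2

theorem StartsChain.mem {S : Set (ℕ × ℕ)} {k : ℕ} {p : ℕ × ℕ} (h : StartsChain S k p) : p ∈ S := by
  cases k with
  | zero => exact h
  | succ k => exact h.1

/-- A point of `S` avoids the border strip exactly if another point of `S` lies strictly below and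
to the right; iterating this turns the peeling of border strips into lengths of chains. -/
theorem mem_sdiff_borderStrip {S : Finset (ℕ × ℕ)} {p : ℕ × ℕ} :
    p ∈ S \ borderStrip S ↔ StartsChain (S : Set (ℕ × ℕ)) 1 p := by
  have h1 : p ∈ S → p ∈ hull S := fun h => mem_hull.2 ⟨p, h, le_rfl⟩
  simp only [Finset.mem_sdiff, borderStrip, Finset.mem_filter, YoungDiagram.mem_cells, StartsChain,
    Finset.mem_coe]
  have h2 : (p.1 + 1, p.2 + 1) ∈ hull S ↔ ∃ q, q ∈ S ∧ p.1 < q.1 ∧ p.2 < q.2 := by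
    rw [mem_hull]; rfl
  rw [h2]
  exact ⟨fun h => ⟨h.1, by_contra fun h3 => h.2 ⟨h1 h.1, h3⟩⟩, fun h => ⟨h.1, fun h3 => h3.2 h.2⟩⟩

theorem startsChain_sdiff_borderStrip {S : Finset (ℕ × ℕ)} {k : ℕ} {p : ℕ × ℕ} :
    StartsChain (↑(S \ borderStrip S) : Set (ℕ × ℕ)) k p ↔
      StartsChain (S : Set (ℕ × ℕ)) (k + 1) p := by
  induction k generalizing p with
  | zero => exact mem_sdiff_borderStrip
  | succ k ih =>
    rw [StartsChain, Finset.mem_coe, mem_sdiff_borderStrip]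
    simp only [ih]
    constructor
    · rintro ⟨h1, q, h2, h3⟩
      exact ⟨h1.1, q, h2, h3⟩
    · rintro ⟨h1, q, h2, h3⟩
      exact ⟨⟨h1, q, h2.1, h3⟩, q, h2, h3⟩

/-- After `k` border strips are removed, exactly the starting points of chains of `k + 1` points are
left, and the corner records their maximal row and column. The default `(0, 0)` past the end matches
the absence of such chains. -/
theorem lt_corners_getD {S : Finset (ℕ × ℕ)} {k x : ℕ} :
    (x < ((corners S).getD k (0, 0)).1 ↔ ∃ p, StartsChain (S : Set (ℕ × ℕ)) k p ∧ x ≤ p.1) ∧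
      (x < ((corners S).getD k (0, 0)).2 ↔ ∃ p, StartsChain (S : Set (ℕ × ℕ)) k p ∧ x ≤ p.2) := by
  induction k generalizing S with
  | zero =>
    rw [corners]
    split_ifs with h
    · simp only [List.getD_cons_zero, corner, ← YoungDiagram.mem_iff_lt_colLen,
        ← YoungDiagram.mem_iff_lt_rowLen, mem_hull, StartsChain, Finset.mem_coe]
      constructor <;> refine exists_congr fun p => and_congr_right fun _ => ?_
      · exact ⟨fun h => h.1, fun h => ⟨h, Nat.zero_le _⟩⟩
      · exact ⟨fun h => h.2, fun h => ⟨Nat.zero_le _, h⟩⟩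
    · rw [Finset.not_nonempty_iff_eq_empty] at h
      subst h
      simp [StartsChain]
  | succ k ih =>
    rw [corners]
    split_ifs with h
    · rw [List.getD_cons_succ]
      simp only [ih, startsChain_sdiff_borderStrip, and_self]
    · rw [Finset.not_nonempty_iff_eq_empty] at h
      subst h
      simp [StartsChain]

theorem suppShape_le_iff {S : Finset (ℕ × ℕ)} {μ : YoungDiagram} : suppShape S ≤ μ ↔
    ∀ k p, StartsChain (S : Set (ℕ × ℕ)) k p → (k + p.1, k) ∈ μ ∧ (k, k + p.2) ∈ μ := by
  have hlen : ∀ k (hk : k < (corners S).length), (corners S)[k] = (corners S).getD k (0, 0) :=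
    fun k hk => (List.getD_eq_getElem _ _ hk).symm
  constructor
  · intro h k p hp
    have h1 := lt_corners_getD.1.2 ⟨p, hp, le_rfl⟩
    have h2 := lt_corners_getD.2.2 ⟨p, hp, le_rfl⟩
    have hk : k < (corners S).length := by
      by_contra hk
      rw [List.getD_eq_default _ _ (by omega)] at h1
      simp at h1
    refine ⟨h (mem_frobeniusCells.2 ⟨k, hk, Or.inl ?_⟩), h (mem_frobeniusCells.2 ⟨k, hk, Or.inr ?_⟩)⟩
    · rw [hlen]; simp only [true_and]; omega
    · rw [hlen]; simp only [true_and]; omega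
  · rintro h ⟨i, j⟩ ha
    obtain ⟨k, hk, h1 | h1⟩ := mem_frobeniusCells.1 ha
    · rw [hlen] at h1
      simp only at h1
      obtain ⟨p, hp, hx⟩ := lt_corners_getD.1.1 (show i - k < ((corners S).getD k (0, 0)).1 by omega)
      obtain ⟨rfl, h2, h3⟩ := h1
      exact μ.isLowerSet (show ((i, j) : ℕ × ℕ) ≤ (j + p.1, j) from ⟨by simp; omega, le_rfl⟩)
        (h j p hp).1
    · rw [hlen] at h1
      simp only at h1
      obtain ⟨p, hp, hx⟩ := lt_corners_getD.2.1 (show j - k < ((corners S).getD k (0, 0)).2 by omega)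
      obtain ⟨rfl, h2, h3⟩ := h1
      exact μ.isLowerSet (show ((i, j) : ℕ × ℕ) ≤ (i, i + p.2) from ⟨le_rfl, by simp; omega⟩)
        (h i p hp).2

/-- The letter `a` lands at the lowest height with no entry above `a` below it or at it. At lower
heights its candidate value is dominated by the entry already there, which is why the condition only
involves the entry just below. The form is chosen to match `startsChain_cons`. -/
theorem getElem?_colInsert {a k x : ℕ} {C : List ℕ} (hC : C.Pairwise (· > ·)) :
    (∃ y, (colInsert a C).1[k]? = some y ∧ x ≤ y) ↔ (∃ y, C[k]? = some y ∧ x ≤ y) ∨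
      (x ≤ a ∧ (k = 0 ∨ ∃ k', k = k' + 1 ∧ ∃ y, C[k']? = some y ∧ a + 1 ≤ y)) := by
  induction C generalizing k with
  | nil => cases k <;> simp [colInsert]
  | cons z C ih =>
    obtain ⟨h1, h2⟩ := List.pairwise_cons.1 hC
    rw [colInsert]
    split_ifs with hz
    · cases k with
      | zero => simp; omega
      | succ k =>
        have : ¬ ∃ y, (z :: C)[k]? = some y ∧ a + 1 ≤ y := by
          rintro ⟨y, hy, hay⟩
          rcases List.mem_cons.1 (List.mem_of_getElem? hy) with rfl | hm
          · omega
          · have := h1 y hm; omega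
        simp only [List.getElem?_cons_succ]
        refine ⟨Or.inl, ?_⟩
        rintro (h | ⟨-, h | ⟨k', hk, h⟩⟩)
        · exact h
        · omega
        · obtain rfl : k = k' := by omega
          exact absurd h this
    · cases k with
      | zero => simp; omega
      | succ k =>
        simp only [List.getElem?_cons_succ]
        rw [ih h2]
        cases k with
        | zero => exact or_congr_right (and_congr_right fun _ =>
            ⟨fun _ => Or.inr ⟨0, rfl, z, rfl, by omega⟩, fun _ => Or.inl rfl⟩)
        | succ k => simp

/-- The new point comes first in the order, so it can only be the start of a chain. A later point
with a strictly larger column lies automatically in a strictly larger row. -/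
theorem startsChain_cons {p : ℕ × ℕ} {L : List (ℕ × ℕ)} (h : (p :: L).Pairwise omegaLE') {k : ℕ}
    {r : ℕ × ℕ} : StartsChain {q | q ∈ p :: L} k r ↔ StartsChain {q | q ∈ L} k r ∨
      (r = p ∧ (k = 0 ∨ ∃ k', k = k' + 1 ∧ ∃ q, StartsChain {q | q ∈ L} k' q ∧ p.2 + 1 ≤ q.2)) := by
  obtain ⟨h1, -⟩ := List.pairwise_cons.1 h
  induction k generalizing r with
  | zero => simp [StartsChain, or_comm]
  | succ k ih =>
    have hnext : ∀ q, p.1 < q.1 → (StartsChain {q | q ∈ p :: L} k q ↔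
        StartsChain {q | q ∈ L} k q) := by
      intro q hq
      rw [ih]
      constructor
      · rintro (h | ⟨rfl, -⟩)
        · exact h
        · omega
      · exact Or.inl
    constructor
    · rintro ⟨hr, q, hq, h2, h3⟩
      have hle : p.1 ≤ r.1 := by
        rcases List.mem_cons.1 hr with rfl | hr
        · exact le_rfl
        · have := h1 r hr; unfold omegaLE' at this; omega
      rw [hnext q (by omega)] at hq
      rcases List.mem_cons.1 hr with rfl | hr
      · exact Or.inr ⟨rfl, Or.inr ⟨k, rfl, q, hq, h3⟩⟩
      · exact Or.inl ⟨hr, q, hq, h2, h3⟩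
    · rintro (⟨hr, q, hq, h2, h3⟩ | ⟨rfl, h | ⟨k', hk, q, hq, h2⟩⟩)
      · refine ⟨List.mem_cons_of_mem _ hr, q, (hnext q ?_).2 hq, h2, h3⟩
        have := h1 r hr; unfold omegaLE' at this; omega
      · omega
      · obtain rfl : k = k' := by omega
        have hlt : r.1 < q.1 := by
          have := h1 q hq.mem; unfold omegaLE' at this; omega
        exact ⟨by simp, q, (hnext q hlt).2 hq, hlt, h2⟩

/-- The maximal column of starting points of chains and the entries of the inserted column obey the
same recursion when a point is added in front. -/
theorem exists_startsChain_iff_pcol {L : List (ℕ × ℕ)} (h : L.Pairwise omegaLE') {k x : ℕ} :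
    (∃ p, StartsChain {q | q ∈ L} k p ∧ x ≤ p.2) ↔ ∃ y, (pcol L)[k]? = some y ∧ x ≤ y := by
  induction L generalizing k x with
  | nil => cases k <;> simp [StartsChain, pcol, peel]
  | cons p L ih =>
    have ih := fun k x => @ih (List.pairwise_cons.1 h).2 k x
    rw [pcol_cons, getElem?_colInsert (pcol_pairwise L), ← ih]
    simp only [← ih, startsChain_cons h, or_and_right, exists_or]
    refine or_congr_right ?_
    constructor
    · rintro ⟨r, ⟨rfl, h1⟩, h2⟩
      exact ⟨h2, h1⟩
    · rintro ⟨h2, h1⟩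
      exact ⟨p, ⟨rfl, h1⟩, h2⟩

theorem StartsChain.swap {S : Set (ℕ × ℕ)} {k : ℕ} {p : ℕ × ℕ} (h : StartsChain S k p) :
    StartsChain (Prod.swap ⁻¹' S) k p.swap := by
  induction k generalizing p with
  | zero => simpa [StartsChain] using h
  | succ k ih =>
    obtain ⟨h1, q, h2, h3, h4⟩ := h
    exact ⟨by simpa using h1, q.swap, ih h2, h4, h3⟩

theorem setOf_mem_biword' (A : Mat) : {q | q ∈ biword' A} = (A.support : Set (ℕ × ℕ)) := by
  ext q
  rw [Set.mem_ofPred_eq, ← List.count_pos_iff, count_biword', Finset.mem_coe, Finsupp.mem_support_iff,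
    Nat.pos_iff_ne_zero]

theorem support_transposeMat (A : Mat) :
    ((transposeMat A).support : Set (ℕ × ℕ)) = Prod.swap ⁻¹' (A.support : Set (ℕ × ℕ)) := by
  ext ⟨i, j⟩
  simp [transposeMat_apply]

/-- The first columns of `κ A` fit into the diagram `μ`. -/
def Fits (μ : YoungDiagram) (A : Mat) : Prop :=
  (∀ k y, (prec (biword' A))[k]? = some y → (k + y, k) ∈ μ) ∧
    ∀ k y, (pcol (biword' A))[k]? = some y → (k, k + y) ∈ μ

theorem exists_startsChain_iff {A : Mat} {k x : ℕ} :
    ((∃ p, StartsChain (A.support : Set (ℕ × ℕ)) k p ∧ x ≤ p.1) ↔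
      ∃ y, (prec (biword' A))[k]? = some y ∧ x ≤ y) ∧
    ((∃ p, StartsChain (A.support : Set (ℕ × ℕ)) k p ∧ x ≤ p.2) ↔
      ∃ y, (pcol (biword' A))[k]? = some y ∧ x ≤ y) := by
  have h : ∀ A : Mat, (∃ p, StartsChain (A.support : Set (ℕ × ℕ)) k p ∧ x ≤ p.2) ↔
      ∃ y, (pcol (biword' A))[k]? = some y ∧ x ≤ y := fun A => by
    rw [← exists_startsChain_iff_pcol (biword'_sorted A), setOf_mem_biword']
  refine ⟨?_, h A⟩
  rw [← (peel_transposeMat A).1, ← h, support_transposeMat]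
  constructor
  · rintro ⟨p, hp, hx⟩
    exact ⟨p.swap, hp.swap, hx⟩
  · rintro ⟨p, hp, hx⟩
    have := hp.swap
    rw [← Set.preimage_comp, Prod.swap_swap_eq, Set.preimage_id] at this
    exact ⟨p.swap, this, hx⟩

/-- The link between supports and tableaux: by `exists_startsChain_iff`, the maximal starting points
of chains in the support are the entries of the two first columns. -/
theorem fits_iff {μ : YoungDiagram} {A : Mat} : suppShape A.support ≤ μ ↔ Fits μ A := by
  rw [suppShape_le_iff]
  constructor
  · intro h
    refine ⟨fun k y hy => ?_, fun k y hy => ?_⟩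
    · obtain ⟨p, hp, hx⟩ := exists_startsChain_iff.1.2 ⟨y, hy, le_rfl⟩
      exact μ.isLowerSet (show ((k + y, k) : ℕ × ℕ) ≤ (k + p.1, k) from ⟨by simpa, le_rfl⟩)
        (h k p hp).1
    · obtain ⟨p, hp, hx⟩ := exists_startsChain_iff.2.2 ⟨y, hy, le_rfl⟩
      exact μ.isLowerSet (show ((k, k + y) : ℕ × ℕ) ≤ (k, k + p.2) from ⟨le_rfl, by simpa⟩)
        (h k p hp).2
  · rintro ⟨h1, h2⟩ k p hp
    obtain ⟨y, hy, hxy⟩ := exists_startsChain_iff.1.1 ⟨p, hp, le_rfl⟩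
    obtain ⟨z, hz, hxz⟩ := exists_startsChain_iff.2.1 ⟨p, hp, le_rfl⟩
    exact ⟨μ.isLowerSet (show ((k + p.1, k) : ℕ × ℕ) ≤ (k + y, k) from ⟨by simpa, le_rfl⟩)
        (h1 k y hy),
      μ.isLowerSet (show ((k, k + p.2) : ℕ × ℕ) ≤ (k, k + z) from ⟨le_rfl, by simpa⟩)
        (h2 k z hz)⟩

theorem mem_boundedMats {w : Equiv.Perm NZ} {A : Mat} : A ∈ boundedMats w ↔ Fits (shape w) A :=
  fits_iff

/-! ### Closure under the raising operators -/

theorem colLE_of_wordE {c : ℕ} {C D : List ℕ} (h : wordE c C.reverse = some D.reverse) :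
    ColLE D C := by
  obtain ⟨u, v, h1, h2, -, -⟩ := wordE_eq_some.1 h
  rw [List.reverse_eq_iff] at h1 h2
  subst h1 h2
  intro i x hx
  simp only [List.reverse_append, List.reverse_cons, List.append_assoc, List.singleton_append]
    at hx ⊢
  rw [List.getElem?_append] at hx ⊢
  split_ifs at hx ⊢ with hi
  · exact ⟨x, hx, le_rfl⟩
  · cases hj : i - v.reverse.length with
    | zero =>
      rw [hj] at hx
      simp only [List.getElem?_cons_zero, Option.some.injEq] at hx
      exact ⟨c + 1, by simp, by omega⟩
    | succ j =>
      rw [hj] at hx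
      exact ⟨x, by simpa using hx, le_rfl⟩

theorem ColLE.refl (C : List ℕ) : ColLE C C := fun _ x hx => ⟨x, hx, le_rfl⟩

theorem colLE_append (C D : List ℕ) : ColLE C (C ++ D) := by
  intro i x hx
  refine ⟨x, ?_, le_rfl⟩
  rw [List.getElem?_append_left (List.getElem?_eq_some_iff.1 hx).1, hx]

/-- For nonzero colours one entry of one first column is lowered or nothing happens to them. For
colour zero both columns stay or lose their top box. -/
theorem colLE_of_matE {i : ℤ} {A B : Mat} (h : matE i A = some B) :
    ColLE (prec (biword' B)) (prec (biword' A)) ∧ ColLE (pcol (biword' B)) (pcol (biword' A)) := by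
  have pos : ∀ (c : ℕ) {A B : Mat}, matE (Int.ofNat (c + 1)) A = some B →
      ColLE (prec (biword' B)) (prec (biword' A)) ∧
        ColLE (pcol (biword' B)) (pcol (biword' A)) := by
    intro c A B h
    obtain ⟨h1, ⟨h2, -, -⟩ | ⟨h2, -, -⟩⟩ := (matE_ofNat_succ.1 h).peel
    · exact ⟨h1 ▸ ColLE.refl _, colLE_of_wordE h2⟩
    · exact ⟨h1 ▸ ColLE.refl _, h2 ▸ ColLE.refl _⟩
  rcases i with (_ | c) | c
  · simp only [matE] at h
    split_ifs at h with h0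
    obtain rfl := Option.some.inj h
    rw [biword'_sub_single]
    have hm : (0, 0) ∈ biword' A := List.count_pos_iff.1 (by rw [count_biword']; omega)
    rcases peel_erase_zero (biword'_sorted A) hm with ⟨h1, h2, -, -⟩ | ⟨h1, h2, -, -⟩
    · rw [h1, h2]; exact ⟨ColLE.refl _, ColLE.refl _⟩
    · rw [h1, h2]; exact ⟨colLE_append _ _, colLE_append _ _⟩
  · exact pos c h
  · rw [matE_negSucc, map_transposeMat_eq_some] at h
    have := pos c h
    rw [(peel_transposeMat A).1, (peel_transposeMat A).2, (peel_transposeMat B).1,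
      (peel_transposeMat B).2] at this
    exact this.symm

theorem Fits.mono {μ : YoungDiagram} {A B : Mat} (hA : Fits μ A)
    (h1 : ColLE (prec (biword' B)) (prec (biword' A)))
    (h2 : ColLE (pcol (biword' B)) (pcol (biword' A))) : Fits μ B := by
  refine ⟨fun k y hy => ?_, fun k y hy => ?_⟩
  · obtain ⟨z, hz, hyz⟩ := h1 k y hy
    exact μ.isLowerSet (show ((k + y, k) : ℕ × ℕ) ≤ (k + z, k) from ⟨by simpa, le_rfl⟩) (hA.1 k z hz)
  · obtain ⟨z, hz, hyz⟩ := h2 k y hy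
    exact μ.isLowerSet (show ((k, k + y) : ℕ × ℕ) ≤ (k, k + z) from ⟨le_rfl, by simpa⟩) (hA.2 k z hz)

theorem Fits.of_matE {μ : YoungDiagram} {i : ℤ} {A B : Mat} (hA : Fits μ A) (h : matE i A = some B) :
    Fits μ B :=
  hA.mono (colLE_of_matE h).1 (colLE_of_matE h).2

/-! ### Flagged bitableaux -/

theorem lt_diagLen {μ : YoungDiagram} {k : ℕ} : k < diagLen μ ↔ (k, k) ∈ μ := by
  have h : (μ.cells.filter fun p => p.1 = p.2) =
      (Finset.range (Nat.find (⟨μ.colLen 0, fun h => by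
        have := YoungDiagram.mem_iff_lt_colLen.1 (μ.isLowerSet
          (show ((μ.colLen 0, 0) : ℕ × ℕ) ≤ (μ.colLen 0, μ.colLen 0) from ⟨le_rfl, Nat.zero_le _⟩) h)
        omega⟩ : ∃ n, (n, n) ∉ μ))).image fun k => (k, k) := by
    ext ⟨i, j⟩
    simp only [Finset.mem_filter, YoungDiagram.mem_cells, Finset.mem_image, Finset.mem_range,
      Nat.lt_find_iff, not_not, Prod.mk.injEq]
    constructor
    · rintro ⟨h, rfl⟩
      exact ⟨i, fun m hm => μ.isLowerSet (show ((m, m) : ℕ × ℕ) ≤ (i, i) from ⟨hm, hm⟩) h, rfl, rfl⟩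
    · rintro ⟨m, h, rfl, rfl⟩
      exact ⟨h m le_rfl, rfl⟩
  rw [diagLen, h, Finset.card_image_of_injective _ fun a b h => (Prod.mk.inj h).1, Finset.card_range,
    Nat.lt_find_iff]
  simp only [not_not]
  exact ⟨fun h => h k le_rfl, fun h m hm =>
    μ.isLowerSet (show ((m, m) : ℕ × ℕ) ≤ (k, k) from ⟨hm, hm⟩) h⟩

theorem map_length_head {ν : YoungDiagram} {T : Tab} (hT : IsSST ν T) :
    (T.headD []).length = ν.colLen 0 := by
  have h1 := (isSST_iff.1 hT).2
  have h2 : ν.transpose.rowLens.headD 0 = ν.colLen 0 := by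
    rw [← YoungDiagram.rowLen_transpose]
    cases h : ν.transpose.rowLens with
    | nil =>
      have h3 := congrArg List.length h
      rw [YoungDiagram.length_rowLens, List.length_nil] at h3
      by_contra hne
      have h4 : ((0, 0) : ℕ × ℕ) ∈ ν.transpose := by
        rw [YoungDiagram.mem_iff_lt_rowLen]
        exact Nat.pos_of_ne_zero fun h => hne (by simpa using h.symm)
      rw [YoungDiagram.mem_iff_lt_colLen] at h4
      omega
    | cons a l =>
      have h3 : ν.transpose.rowLens[0]'(by rw [h]; simp) = a := by simp [h]
      rw [YoungDiagram.get_rowLens] at h3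
      simp [h3]
  rw [← h2, ← h1]
  cases T <;> simp

/-- In every row the first column has the largest entry, so the flag condition needs to be checked
only there; the two reversals of the flag cancel. -/
theorem mem_flaggedSST {ν : YoungDiagram} {d : ℕ} {α : Fin d → ℕ} (hν : ν.colLen 0 ≤ d) {T : Tab} :
    T ∈ flaggedSST ν (fun i => α i.rev) ↔ IsSST ν T ∧
      ∀ k y, (T.headD [])[k]? = some y → ∃ h : k < d, y < α ⟨k, h⟩ := by
  constructor
  · rintro ⟨h1, h2⟩
    refine ⟨h1, fun k y hy => ?_⟩
    have hk : k < d := by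
      have h3 := (List.getElem?_eq_some_iff.1 hy).1
      have := map_length_head h1
      omega
    refine ⟨hk, ?_⟩
    cases T with
    | nil => simp at hy
    | cons C T =>
      have := h2 ⟨k, hk⟩ C (by simp) y hy
      dsimp only at this
      rwa [Fin.rev_rev] at this
  · rintro ⟨h1, h2⟩
    refine ⟨h1, fun i C hC x hx => ?_⟩
    change x < α i.rev.rev
    rw [Fin.rev_rev]
    cases T with
    | nil => simp at hC
    | cons D T =>
      have h3 := (semistandard_cons.1 (isSST_iff.1 h1).1).2.2.1
      obtain ⟨y, hy, hxy⟩ : ∃ y, D[(i : ℕ)]? = some y ∧ x ≤ y := by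
        rcases List.mem_cons.1 hC with rfl | hC
        · exact ⟨x, hx, le_rfl⟩
        · exact h3 C hC i x hx
      have h4 := (h2 i y hy).choose_spec
      exact lt_of_le_of_lt hxy h4

theorem head_kappa (A : Mat) : (kappa A).1.headD [] = prec (biword' A) ∧
    (kappa A).2.headD [] = pcol (biword' A) := by
  rw [kappa_eq]
  by_cases h : biword' A = []
  · rw [h]; simp [prec, pcol, peel]
  · rw [recTab_of_ne_nil h, ins_of_ne_nil h]; simp

theorem lt_frobLower {μ : YoungDiagram} {k y : ℕ} :
    (∃ h : k < diagLen μ, y < frobLower μ ⟨k, h⟩) ↔ (k + y, k) ∈ μ := by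
  constructor
  · rintro ⟨h, hy⟩
    rw [YoungDiagram.mem_iff_lt_colLen]
    simp only [frobLower] at hy; omega
  · intro h
    refine ⟨lt_diagLen.2 (μ.isLowerSet
      (show ((k, k) : ℕ × ℕ) ≤ (k + y, k) from ⟨by simp, le_rfl⟩) h), ?_⟩
    rw [YoungDiagram.mem_iff_lt_colLen] at h
    simp only [frobLower]; omega

theorem lt_frobUpper {μ : YoungDiagram} {k y : ℕ} :
    (∃ h : k < diagLen μ, y < frobUpper μ ⟨k, h⟩) ↔ (k, k + y) ∈ μ := by
  constructor
  · rintro ⟨h, hy⟩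
    rw [YoungDiagram.mem_iff_lt_rowLen]
    simp only [frobUpper] at hy; omega
  · intro h
    refine ⟨lt_diagLen.2 (μ.isLowerSet
      (show ((k, k) : ℕ × ℕ) ≤ (k, k + y) from ⟨le_rfl, by simp⟩) h), ?_⟩
    rw [YoungDiagram.mem_iff_lt_rowLen] at h
    simp only [frobUpper]; omega

theorem kappa_mem_flaggedBitableaux {μ : YoungDiagram} {A : Mat} :
    kappa A ∈ flaggedBitableaux (fun i : Fin (diagLen μ) => frobLower μ i.rev)
      (fun i : Fin (diagLen μ) => frobUpper μ i.rev) ↔ Fits μ A := by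
  obtain ⟨hS, hT, hlen⟩ := kappa_semistandard A
  obtain ⟨hd1, hd2⟩ := head_kappa A
  simp only [flaggedBitableaux, Set.mem_iUnion, Set.mem_ofPred_eq, exists_prop, Set.mem_prod]
  constructor
  · rintro ⟨ν, hν, h1, h2⟩
    rw [mem_flaggedSST hν, hd1] at h1
    rw [mem_flaggedSST hν, hd2] at h2
    exact ⟨fun k y hy => lt_frobLower.1 (h1.2 k y hy), fun k y hy => lt_frobUpper.1 (h2.2 k y hy)⟩
  · rintro ⟨h1, h2⟩
    obtain ⟨ν, hν⟩ := hT.exists_isSST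
    have hν' : IsSST ν (kappa A).1 := isSST_iff.2 ⟨hS, hlen.trans (isSST_iff.1 hν).2⟩
    -- An entry at height `diagLen μ` of the first column would put a box on or to the right of the
    -- diagonal in that row of `μ`, although that row has no diagonal box.
    have hd : ν.colLen 0 ≤ diagLen μ := by
      rw [← map_length_head hν, hd2]
      by_contra hlt
      obtain ⟨h3, -⟩ := lt_frobUpper.2
        (h2 (diagLen μ) _ (List.getElem?_eq_getElem (by omega)))
      omega
    refine ⟨ν, hd, ?_, ?_⟩
    · rw [mem_flaggedSST hd, hd1]
      exact ⟨hν', fun k y hy => lt_frobLower.2 (h1 k y hy)⟩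
    · rw [mem_flaggedSST hd, hd2]
      exact ⟨hν, fun k y hy => lt_frobUpper.2 (h2 k y hy)⟩

theorem bijOn_kappa (w : Equiv.Perm NZ) :
    Set.BijOn kappa (boundedMats w) (flaggedBitableaux (phi w) (psi w)) := by
  refine ⟨fun A hA => kappa_mem_flaggedBitableaux.2 (mem_boundedMats.1 hA),
    kappa_injective.injOn, ?_⟩
  intro p hp
  have hp' := hp
  simp only [flaggedBitableaux, Set.mem_iUnion, Set.mem_ofPred_eq, exists_prop, Set.mem_prod] at hp'
  obtain ⟨ν, -, h1, h2⟩ := hp'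
  obtain ⟨h3, h4⟩ := isSST_iff.1 h1.1
  obtain ⟨h5, h6⟩ := isSST_iff.1 h2.1
  obtain ⟨A, hA⟩ := exists_kappa_eq h3 h5 (h4.trans h6.symm)
  refine ⟨A, mem_boundedMats.2 (kappa_mem_flaggedBitableaux.1 ?_), hA⟩
  rw [hA]
  exact hp

/-! ## The Weyl group as a group of permutations of `ℤ` -/

/-- The increasing bijection from the nonzero integers to `ℤ` sending `1` to `1`. -/
def nzEquiv : NZ ≃ ℤ where
  toFun n := if 0 < n.1 then n.1 else n.1 + 1
  invFun k := if h : 0 < k then ⟨k, by omega⟩ else ⟨k - 1, by omega⟩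
  left_inv n := by
    obtain ⟨n, hn⟩ := n
    apply Subtype.ext
    simp only
    split_ifs <;> simp only <;> omega
  right_inv k := by
    simp only
    split_ifs <;> simp only at * <;> omega

theorem nzEquiv_lt {a b : NZ} : nzEquiv a < nzEquiv b ↔ a < b := by
  obtain ⟨a, ha⟩ := a
  obtain ⟨b, hb⟩ := b
  rw [Subtype.mk_lt_mk]
  simp only [nzEquiv, Equiv.coe_fn_mk]
  split_ifs <;> omega

/-- The transport of a permutation of the nonzero integers to `ℤ`. -/
def zPerm : Equiv.Perm NZ ≃* Equiv.Perm ℤ := nzEquiv.permCongrHom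

theorem zPerm_apply (w : Equiv.Perm NZ) (x : ℤ) : zPerm w x = nzEquiv (w (nzEquiv.symm x)) := rfl

theorem zPerm_simpleRefl (i : ℤ) : zPerm (simpleRefl i) = Equiv.swap i (i + 1) := by
  have h : ∀ a b : NZ, zPerm (Equiv.swap a b) = Equiv.swap (nzEquiv a) (nzEquiv b) := by
    intro a b
    ext x
    rw [zPerm_apply, Equiv.swap_apply_def, Equiv.swap_apply_def]
    simp only [Equiv.symm_apply_eq]
    split_ifs <;> simp
  unfold simpleRefl
  split_ifs with h1 h2 <;> rw [h] <;> simp only [nzEquiv, Equiv.coe_fn_mk]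
  · rw [if_pos h1, if_pos (by omega)]
  · rw [if_neg (by omega), if_neg (by omega)]; congr 1; omega
  · obtain rfl : i = 0 := by omega
    simp

theorem zPerm_prod (l : List ℤ) : zPerm (l.map simpleRefl).prod =
    (l.map fun i => Equiv.swap i (i + 1)).prod := by
  rw [map_list_prod, List.map_map]
  congr 1
  exact List.map_congr_left fun i _ => zPerm_simpleRefl i

theorem lt_of_swap_succ_lt {i a b : ℤ} (hab : a < b)
    (h : Equiv.swap i (i + 1) b < Equiv.swap i (i + 1) a) : a = i ∧ b = i + 1 := by
  rw [Equiv.swap_apply_def, Equiv.swap_apply_def] at h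
  split_ifs at h <;> omega

/-- The exchange property. -/
theorem exists_shorter_word (l : List ℤ) {p q : ℤ} (hpq : p < q)
    (h : (l.map fun i => Equiv.swap i (i + 1)).prod q <
      (l.map fun i => Equiv.swap i (i + 1)).prod p) :
    ∃ l' : List ℤ, l'.length < l.length ∧ (l'.map fun i => Equiv.swap i (i + 1)).prod =
      (l.map fun i => Equiv.swap i (i + 1)).prod * Equiv.swap p q := by
  induction l with
  | nil => simp at h; omega
  | cons i l ih =>
    simp only [List.map_cons, List.prod_cons, Equiv.Perm.mul_apply] at h ⊢
    set t := (l.map fun i => Equiv.swap i (i + 1)).prod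
    rcases lt_trichotomy (t q) (t p) with h1 | h1 | h1
    · obtain ⟨l', h2, h3⟩ := ih h1
      exact ⟨i :: l', by simpa using h2, by simp [h3, mul_assoc]⟩
    · have := t.injective h1; omega
    -- The letter `i` is the one that creates the inversion, so `l` takes `p`, `q` to `i`, `i + 1`,
    -- and deleting `i` amounts to multiplying by the transposition of `p` and `q`.
    · obtain ⟨h2, h3⟩ := lt_of_swap_succ_lt h1 h
      refine ⟨l, by simp, ?_⟩
      rw [mul_assoc, Equiv.mul_swap_eq_swap_mul, h2, h3, ← mul_assoc, Equiv.swap_mul_self, one_mul]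

/-! ### Words and lengths in the Weyl group -/

theorem simpleRefl_mul_self (i : ℤ) : simpleRefl i * simpleRefl i = 1 := by
  apply zPerm.injective
  rw [map_mul, zPerm_simpleRefl, Equiv.swap_mul_self, map_one]

theorem simpleRefl_mem (i : ℤ) : simpleRefl i ∈ weylGroup := Subgroup.subset_closure ⟨i, rfl⟩

theorem prod_mem_weylGroup (l : List ℤ) : (l.map simpleRefl).prod ∈ weylGroup :=
  Subgroup.list_prod_mem _ fun x hx => by
    obtain ⟨i, -, rfl⟩ := List.mem_map.1 hx
    exact simpleRefl_mem i

theorem exists_word {w : Equiv.Perm NZ} (hw : w ∈ weylGroup) :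
    ∃ l : List ℤ, (l.map simpleRefl).prod = w := by
  induction hw using Subgroup.closure_induction with
  | mem x hx =>
    obtain ⟨i, rfl⟩ := hx
    exact ⟨[i], by simp⟩
  | one => exact ⟨[], rfl⟩
  | mul x y _ _ hx hy =>
    obtain ⟨l, rfl⟩ := hx
    obtain ⟨m, rfl⟩ := hy
    exact ⟨l ++ m, by simp⟩
  | inv x _ hx =>
    obtain ⟨l, rfl⟩ := hx
    refine ⟨l.reverse, ?_⟩
    rw [List.prod_inv_reverse, List.map_reverse, List.map_map]
    congr 2
    refine List.map_congr_left fun i _ => ?_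
    exact eq_inv_of_mul_eq_one_left (simpleRefl_mul_self i)

theorem exists_reducedExpr {w : Equiv.Perm NZ} (hw : w ∈ weylGroup) : ∃ l, IsReducedExpr l w := by
  obtain ⟨l, hl⟩ := exists_word hw
  obtain ⟨m, hm1, hm2⟩ := Nat.sInf_mem
    (s := {n | ∃ l : List ℤ, l.length = n ∧ (l.map simpleRefl).prod = w}) ⟨_, l, rfl, hl⟩
  exact ⟨m, hm2, hm1⟩

theorem weylLength_le {l : List ℤ} {w : Equiv.Perm NZ} (h : (l.map simpleRefl).prod = w) :
    weylLength w ≤ l.length := Nat.sInf_le ⟨l, rfl, h⟩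

theorem weylLength_mul_swap_lt {w : Equiv.Perm NZ} (hw : w ∈ weylGroup) {p q : ℤ} (hpq : p < q)
    (h : zPerm w q < zPerm w p) :
    weylLength (w * zPerm.symm (Equiv.swap p q)) < weylLength w := by
  obtain ⟨l, hl, hlen⟩ := exists_reducedExpr hw
  rw [← hl, zPerm_prod] at h
  obtain ⟨l', h1, h2⟩ := exists_shorter_word l hpq h
  refine lt_of_le_of_lt (weylLength_le (l := l') ?_) (h1.trans_le hlen.le)
  apply zPerm.injective
  rw [zPerm_prod, h2, ← zPerm_prod, hl, map_mul, MulEquiv.apply_symm_apply]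

theorem weylLength_lt_mul_swap {w : Equiv.Perm NZ} {p q : ℤ}
    (hw : w * zPerm.symm (Equiv.swap p q) ∈ weylGroup) (hpq : p < q)
    (h : zPerm w p < zPerm w q) :
    weylLength w < weylLength (w * zPerm.symm (Equiv.swap p q)) := by
  have := weylLength_mul_swap_lt hw hpq (by simpa using h)
  rwa [mul_assoc, ← map_mul, Equiv.swap_mul_self, map_one, mul_one] at this

theorem mem_minReps_iff {w : Equiv.Perm NZ} :
    w ∈ minReps ↔ w ∈ weylGroup ∧ ∀ i : ℤ, i ≠ 0 → zPerm w i < zPerm w (i + 1) := by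
  have hs : ∀ i, simpleRefl i = zPerm.symm (Equiv.swap i (i + 1)) := fun i => by
    rw [← zPerm_simpleRefl, MulEquiv.symm_apply_apply]
  refine and_congr_right fun hw => forall_congr' fun i => imp_congr_right fun _ => ?_
  constructor
  · intro h
    by_contra hlt
    have hne : zPerm w (i + 1) ≠ zPerm w i := fun h => by
      have := (zPerm w).injective h; omega
    have := weylLength_mul_swap_lt hw (lt_add_one i) (by omega)
    rw [← hs] at this
    omega
  · intro h
    rw [hs]
    refine weylLength_lt_mul_swap ?_ (lt_add_one i) h
    rw [← hs]
    exact mul_mem hw (simpleRefl_mem i)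

/-! ### Monotonicity and cells -/

/-- A permutation of `ℤ` which is increasing on the nonpositive and on the positive integers and
moves only finitely many integers. -/
structure Grassmannian (v : Equiv.Perm ℤ) : Prop where
  neg : ∀ {a b : ℤ}, a < b → b ≤ 0 → v a < v b
  pos : ∀ {a b : ℤ}, a < b → 0 < a → v a < v b
  bdd : ∃ N : ℤ, ∀ x, N < |x| → v x = x

theorem exists_bound {w : Equiv.Perm NZ} (hw : w ∈ weylGroup) :
    ∃ N : ℤ, ∀ x, N < |x| → zPerm w x = x := by
  obtain ⟨l, rfl⟩ := exists_word hw
  rw [zPerm_prod]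
  clear hw
  induction l with
  | nil => exact ⟨0, fun x _ => rfl⟩
  | cons i l ih =>
    obtain ⟨N, hN⟩ := ih
    refine ⟨max N (|i| + 1), fun x hx => ?_⟩
    rw [List.map_cons, List.prod_cons, Equiv.Perm.mul_apply, hN x (by omega)]
    have h2 : |i| + 1 < |x| := by omega
    refine Equiv.swap_apply_of_ne_of_ne ?_ ?_
    · rintro rfl; omega
    · rintro rfl
      have := abs_add_le i 1
      rw [abs_one] at this; omega

theorem lt_of_forall_lt_succ {f : ℤ → ℤ} {a b : ℤ} (hab : a < b)
    (h : ∀ i, a ≤ i → i < b → f i < f (i + 1)) : f a < f b := by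
  obtain ⟨n, rfl⟩ : ∃ n : ℕ, b = a + 1 + n := ⟨(b - a - 1).toNat, by omega⟩
  induction n with
  | zero => simpa using h a le_rfl (by omega)
  | succ n ih =>
    have h1 := ih (by omega) fun i h1 h2 => h i h1 (by push_cast; omega)
    have h2 := h (a + 1 + n) (by omega) (by push_cast; omega)
    push_cast
    rw [← add_assoc]
    exact h1.trans h2

theorem grassmannian_of_mem {w : Equiv.Perm NZ} (hw : w ∈ minReps) : Grassmannian (zPerm w) := by
  obtain ⟨h1, h2⟩ := mem_minReps_iff.1 hw
  exact ⟨fun hab hb => lt_of_forall_lt_succ hab fun i _ _ => h2 i (by omega),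
    fun hab hb => lt_of_forall_lt_succ hab fun i _ _ => h2 i (by omega), exists_bound h1⟩

theorem Grassmannian.exists_lt {v : Equiv.Perm ℤ} (hv : Grassmannian v) (y : ℤ) :
    ∃ m : ℕ, ∀ q : ℕ, v (q + 1) < y ↔ q < m := by
  have hex : ∃ m : ℕ, y ≤ v (m + 1) := by
    obtain ⟨N, hN⟩ := hv.bdd
    refine ⟨(|N| + |y|).toNat, ?_⟩
    have h1 := abs_nonneg N
    have h2 := abs_nonneg y
    have h3 := le_abs_self y
    have h4 := le_abs_self N
    rw [hN]
    · omega
    · rw [abs_of_nonneg (by omega)]; omega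
  refine ⟨Nat.find hex, fun q => ?_⟩
  rw [Nat.lt_find_iff]
  constructor
  · intro h m hm
    rcases hm.eq_or_lt with rfl | hm
    · omega
    · have := hv.pos (a := (m : ℤ) + 1) (b := (q : ℤ) + 1) (by omega) (by omega)
      omega
  · intro h
    have := h q le_rfl
    omega

/-- In the row of `-p` of the diagram the values come from positions to the right of `-p`.
Monotonicity on the nonpositive integers excludes nonpositive positions, and monotonicity on the
positive ones makes the admissible positions an initial segment. -/
theorem lt_shapePart {w : Equiv.Perm NZ} (hw : Grassmannian (zPerm w)) {p q : ℕ} :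
    q < shapePart w p ↔ zPerm w (q + 1) < zPerm w (-p) := by
  obtain ⟨m, hm⟩ := hw.exists_lt (zPerm w (-p))
  have hp : nzEquiv ⟨-((p : ℤ) + 1), by omega⟩ = -(p : ℤ) := by
    simp only [nzEquiv, Equiv.coe_fn_mk]
    rw [if_neg (by omega)]; ring
  have hset : {j : NZ | ((⟨-((p : ℤ) + 1), by omega⟩ : NZ), j) ∈ diagram w} =
      (fun q : ℕ => nzEquiv.symm (zPerm w (q + 1))) '' {q | q < m} := by
    ext j
    obtain ⟨x, rfl⟩ : ∃ x, j = w (nzEquiv.symm x) :=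
      ⟨nzEquiv (w.symm j), by simp⟩
    simp only [diagram, Set.mem_ofPred_eq, Equiv.symm_apply_apply, Set.mem_image]
    rw [← nzEquiv_lt, ← nzEquiv_lt, hp, Equiv.apply_symm_apply, ← zPerm_apply,
      ← Equiv.symm_apply_apply nzEquiv ⟨-((p : ℤ) + 1), by omega⟩, hp, ← zPerm_apply]
    constructor
    · rintro ⟨h1, h2⟩
      have hx : 0 < x := by
        by_contra hx
        have := hw.neg h1 (by omega)
        omega
      obtain ⟨q, rfl⟩ : ∃ q : ℕ, x = q + 1 := ⟨(x - 1).toNat, by omega⟩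
      exact ⟨q, (hm q).1 h2, by rw [zPerm_apply, Equiv.symm_apply_apply]⟩
    · rintro ⟨q, hq, h⟩
      rw [zPerm_apply, Equiv.symm_apply_apply] at h
      have := nzEquiv.symm.injective (w.injective h)
      subst this
      exact ⟨by omega, (hm q).2 hq⟩
  rw [hm, shapePart, hset, Set.ncard_image_of_injective]
  · have : {q | q < m} = (↑(Finset.range m) : Set ℕ) := by ext; simp
    rw [this, Set.ncard_coe_finset, Finset.card_range]
  · intro a b hab
    have := (zPerm w).injective (nzEquiv.symm.injective hab)
    omega

/-- Boxes of the partition are the inversions between a nonpositive and a positive position;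
monotonicity on both halves makes this a finite lower set, so the default value in the definition
does not occur. -/
theorem mem_shape {w : Equiv.Perm NZ} (hw : Grassmannian (zPerm w)) {p q : ℕ} :
    (p, q) ∈ shape w ↔ zPerm w (q + 1) < zPerm w (-p) := by
  have hset : {p : ℕ × ℕ | p.2 < shapePart w p.1} =
      {p : ℕ × ℕ | zPerm w (p.2 + 1) < zPerm w (-p.1)} := by
    ext ⟨p, q⟩
    exact lt_shapePart hw
  have hlow : IsLowerSet {p : ℕ × ℕ | p.2 < shapePart w p.1} := by
    rw [hset]
    rintro ⟨a, b⟩ ⟨a', b'⟩ ⟨ha, hb⟩ h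
    simp only [Set.mem_ofPred_eq] at h ha hb ⊢
    have h1 : zPerm w (-a) ≤ zPerm w (-a') := by
      rcases ha.eq_or_lt with rfl | ha
      · exact le_rfl
      · exact (hw.neg (by omega) (by omega)).le
    have h2 : zPerm w (b' + 1) ≤ zPerm w (b + 1) := by
      rcases hb.eq_or_lt with rfl | hb
      · exact le_rfl
      · exact (hw.pos (by omega) (by omega)).le
    omega
  have hfin : {p : ℕ × ℕ | p.2 < shapePart w p.1}.Finite := by
    obtain ⟨N, hN⟩ := hw.bdd
    refine ((Finset.range (shapePart w 0) ×ˢ Finset.range (|N|.toNat + 1)).finite_toSet.image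
      Prod.swap).subset ?_
    rintro ⟨a, b⟩ h
    refine ⟨(b, a), ?_, rfl⟩
    have h0 := hlow (show ((0, b) : ℕ × ℕ) ≤ (a, b) from ⟨Nat.zero_le _, le_rfl⟩) h
    have h1 := hlow (show ((a, 0) : ℕ × ℕ) ≤ (a, b) from ⟨le_rfl, Nat.zero_le _⟩) h
    rw [hset] at h1
    simp only [Set.mem_ofPred_eq, Finset.coe_product, Finset.coe_range, Set.mem_prod,
      Set.mem_Iio] at h0 h1 ⊢
    refine ⟨h0, ?_⟩
    by_contra ha
    have h2 := abs_nonneg N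
    have h3 := le_abs_self N
    -- In a far row `-a` is fixed, so a box would force the value at position `1` to lie below `-a`.
    -- That value is then itself a fixed point, and injectivity makes it equal to `1`.
    rw [hN (-a) (by rw [abs_neg, Nat.abs_cast]; omega)] at h1
    have h4 := hN (zPerm w (((0 : ℕ) : ℤ) + 1)) (by rw [abs_of_neg] <;> omega)
    have h5 := (zPerm w).injective h4
    push_cast at h5 h1
    omega
  have hmem : (p, q) ∈ shape w ↔ (p, q) ∈ {p : ℕ × ℕ | p.2 < shapePart w p.1} := by
    rw [shape, dif_pos ⟨hfin, hlow⟩, ← YoungDiagram.mem_cells, Set.Finite.mem_toFinset]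
  rw [hmem, hset]
  rfl

theorem simpleRefl_mul_eq {w : Equiv.Perm NZ} {i a b : ℤ} (ha : zPerm w a = i + 1)
    (hb : zPerm w b = i) : simpleRefl i * w = w * zPerm.symm (Equiv.swap a b) := by
  apply zPerm.injective
  rw [map_mul, map_mul, zPerm_simpleRefl, MulEquiv.apply_symm_apply, Equiv.mul_swap_eq_swap_mul,
    ha, hb, Equiv.swap_comm]

theorem zPerm_simpleRefl_mul (i : ℤ) (w : Equiv.Perm NZ) (x : ℤ) :
    zPerm (simpleRefl i * w) x = Equiv.swap i (i + 1) (zPerm w x) := by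
  rw [map_mul, zPerm_simpleRefl]; rfl

/-- Removal of the box with the consecutive values `i` and `i + 1`. -/
theorem remove_box {w : Equiv.Perm NZ} (hw : w ∈ minReps) {i : ℤ} {p q : ℕ}
    (hp : zPerm w (-p) = i + 1) (hq : zPerm w (q + 1) = i) :
    simpleRefl i * w ∈ minReps ∧ weylLength (simpleRefl i * w) < weylLength w ∧
      (p, q) ∈ shape w ∧
      (∀ b, b ∈ shape (simpleRefl i * w) ↔ b ∈ shape w ∧ b ≠ (p, q)) ∧ (q : ℤ) - p = i := by
  have hw1 := (mem_minReps_iff.1 hw).1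
  have hG := grassmannian_of_mem hw
  have hmem : simpleRefl i * w ∈ minReps := by
    refine mem_minReps_iff.2 ⟨mul_mem (simpleRefl_mem i) hw1, fun j hj => ?_⟩
    rw [zPerm_simpleRefl_mul, zPerm_simpleRefl_mul]
    have h1 := (mem_minReps_iff.1 hw).2 j hj
    by_contra hlt
    have hne : Equiv.swap i (i + 1) (zPerm w (j + 1)) ≠ Equiv.swap i (i + 1) (zPerm w j) :=
      fun h => by
        have := (zPerm w).injective ((Equiv.swap i (i + 1)).injective h); omega
    obtain ⟨h2, h3⟩ := lt_of_swap_succ_lt (i := i) h1 (by omega)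
    have h4 := (zPerm w).injective (h2.trans hq.symm)
    have h5 := (zPerm w).injective (h3.trans hp.symm)
    omega
  refine ⟨hmem, ?_, ?_, ?_, ?_⟩
  · rw [simpleRefl_mul_eq hp hq]
    exact weylLength_mul_swap_lt hw1 (by omega) (by omega)
  · rw [mem_shape hG]; omega
  · rintro ⟨a, b⟩
    rw [mem_shape (grassmannian_of_mem hmem), mem_shape hG, zPerm_simpleRefl_mul,
      zPerm_simpleRefl_mul]
    have ha : zPerm w (-a) = i + 1 ↔ a = p := by
      rw [← hp, (zPerm w).injective.eq_iff]; omega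
    have hb : zPerm w (b + 1) = i ↔ b = q := by
      rw [← hq, (zPerm w).injective.eq_iff]; omega
    have ha' : zPerm w (-a) ≠ i := by
      rw [← hq]; intro h; have := (zPerm w).injective h; omega
    have hb' : zPerm w (b + 1) ≠ i + 1 := by
      rw [← hp]; intro h; have := (zPerm w).injective h; omega
    have hne : (a, b) ≠ (p, q) ↔ ¬ (zPerm w (-a) = i + 1 ∧ zPerm w (b + 1) = i) := by
      rw [ha, hb, Ne, Prod.mk.injEq]
    rw [hne, Equiv.swap_apply_def, Equiv.swap_apply_def, if_neg ha', if_neg hb']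
    split_ifs <;> omega
  · obtain ⟨N', hN'⟩ := hG.bdd
    obtain ⟨N, hN0, hN1, hN2, hN3, hN4, hN⟩ : ∃ N : ℤ, (p : ℤ) < N ∧ (q : ℤ) + 1 < N ∧ i + 1 < N ∧
        -N < i ∧ 0 < N ∧ ∀ x, N < |x| → zPerm w x = x := by
      refine ⟨|N'| + p + q + |i| + 2, ?_, ?_, ?_, ?_, ?_, fun x hx => hN' x ?_⟩ <;>
      · have h1 := abs_nonneg N'
        have h2 := le_abs_self N'
        have h3 := abs_nonneg i
        have h4 := le_abs_self i
        have h5 := neg_abs_le i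
        omega
    -- The content is found by counting: the values `i + 1, …, N` are taken exactly at the positions
    -- `-p, …, 0` and `q + 2, …, N`, whence `q - p = i`.
    have himg : (Finset.Icc (-(p : ℤ)) 0 ∪ Finset.Icc ((q : ℤ) + 2) N).image (zPerm w) =
        Finset.Icc (i + 1) N := by
      ext y
      simp only [Finset.mem_image, Finset.mem_union, Finset.mem_Icc]
      have hbd : ∀ x, |x| ≤ N ↔ |zPerm w x| ≤ N := by
        intro x
        constructor
        · intro h
          by_contra hlt
          have := (zPerm w).injective (hN _ (not_le.1 hlt))
          rw [this] at hlt
          exact hlt h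
        · intro h
          by_contra hlt
          rw [hN x (not_le.1 hlt)] at h
          exact hlt h
      simp only [abs_le] at hbd
      constructor
      · rintro ⟨x, hx, rfl⟩
        have h1 := (hbd x).1 (by omega)
        refine ⟨?_, h1.2⟩
        rcases hx with hx | hx
        · rcases hx.1.eq_or_lt with rfl | h
          · omega
          · have := hG.neg h hx.2; omega
        · have h2 := hG.pos (a := (q : ℤ) + 1) (b := x) (by omega) (by omega)
          omega
      · rintro ⟨h1, h2⟩
        obtain ⟨x, rfl⟩ := (zPerm w).surjective y
        have h3 := (hbd x).2 (by omega)
        refine ⟨x, ?_, rfl⟩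
        rcases le_or_gt x 0 with hx | hx
        · left
          refine ⟨?_, hx⟩
          by_contra hlt
          have := hG.neg (a := x) (b := -p) (by omega) (by omega)
          omega
        · right
          refine ⟨?_, h3.2⟩
          by_contra hlt
          rcases (show x ≤ (q : ℤ) + 1 by omega).eq_or_lt with rfl | h
          · omega
          · have := hG.pos h hx; omega
    have hcard := congrArg Finset.card himg
    rw [Finset.card_image_of_injective _ (zPerm w).injective, Finset.card_union_of_disjoint,
      Int.card_Icc, Int.card_Icc, Int.card_Icc] at hcard
    · omega
    · rw [Finset.disjoint_left]
      intro x hx hx'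
      rw [Finset.mem_Icc] at hx hx'
      omega

/-- The first letter of a reduced expression removes a box. -/
theorem exists_box_of_reduced {w : Equiv.Perm NZ} (hw : w ∈ minReps) {i : ℤ} {l : List ℤ}
    (h : IsReducedExpr (i :: l) w) :
    IsReducedExpr l (simpleRefl i * w) ∧
      ∃ p q : ℕ, zPerm w (-p) = i + 1 ∧ zPerm w (q + 1) = i := by
  obtain ⟨h1, h2⟩ := h
  have hl : (l.map simpleRefl).prod = simpleRefl i * w := by
    rw [← h1, List.map_cons, List.prod_cons, ← mul_assoc, simpleRefl_mul_self, one_mul]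
  have hmem : simpleRefl i * w ∈ weylGroup := hl ▸ prod_mem_weylGroup l
  have hle := weylLength_le hl
  have hle' : weylLength w ≤ weylLength (simpleRefl i * w) + 1 := by
    obtain ⟨m, hm1, hm2⟩ := exists_reducedExpr hmem
    rw [← hm2]
    refine weylLength_le (l := i :: m) ?_
    rw [List.map_cons, List.prod_cons, hm1, ← mul_assoc, simpleRefl_mul_self, one_mul]
  rw [List.length_cons] at h2
  refine ⟨⟨hl, by omega⟩, ?_⟩
  obtain ⟨a, ha⟩ := (zPerm w).surjective (i + 1)
  obtain ⟨b, hb⟩ := (zPerm w).surjective i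
  -- If the value `i` stood to the left of `i + 1`, exchanging the two would lengthen `w`.
  -- Monotonicity on the two halves then places `i + 1` at a nonpositive and `i` at a positive
  -- position.
  have hab : a < b := by
    by_contra hab
    have hne : a ≠ b := by rintro rfl; omega
    have := weylLength_lt_mul_swap (w := w) (p := b) (q := a)
      (by rwa [Equiv.swap_comm, ← simpleRefl_mul_eq ha hb]) (by omega) (by omega)
    rw [Equiv.swap_comm, ← simpleRefl_mul_eq ha hb] at this
    omega
  have hG := grassmannian_of_mem hw
  have ha0 : a ≤ 0 := by
    by_contra h
    have := hG.pos hab (by omega); omega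
  have hb0 : 0 < b := by
    by_contra h
    have := hG.neg hab (by omega); omega
  refine ⟨(-a).toNat, (b - 1).toNat, ?_, ?_⟩
  · rw [← ha]; congr 1; omega
  · rw [← hb]; congr 1; omega

/-! ### The Bruhat order -/

/-- The numbers of large values at nonpositive positions and of small values at positive positions
can only grow upwards in the Bruhat order; on `minReps` they determine the partition. -/
theorem bruhat_encard_le {u v : Equiv.Perm NZ} (hu : u ∈ weylGroup) (h : BruhatLE u v) (b : ℤ) :
    v ∈ weylGroup ∧ {x : ℤ | x ≤ 0 ∧ b ≤ zPerm u x}.encard ≤ {x : ℤ | x ≤ 0 ∧ b ≤ zPerm v x}.encard ∧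
      {x : ℤ | 0 < x ∧ zPerm u x < b}.encard ≤ {x : ℤ | 0 < x ∧ zPerm v x < b}.encard := by
  induction h with
  | refl => exact ⟨hu, le_rfl, le_rfl⟩
  | @tail v v' _ hstep ih =>
    obtain ⟨hv, ih1, ih2⟩ := ih
    obtain ⟨g, hg, i, hv', hlen⟩ := hstep
    have hmem : v' ∈ weylGroup := by
      rw [hv']
      exact mul_mem hv (mul_mem (mul_mem hg (simpleRefl_mem i)) (inv_mem hg))
    obtain ⟨p, q, hpq, ht⟩ : ∃ p q : ℤ, p < q ∧ g * simpleRefl i * g⁻¹ =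
        zPerm.symm (Equiv.swap p q) := by
      have key : g * simpleRefl i * g⁻¹ =
          zPerm.symm (Equiv.swap (zPerm g i) (zPerm g (i + 1))) := by
        apply zPerm.injective
        rw [map_mul, map_mul, zPerm_simpleRefl, MulEquiv.apply_symm_apply,
          Equiv.mul_swap_eq_swap_mul, mul_assoc, ← map_mul, mul_inv_cancel, map_one, mul_one]
      rcases lt_trichotomy (zPerm g i) (zPerm g (i + 1)) with h | h | h
      · exact ⟨_, _, h, key⟩
      · have := (zPerm g).injective h; omega
      · exact ⟨_, _, h, by rw [key, Equiv.swap_comm]⟩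
    rw [ht] at hv'
    have hlt : zPerm v p < zPerm v q := by
      by_contra hlt
      have hne : zPerm v q ≠ zPerm v p := fun h => by
        have := (zPerm v).injective h; omega
      have := weylLength_mul_swap_lt hv hpq (by omega)
      rw [← hv'] at this
      omega
    have hz : ∀ x, zPerm v' x = zPerm v (Equiv.swap p q x) := fun x => by
      rw [hv', map_mul, MulEquiv.apply_symm_apply]; rfl
    refine ⟨hmem, ih1.trans ?_, ih2.trans ?_⟩
    -- A lengthening transposition across the two halves moves the larger value to the nonpositive
    -- side. Within one half it merely permutes the positions counted.
    · by_cases hside : p ≤ 0 ∧ 0 < q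
      · refine Set.encard_le_encard fun x hx => ⟨hx.1, ?_⟩
        rw [hz, Equiv.swap_apply_def]
        have := hx.2
        split_ifs with h1 h2
        · subst h1; omega
        · have := hx.1; omega
        · exact this
      · rw [← (Equiv.swap p q).injective.encard_image]
        refine Set.encard_le_encard ?_
        rintro _ ⟨x, ⟨hx1, hx2⟩, rfl⟩
        refine ⟨?_, by rwa [hz, Equiv.swap_apply_self]⟩
        rw [Equiv.swap_apply_def]
        split_ifs <;> omega
    · by_cases hside : p ≤ 0 ∧ 0 < q
      · refine Set.encard_le_encard fun x hx => ⟨hx.1, ?_⟩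
        rw [hz, Equiv.swap_apply_def]
        have := hx.2
        split_ifs with h1 h2
        · have := hx.1; omega
        · subst h2; omega
        · exact this
      · rw [← (Equiv.swap p q).injective.encard_image]
        refine Set.encard_le_encard ?_
        rintro _ ⟨x, ⟨hx1, hx2⟩, rfl⟩
        refine ⟨?_, by rwa [hz, Equiv.swap_apply_self]⟩
        rw [Equiv.swap_apply_def]
        split_ifs <;> omega

theorem Grassmannian.encard_neg {v : Equiv.Perm ℤ} (hv : Grassmannian v) (p : ℕ) (b : ℤ) :
    ((p + 1 : ℕ) : ℕ∞) ≤ {x : ℤ | x ≤ 0 ∧ b ≤ v x}.encard ↔ b ≤ v (-p) := by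
  constructor
  · intro h
    by_contra hlt
    have hsub : {x : ℤ | x ≤ 0 ∧ b ≤ v x} ⊆ (Finset.Ioc (-(p : ℤ)) 0 : Set ℤ) := by
      rintro x ⟨hx1, hx2⟩
      rw [Finset.coe_Ioc]
      refine ⟨?_, hx1⟩
      by_contra hx
      rcases (not_lt.1 hx).eq_or_lt with rfl | hx
      · omega
      · have := hv.neg hx (by omega); omega
    have := h.trans (Set.encard_le_encard hsub)
    rw [Set.encard_coe_eq_coe_finsetCard, Nat.cast_le, Int.card_Ioc] at this
    omega
  · intro h
    have hsub : (Finset.Icc (-(p : ℤ)) 0 : Set ℤ) ⊆ {x : ℤ | x ≤ 0 ∧ b ≤ v x} := by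
      rintro x hx
      rw [Finset.coe_Icc] at hx
      refine ⟨hx.2, ?_⟩
      rcases hx.1.eq_or_lt with rfl | h1
      · exact h
      · have := hv.neg h1 hx.2; omega
    refine le_trans ?_ (Set.encard_le_encard hsub)
    rw [Set.encard_coe_eq_coe_finsetCard, Nat.cast_le, Int.card_Icc]
    omega

theorem Grassmannian.encard_pos {v : Equiv.Perm ℤ} (hv : Grassmannian v) (q : ℕ) (b : ℤ) :
    ((q + 1 : ℕ) : ℕ∞) ≤ {x : ℤ | 0 < x ∧ v x < b}.encard ↔ v (q + 1) < b := by
  constructor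
  · intro h
    by_contra hlt
    have hsub : {x : ℤ | 0 < x ∧ v x < b} ⊆ (Finset.Ioo 0 ((q : ℤ) + 1) : Set ℤ) := by
      rintro x ⟨hx1, hx2⟩
      rw [Finset.coe_Ioo]
      refine ⟨hx1, ?_⟩
      by_contra hx
      rcases (not_lt.1 hx).eq_or_lt with rfl | hx
      · omega
      · have := hv.pos hx (by omega); omega
    have := h.trans (Set.encard_le_encard hsub)
    rw [Set.encard_coe_eq_coe_finsetCard, Nat.cast_le, Int.card_Ioo] at this
    omega
  · intro h
    have hsub : (Finset.Icc 1 ((q : ℤ) + 1) : Set ℤ) ⊆ {x : ℤ | 0 < x ∧ v x < b} := by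
      rintro x hx
      rw [Finset.coe_Icc] at hx
      refine ⟨hx.1, ?_⟩
      rcases hx.2.eq_or_lt with rfl | h1
      · exact h
      · have := hv.pos h1 hx.1; omega
    refine le_trans ?_ (Set.encard_le_encard hsub)
    rw [Set.encard_coe_eq_coe_finsetCard, Nat.cast_le, Int.card_Icc]
    omega

/-- The threshold `zPerm u (-p)` separates both sides: it is reached by `w` at `-p`, and stays above
the value of `w` at `q + 1`, so the inversion of `u` persists in `w`. -/
theorem shape_le_of_bruhatLE {u w : Equiv.Perm NZ} (hu : u ∈ minReps) (hw : w ∈ minReps)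
    (h : BruhatLE u w) : shape u ≤ shape w := by
  rintro ⟨p, q⟩ hpq
  have hGu := grassmannian_of_mem hu
  have hGw := grassmannian_of_mem hw
  have h1 := (mem_shape hGu).1 hpq
  obtain ⟨-, h2, h3⟩ := bruhat_encard_le hu.1 h (zPerm u (-p))
  have h4 := (hGw.encard_neg p _).1 (((hGu.encard_neg p _).2 le_rfl).trans h2)
  have h5 := (hGw.encard_pos q _).1 (((hGu.encard_pos q _).2 h1).trans h3)
  exact (mem_shape hGw).2 (by omega)

/-- The outer corners of `λ(w)` have consecutive values. -/
theorem exists_values_of_corner {w : Equiv.Perm NZ} (hw : w ∈ minReps) {p q : ℕ}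
    (h : (p, q) ∈ shape w) (h1 : (p + 1, q) ∉ shape w) (h2 : (p, q + 1) ∉ shape w) :
    ∃ i, zPerm w (-p) = i + 1 ∧ zPerm w (q + 1) = i := by
  have hG := grassmannian_of_mem hw
  rw [mem_shape hG] at h h1 h2
  push_cast at h1 h2
  refine ⟨_, ?_, rfl⟩
  by_contra hne
  obtain ⟨x, hx⟩ := (zPerm w).surjective (zPerm w (q + 1) + 1)
  -- The value next above the one at `q + 1` can only sit at `-p`: any other position contradicts
  -- monotonicity, the box `(p, q)`, or one of the two missing neighbours.
  rcases le_or_gt x 0 with h0 | h0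
  · have h3 : -(p : ℤ) - 1 < x := by
      by_contra h3
      rcases (not_lt.1 h3).eq_or_lt with rfl | h3
      · have := h1; rw [show -((p : ℤ) + 1) = -p - 1 by ring] at this; omega
      · have := hG.neg h3 (by omega)
        rw [show -((p : ℤ) + 1) = -p - 1 by ring] at h1; omega
    rcases (show -(p : ℤ) ≤ x by omega).eq_or_lt with rfl | h4
    · omega
    · have := hG.neg h4 h0; omega
  · rcases lt_trichotomy x ((q : ℤ) + 1) with h3 | h3 | h3
    · have := hG.pos h3 h0; omega
    · subst h3; omega
    · rcases (show (q : ℤ) + 1 + 1 ≤ x by omega).eq_or_lt with rfl | h4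
      · omega
      · have := hG.pos h4 (by omega); omega

/-- Boxes of the larger partition outside `μ` are removed one at a time as corners. Left
multiplication by `s_i` is right multiplication by a conjugate of it, so each removal is a step down
in the Bruhat order. -/
theorem exists_bruhatLE {w : Equiv.Perm NZ} (hw : w ∈ minReps) {μ : YoungDiagram}
    (hμ : μ ≤ shape w) : ∃ u ∈ minReps, shape u = μ ∧ BruhatLE u w := by
  induction hn : (shape w).cells.card using Nat.strong_induction_on generalizing w with
  | _ n ih =>
    by_cases heq : μ = shape w
    · exact ⟨w, hw, heq.symm, Relation.ReflTransGen.refl⟩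
    obtain ⟨x, hx⟩ : ((shape w).cells \ μ.cells).Nonempty := by
      rw [Finset.nonempty_iff_ne_empty, Ne, Finset.sdiff_eq_empty_iff_subset]
      exact fun h => heq (le_antisymm hμ h)
    -- A box outside `μ` with maximal coordinate sum is a corner of the larger partition, since
    -- boxes beyond it would also lie outside `μ`.
    obtain ⟨⟨p, q⟩, hpq, hmax⟩ := ((shape w).cells \ μ.cells).exists_max_image
      (fun b => b.1 + b.2) ⟨x, hx⟩
    simp only [Finset.mem_sdiff, YoungDiagram.mem_cells] at hpq hmax
    have hout : ∀ b : ℕ × ℕ, (p, q) ≤ b → p + q < b.1 + b.2 → b ∉ shape w := by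
      intro b hb hlt hbw
      have := hmax b ⟨hbw, fun hbμ => hpq.2 (μ.isLowerSet hb hbμ)⟩
      omega
    obtain ⟨i, h1, h2⟩ := exists_values_of_corner hw hpq.1
      (hout _ ⟨by simp, le_rfl⟩ (by simp)) (hout _ ⟨le_rfl, by simp⟩ (by simp))
    obtain ⟨r1, r2, r3, r4, -⟩ := remove_box hw h1 h2
    have hcells : (shape (simpleRefl i * w)).cells = (shape w).cells.erase (p, q) := by
      ext b
      rw [YoungDiagram.mem_cells, r4, Finset.mem_erase, YoungDiagram.mem_cells, and_comm]
    obtain ⟨u, hu1, hu2, hu3⟩ := ih (shape (simpleRefl i * w)).cells.card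
      (by rw [hcells, ← hn]; exact Finset.card_erase_lt_of_mem r3) r1 (by
        intro b hb
        refine (r4 b).2 ⟨hμ hb, ?_⟩
        rintro rfl
        exact hpq.2 hb) rfl
    refine ⟨u, hu1, hu2, hu3.tail ⟨(simpleRefl i * w)⁻¹, inv_mem r1.1, i, ?_, r2⟩⟩
    rw [inv_inv, mul_assoc _⁻¹, mul_inv_cancel_left, ← mul_assoc, simpleRefl_mul_self, one_mul]

theorem mem_dominatedSupports {w : Equiv.Perm NZ} (hw : w ∈ minReps) {S : Finset (ℕ × ℕ)} :
    S ∈ dominatedSupports w ↔ suppShape S ≤ shape w := by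
  constructor
  · rintro ⟨u, hu, hS, h⟩
    rw [← hS]
    exact shape_le_of_bruhatLE hu hw h
  · exact fun h => exists_bruhatLE hw h

/-! ## The matrices generated by a reduced expression -/

/-- The diagram `μ'` arises from `μ` by removal of the box `(p, q)`. -/
structure RemovesBox (μ μ' : YoungDiagram) (p q : ℕ) : Prop where
  mem : (p, q) ∈ μ
  mem_iff : ∀ b, b ∈ μ' ↔ b ∈ μ ∧ b ≠ (p, q)

theorem RemovesBox.not_mem {μ μ' : YoungDiagram} {p q : ℕ} (h : RemovesBox μ μ' p q) {b : ℕ × ℕ}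
    (hb : (p, q) ≤ b) (hne : b ≠ (p, q)) : b ∉ μ := fun hbμ =>
  ((h.mem_iff _).1 (μ'.isLowerSet hb ((h.mem_iff b).2 ⟨hbμ, hne⟩))).2 rfl

theorem RemovesBox.transpose {μ μ' : YoungDiagram} {p q : ℕ} (h : RemovesBox μ μ' p q) :
    RemovesBox μ.transpose μ'.transpose q p := by
  refine ⟨YoungDiagram.mem_transpose.2 h.mem, fun b => ?_⟩
  rw [YoungDiagram.mem_transpose, YoungDiagram.mem_transpose, h.mem_iff]
  refine and_congr_right fun _ => not_congr ?_
  rw [Prod.ext_iff, Prod.ext_iff]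
  exact and_comm

theorem fits_transpose {μ : YoungDiagram} {A : Mat} :
    Fits μ.transpose (transposeMat A) ↔ Fits μ A := by
  unfold Fits
  rw [(peel_transposeMat A).1, (peel_transposeMat A).2]
  simp only [YoungDiagram.mem_transpose, Prod.swap_prod_mk]
  exact and_comm

/-- At most one entry of a first column changes, from `c` to `c + 1` at some height `k`. For `k ≤ p`
the box now required lies weakly north-west of the corner. For `k > p` the box required before would
already lie beyond the corner. -/
theorem Fits.matF_pos {μ μ' : YoungDiagram} {p c : ℕ} (h : RemovesBox μ μ' p (p + (c + 1)))
    {A B : Mat} (hA : Fits μ A) (hB : matF (Int.ofNat (c + 1)) A = some B) : Fits μ B := by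
  obtain ⟨h1, ⟨h2, -, -⟩ | ⟨h2, -, -⟩⟩ := (matF_ofNat_succ.1 hB).peel
  · refine ⟨fun k y hy => hA.1 k y (by rwa [h1]), fun k y hy => ?_⟩
    obtain ⟨u, v, h3, h4, -, -⟩ := wordE_eq_some.1 h2
    rw [List.reverse_eq_iff] at h3 h4
    simp only [List.reverse_append, List.reverse_cons, List.append_assoc, List.singleton_append]
      at h3 h4
    have hk := hA.2 k
    rw [h4] at hk
    rw [h3] at hy
    rw [List.getElem?_append] at hy hk
    split_ifs at hy hk with hi
    · exact hk y hy
    · cases hj : k - v.reverse.length with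
      | zero =>
        rw [hj] at hy hk
        simp only [List.getElem?_cons_zero, Option.some.injEq] at hy hk
        have hk := hk c rfl
        subst hy
        rcases le_or_gt k p with hkp | hkp
        · exact μ.isLowerSet (show ((k, k + (c + 1)) : ℕ × ℕ) ≤ (p, p + (c + 1)) from
            ⟨hkp, by simp; omega⟩) h.mem
        · exact absurd hk (h.not_mem ⟨by simp; omega, by simp; omega⟩ (by simp; omega))
      | succ j =>
        rw [hj] at hy hk
        exact hk y (by simpa using hy)
  · exact ⟨fun k y hy => hA.1 k y (by rwa [h1]), fun k y hy => hA.2 k y (by rwa [h2])⟩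

/-- The removed box is needed only for an entry `c + 1` at height `p`. If the word cannot be raised,
the column has `c` above it as well, and that entry would need a box of `μ` beyond the corner. -/
theorem Fits.of_matE_pos_eq_none {μ μ' : YoungDiagram} {p c : ℕ}
    (h : RemovesBox μ μ' p (p + (c + 1))) {A : Mat} (hA : Fits μ A)
    (hn : matE (Int.ofNat (c + 1)) A = none) : Fits μ' A := by
  refine ⟨fun k y hy => (h.mem_iff _).2 ⟨hA.1 k y hy, ?_⟩,
    fun k y hy => (h.mem_iff _).2 ⟨hA.2 k y hy, ?_⟩⟩
  · simp only [Ne, Prod.mk.injEq]; omega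
  · simp only [Ne, Prod.mk.injEq]
    rintro ⟨rfl, h1⟩
    obtain rfl : y = c + 1 := by omega
    rw [matE_ofNat_succ_eq_none] at hn
    have h2 := (wordEps_wt_peel c (biword' A)).1
    rw [hn, wordEps_append] at h2
    have h3 : c ∈ pcol (biword' A) := by
      by_contra hc
      have := one_le_wordEps_reverse (pcol_pairwise _) (List.mem_of_getElem? hy) hc
      omega
    obtain ⟨k', hk'⟩ := List.getElem?_of_mem h3
    have hlt : k < k' := by
      by_contra hlt
      rcases (not_lt.1 hlt).eq_or_lt with rfl | hlt
      · rw [hk'] at hy; simp at hy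
      · obtain ⟨g1, g2⟩ := List.getElem?_eq_some_iff.1 hk'
        obtain ⟨g3, g4⟩ := List.getElem?_eq_some_iff.1 hy
        have := List.pairwise_iff_getElem.1 (pcol_pairwise (biword' A)) k' k g1 g3 hlt
        omega
    exact h.not_mem (b := (k', k' + c)) ⟨by simp; omega, by simp; omega⟩ (by simp; omega)
      (hA.2 k' c hk')

/-- By `peel_erase_zero` the only possible change is a new zero on top of both first columns, which
needs a diagonal box. It sits at height at most `p`: otherwise the corner at `(p, p)` would force a
zero already at height `p`, contradicting strictness. -/
theorem Fits.matF_zero {μ μ' : YoungDiagram} {p : ℕ} (h : RemovesBox μ μ' p p) {A B : Mat}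
    (hA : Fits μ A) (hB : matF 0 A = some B) : Fits μ B := by
  have hE := matE_eq_some_iff_matF.2 hB
  change (if B (0, 0) = 0 then none else some (B - Finsupp.single (0, 0) 1)) = some A at hE
  split_ifs at hE with h0
  have hE := Option.some.inj hE
  have hm : (0, 0) ∈ biword' B := List.count_pos_iff.1 (by rw [count_biword']; omega)
  have hAB : biword' A = (biword' B).erase (0, 0) := by rw [← hE, biword'_sub_single]
  unfold Fits at hA ⊢
  rw [hAB] at hA
  rcases peel_erase_zero (biword'_sorted B) hm with ⟨h1, h2, -, -⟩ | ⟨h1, h2, -, -⟩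
  · rwa [h1, h2] at hA
  · have hlen := length_prec ((biword' B).erase (0, 0))
    have hle : (pcol ((biword' B).erase (0, 0))).length ≤ p := by
      by_contra hlt
      have hlt := not_le.1 hlt
      have hy := List.getElem?_eq_getElem hlt
      have h3 := hA.2 _ _ hy
      have hy0 : (pcol ((biword' B).erase (0, 0)))[p] = 0 := by
        by_contra hne
        exact h.not_mem (b := (p, p + _)) ⟨le_rfl, by simp⟩ (by simp; omega) h3
      have hp := pcol_pairwise (biword' B)
      rw [h1] at hp
      have := (List.pairwise_append.1 hp).2.2 _ (List.getElem_mem hlt) 0 (by simp)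
      omega
    have hnew : ∀ k, k ≤ p → (k, k) ∈ μ := fun k hk =>
      μ.isLowerSet (show ((k, k) : ℕ × ℕ) ≤ (p, p) from ⟨hk, hk⟩) h.mem
    rw [h1, h2]
    constructor
    · intro k y hy
      rw [List.getElem?_append] at hy
      split_ifs at hy with hk
      · exact hA.1 k y hy
      · obtain ⟨h4, rfl⟩ : k = (prec ((biword' B).erase (0, 0))).length ∧ y = 0 := by
          rw [List.getElem?_singleton] at hy
          split_ifs at hy with h5
          exact ⟨by omega, (Option.some.inj hy).symm⟩
        exact hnew k (by omega)
    · intro k y hy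
      rw [List.getElem?_append] at hy
      split_ifs at hy with hk
      · exact hA.2 k y hy
      · obtain ⟨h4, rfl⟩ : k = (pcol ((biword' B).erase (0, 0))).length ∧ y = 0 := by
          rw [List.getElem?_singleton] at hy
          split_ifs at hy with h5
          exact ⟨by omega, (Option.some.inj hy).symm⟩
        exact hnew k (by omega)

theorem getLast?_of_getElem?_zero {Y : List (ℕ × ℕ)} {p : ℕ} (h : (pcol Y)[p]? = some 0) :
    (pcol Y).getLast? = some 0 := by
  rcases pcol_last_cases Y with ⟨D, hD⟩ | h1
  · rw [hD]; simp
  · have := h1 0 (List.mem_of_getElem? h)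
    omega

/-- First columns longer than `p` would both have a zero at height `p` because of the corner, hence
on top. They would have sign `-`, which by `count_pout` makes the entry at the first position
nonzero. -/
theorem Fits.of_matE_zero_eq_none {μ μ' : YoungDiagram} {p : ℕ} (h : RemovesBox μ μ' p p) {A : Mat}
    (hA : Fits μ A) (hn : matE 0 A = none) : Fits μ' A := by
  change (if A (0, 0) = 0 then none else some (A - Finsupp.single (0, 0) 1)) = none at hn
  have h0 : A (0, 0) = 0 := by
    by_contra h0
    rw [if_neg h0] at hn
    simp at hn
  have hlen := length_prec (biword' A)
  have hle : (pcol (biword' A)).length ≤ p := by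
    by_contra hlt
    have hlt := not_le.1 hlt
    have hy := List.getElem?_eq_getElem hlt
    have hz := List.getElem?_eq_getElem (show p < (prec (biword' A)).length by omega)
    have hy0 : (pcol (biword' A))[p] = 0 := by
      by_contra hne
      exact h.not_mem (b := (p, p + _)) ⟨le_rfl, by simp⟩ (by simp; omega) (hA.2 _ _ hy)
    have hz0 : (prec (biword' A))[p] = 0 := by
      by_contra hne
      exact h.not_mem (b := (p + _, p)) ⟨by simp, le_rfl⟩ (by simp; omega) (hA.1 _ _ hz)
    rw [hy0] at hy
    rw [hz0] at hz
    have h1 := getLast?_of_getElem?_zero hy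
    rw [← (peel_transposeMat A).1] at hz
    have h2 := getLast?_of_getElem?_zero hz
    rw [(peel_transposeMat A).1] at h2
    have := (count_pout (biword'_sorted A)).1 ⟨h2, h1⟩
    rw [count_biword', h0] at this
    omega
  refine ⟨fun k y hy => (h.mem_iff _).2 ⟨hA.1 k y hy, ?_⟩,
    fun k y hy => (h.mem_iff _).2 ⟨hA.2 k y hy, ?_⟩⟩
  · have := (List.getElem?_eq_some_iff.1 hy).1
    simp only [Ne, Prod.mk.injEq]; omega
  · have := (List.getElem?_eq_some_iff.1 hy).1
    simp only [Ne, Prod.mk.injEq]; omega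

theorem Fits.of_matF {μ μ' : YoungDiagram} {p q : ℕ} (h : RemovesBox μ μ' p q) {i : ℤ}
    (hi : (q : ℤ) - p = i) {A B : Mat} (hA : Fits μ A) (hB : matF i A = some B) : Fits μ B := by
  rcases i with (_ | c) | c
  · obtain rfl : q = p := by simp at hi; omega
    exact hA.matF_zero h hB
  · obtain rfl : q = p + (c + 1) := by simp at hi; omega
    exact hA.matF_pos h hB
  · obtain rfl : p = q + (c + 1) := by
      rw [Int.negSucc_eq] at hi; omega
    rw [matF_negSucc, map_transposeMat_eq_some] at hB
    rw [← fits_transpose] at hA ⊢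
    exact hA.matF_pos h.transpose hB

theorem Fits.of_matE_eq_none {μ μ' : YoungDiagram} {p q : ℕ} (h : RemovesBox μ μ' p q) {i : ℤ}
    (hi : (q : ℤ) - p = i) {A : Mat} (hA : Fits μ A) (hn : matE i A = none) :
    Fits μ' A := by
  rcases i with (_ | c) | c
  · obtain rfl : q = p := by simp at hi; omega
    exact hA.of_matE_zero_eq_none h hn
  · obtain rfl : q = p + (c + 1) := by simp at hi; omega
    exact hA.of_matE_pos_eq_none h hn
  · obtain rfl : p = q + (c + 1) := by
      rw [Int.negSucc_eq] at hi; omega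
    rw [matE_negSucc, Option.map_eq_none_iff] at hn
    rw [← fits_transpose] at hA ⊢
    exact hA.of_matE_pos_eq_none h.transpose hn

/-- Raising in the colour `i` stays among matrices that fit `μ` and ends at one that fits `μ'`;
lowering back never leaves the set. Termination is by `matWeight`. -/
theorem fits_iff_exists_iterate {μ μ' : YoungDiagram} {p q : ℕ} (h : RemovesBox μ μ' p q) {i : ℤ}
    (hi : (q : ℤ) - p = i) {B : Mat} : Fits μ B ↔ ∃ A, Fits μ' A ∧
      ∃ m : ℕ, (fun o : Option Mat => o.bind (matF i))^[m] (some A) = some B := by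
  constructor
  · induction hn : matWeight B using Nat.strong_induction_on generalizing B with
    | _ n ih =>
      intro hB
      cases he : matE i B with
      | none => exact ⟨B, hB.of_matE_eq_none h hi he, 0, rfl⟩
      | some B' =>
        obtain ⟨A, hA, m, hm⟩ := ih _ (hn ▸ matWeight_lt_of_matE he) rfl (hB.of_matE he)
        refine ⟨A, hA, m + 1, ?_⟩
        rw [Function.iterate_succ_apply', hm]
        exact matE_eq_some_iff_matF.1 he
  · rintro ⟨A, hA, m, hm⟩
    induction m generalizing B with
    | zero =>
      obtain rfl := Option.some.inj hm
      exact ⟨fun k y hy => ((h.mem_iff _).1 (hA.1 k y hy)).1,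
        fun k y hy => ((h.mem_iff _).1 (hA.2 k y hy)).1⟩
    | succ m ih =>
      rw [Function.iterate_succ_apply', Option.bind_eq_some_iff] at hm
      obtain ⟨B', hB', hB⟩ := hm
      exact (ih hB').of_matF h hi hB

/-- The first letter of the expression removes a corner box of its own content and leaves a reduced
expression of the smaller element, so `fits_iff_exists_iterate` is exactly the induction step. -/
theorem demazure_eq {w : Equiv.Perm NZ} (hw : w ∈ minReps) {l : List ℤ} (hl : IsReducedExpr l w) :
    demazure l = boundedMats w := by
  induction l generalizing w with
  | nil =>
    obtain rfl : 1 = w := hl.1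
    ext A
    rw [mem_boundedMats]
    simp only [demazure, Set.mem_singleton_iff]
    have hempty : ∀ b, b ∉ shape 1 := by
      rintro ⟨p, q⟩ hb
      rw [mem_shape (grassmannian_of_mem hw), map_one, Equiv.Perm.one_apply,
        Equiv.Perm.one_apply] at hb
      omega
    constructor
    · rintro rfl
      rw [Fits, biword'_eq_nil.2 rfl]
      simp [prec, pcol, peel]
    · intro hA
      rw [← biword'_eq_nil]
      by_contra hne
      have hpos := List.length_pos_iff.2 (pcol_ne_nil hne)
      exact hempty _ (hA.2 0 _ (List.getElem?_eq_getElem hpos))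
  | cons i l ih =>
    obtain ⟨h1, p, q, h2, h3⟩ := exists_box_of_reduced hw hl
    obtain ⟨r1, -, r3, r4, r5⟩ := remove_box hw h2 h3
    ext B
    rw [mem_boundedMats, fits_iff_exists_iterate ⟨r3, r4⟩ r5]
    simp only [demazure, Set.mem_ofPred_eq, ih r1 h1, mem_boundedMats]

/-! ## Complete symmetric functions of an interval of variables -/

section CompleteSymmetric

variable {R : Type*} [CommRing R]

/-- The complete symmetric function of degree `k` in `x m, …, x (n - 1)`. -/
noncomputable def hComp (x : ℕ → R) (m n : ℕ) (k : ℤ) : R :=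
  if k < 0 then 0 else ∑ σ ∈ (Finset.Ico m n).sym k.toNat, ((σ : Multiset ℕ).map x).prod

theorem hComp_of_neg (x : ℕ → R) (m n : ℕ) {k : ℤ} (h : k < 0) : hComp x m n k = 0 := if_pos h

theorem hComp_natCast (x : ℕ → R) (m n k : ℕ) :
    hComp x m n k = ∑ σ ∈ (Finset.Ico m n).sym k, ((σ : Multiset ℕ).map x).prod := by
  rw [hComp, if_neg (by omega), Int.toNat_natCast]

theorem hComp_zero (x : ℕ → R) (m n : ℕ) : hComp x m n 0 = 1 := by
  have := hComp_natCast x m n 0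
  rw [Nat.cast_zero] at this
  rw [this, Finset.sym_zero, Finset.sum_singleton]
  rfl

theorem hComp_of_le (x : ℕ → R) {m n : ℕ} (h : n ≤ m) (k : ℤ) :
    hComp x m n k = if k = 0 then 1 else 0 := by
  split_ifs with hk
  · rw [hk, hComp_zero]
  · rcases lt_or_ge k 0 with h0 | h0
    · exact hComp_of_neg x m n h0
    · obtain ⟨j, rfl⟩ : ∃ j : ℕ, k = (j + 1 : ℕ) := ⟨k.toNat - 1, by omega⟩
      rw [hComp_natCast, Finset.Ico_eq_empty (by omega), Finset.sym_empty, Finset.sum_empty]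

theorem sum_sym_insert (x : ℕ → R) {s : Finset ℕ} {a : ℕ} (ha : a ∉ s) (k : ℕ) :
    ∑ σ ∈ (insert a s).sym (k + 1), ((σ : Multiset ℕ).map x).prod =
      ∑ σ ∈ s.sym (k + 1), ((σ : Multiset ℕ).map x).prod +
        x a * ∑ σ ∈ (insert a s).sym k, ((σ : Multiset ℕ).map x).prod := by
  classical
  rw [← Finset.sum_filter_add_sum_filter_not _ (fun σ => a ∉ σ)]
  congr 1
  · refine Finset.sum_congr ?_ fun _ _ => rfl
    ext σ
    simp only [Finset.mem_filter, Finset.mem_sym_iff, Finset.mem_insert]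
    constructor
    · rintro ⟨h1, h2⟩ b hb
      rcases h1 b hb with rfl | h
      · exact absurd hb h2
      · exact h
    · exact fun h => ⟨fun b hb => Or.inr (h b hb), fun h' => ha (h a h')⟩
  · rw [Finset.mul_sum]
    have himg : ((insert a s).sym (k + 1)).filter (fun σ => ¬ a ∉ σ) =
        ((insert a s).sym k).image fun σ => a ::ₛ σ := by
      ext σ
      simp only [Finset.mem_filter, Finset.mem_sym_iff, not_not, Finset.mem_image]
      constructor
      · rintro ⟨h1, h2⟩
        obtain ⟨τ, rfl⟩ := Sym.exists_cons_of_mem h2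
        exact ⟨τ, fun b hb => h1 b (Sym.mem_cons_of_mem hb), rfl⟩
      · rintro ⟨τ, h1, rfl⟩
        refine ⟨fun b hb => ?_, Sym.mem_cons_self _ _⟩
        rcases Sym.mem_cons.1 hb with rfl | hb
        · simp
        · exact h1 b hb
    rw [himg, Finset.sum_image fun _ _ _ _ h => (Sym.cons_inj_right _ _ _).1 h]
    refine Finset.sum_congr rfl fun σ _ => ?_
    rw [Sym.coe_cons, Multiset.map_cons, Multiset.prod_cons]

theorem hComp_eq_add (x : ℕ → R) {m n : ℕ} (h : m < n) (k : ℤ) :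
    hComp x m n k = hComp x (m + 1) n k + x m * hComp x m n (k - 1) := by
  rcases lt_trichotomy k 0 with h0 | rfl | h0
  · rw [hComp_of_neg _ _ _ h0, hComp_of_neg _ _ _ h0, hComp_of_neg _ _ _ (by omega)]; simp
  · rw [hComp_zero, hComp_zero, hComp_of_neg _ _ _ (by omega)]; simp
  · obtain ⟨j, rfl⟩ : ∃ j : ℕ, k = (j + 1 : ℕ) := ⟨k.toNat - 1, by omega⟩
    have hs := sum_sym_insert x (s := Finset.Ico (m + 1) n) (a := m) (by simp) j
    rw [Finset.insert_Ico_add_one_left_eq_Ico h] at hs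
    rw [show ((j + 1 : ℕ) : ℤ) - 1 = j by push_cast; ring, hComp_natCast, hComp_natCast,
      hComp_natCast, hs]

/-- `hComp_eq_add` telescopes: the left side collects the monomials in which the first variable has
exponent below `e`. -/
theorem hComp_sub_eq_sum (x : ℕ → R) {m n : ℕ} (h : m < n) (k : ℤ) (e : ℕ) :
    hComp x m n k - x m ^ e * hComp x m n (k - e) =
      ∑ r ∈ Finset.range e, x m ^ r * hComp x (m + 1) n (k - r) := by
  induction e with
  | zero => simp
  | succ e ih =>
    rw [Finset.sum_range_succ, ← ih]
    have := hComp_eq_add x h (k - e)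
    rw [show k - (e : ℤ) - 1 = k - (e + 1 : ℕ) by push_cast; ring] at this
    rw [this]
    ring

/-! ## Flagged tableaux as fillings -/

/-- A filling of the diagram with row lengths `ν i` which is weakly decreasing along the rows,
strictly decreasing along the columns, and has entries between `m` and `α i` in row `i`. -/
structure FlagFilling {d : ℕ} (ν α : Fin d → ℕ) (m : ℕ) (t : Fin d → ℕ → ℕ) : Prop where
  zero : ∀ i j, ν i ≤ j → t i j = 0
  row : ∀ i j j', j ≤ j' → j' < ν i → t i j' ≤ t i j
  col : ∀ i i' j, i < i' → j < ν i' → t i' j < t i j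
  le : ∀ i j, j < ν i → m ≤ t i j
  lt : ∀ i j, j < ν i → t i j < α i

/-- The length of the row after row `i`. -/
def nextRow {d : ℕ} (ν : Fin d → ℕ) (i : Fin d) : ℕ :=
  if h : (i : ℕ) + 1 < d then ν ⟨i + 1, h⟩ else 0

theorem nextRow_le {d : ℕ} {ν : Fin d → ℕ} (hν : Antitone ν) (i : Fin d) : nextRow ν i ≤ ν i := by
  unfold nextRow
  split_ifs with h
  · exact hν (Fin.mk_le_mk.2 (by simp) : i ≤ ⟨i + 1, h⟩)
  · exact Nat.zero_le _

theorem le_nextRow {d : ℕ} {ν : Fin d → ℕ} (hν : Antitone ν) {i i' : Fin d} (h : i < i') :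
    ν i' ≤ nextRow ν i := by
  have hi : (i : ℕ) + 1 < d := by have := i'.2; have : (i : ℕ) < i' := h; omega
  rw [nextRow, dif_pos hi]
  exact hν (show (⟨i + 1, hi⟩ : Fin d) ≤ i' from h)

/-- The Jacobi–Trudi matrix in the variables `x m, x (m + 1), …`. -/
noncomputable def jtMatrix (x : ℕ → R) {d : ℕ} (α : Fin d → ℕ) (m : ℕ) (ν : Fin d → ℕ) :
    Matrix (Fin d) (Fin d) R :=
  Matrix.of fun i j => hComp x m (α j) ((ν i : ℤ) - i + j)

/-- Expansion of the Jacobi–Trudi determinant along horizontal strips. -/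
theorem det_jtMatrix_eq_sum (x : ℕ → R) {d : ℕ} {α : Fin d → ℕ} {m : ℕ} (hm : ∀ j, m < α j)
    {ν : Fin d → ℕ} (hν : Antitone ν) : (jtMatrix x α m ν).det =
      ∑ r ∈ Fintype.piFinset fun i => Finset.range (ν i - nextRow ν i + 1),
        (∏ i, x m ^ r i) * (jtMatrix x α (m + 1) fun i => ν i - r i).det := by
  classical
  -- The exponent is chosen so that lowering the degrees of row `i` by `e i` gives those of row `i +
  -- 1`. Subtracting that multiple of the next row is therefore the truncation of
  -- `hComp_sub_eq_sum`, and the matrix `U` performing it is unitriangular.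
  set e : Fin d → ℕ := fun i => ν i - nextRow ν i + 1 with he
  let U : Matrix (Fin d) (Fin d) R := Matrix.of fun i k =>
    if k = i then 1 else if (k : ℕ) = i + 1 then - x m ^ e i else 0
  have hU : U.det = 1 := by
    rw [Matrix.det_of_isUpperTriangular]
    · simp [U]
    · intro i k hik
      have hik : (k : ℕ) < i := hik
      simp only [U, Matrix.of_apply]
      rw [if_neg (by rintro rfl; omega), if_neg (by omega)]
  have hrow : U * jtMatrix x α m ν = Matrix.of fun i => ∑ r ∈ Finset.range (e i),
      x m ^ r • fun j : Fin d => hComp x (m + 1) (α j) ((ν i : ℤ) - i + j - r) := by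
    ext i j
    rw [Matrix.mul_apply, Matrix.of_apply, Finset.sum_apply]
    simp only [Pi.smul_apply, smul_eq_mul]
    rw [← hComp_sub_eq_sum x (hm j)]
    have hsplit : ∀ k, U i k * jtMatrix x α m ν k j =
        (if k = i then jtMatrix x α m ν k j else 0) +
          (if (k : ℕ) = i + 1 then - x m ^ e i * jtMatrix x α m ν k j else 0) := by
      intro k
      simp only [U, Matrix.of_apply]
      split_ifs with h1 h2
      · subst h1; omega
      · simp
      · simp
      · simp
    simp only [hsplit]
    rw [Finset.sum_add_distrib, Finset.sum_ite_eq' Finset.univ i, if_pos (Finset.mem_univ _),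
      sub_eq_add_neg, ← neg_mul]
    congr 1
    have hle := nextRow_le hν i
    by_cases hi : (i : ℕ) + 1 < d
    · have : ∀ k : Fin d, ((k : ℕ) = i + 1) ↔ k = ⟨i + 1, hi⟩ := fun k => by
        rw [Fin.ext_iff]
      simp only [this]
      rw [Finset.sum_ite_eq' Finset.univ, if_pos (Finset.mem_univ _), jtMatrix, Matrix.of_apply]
      congr 2
      have : nextRow ν i = ν ⟨i + 1, hi⟩ := dif_pos hi
      simp only [he]
      push_cast
      omega
    -- The last row has no successor, but there the shifted degree is `j - i - 1`, which is
    -- negative, so nothing needs to be subtracted.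
    · rw [Finset.sum_eq_zero, hComp_of_neg, mul_zero]
      · have : nextRow ν i = 0 := dif_neg hi
        simp only [he]
        have := j.2
        push_cast
        omega
      · intro k _
        rw [if_neg]
        have := k.2
        omega
  have hdet : (jtMatrix x α m ν).det = (U * jtMatrix x α m ν).det := by
    rw [Matrix.det_mul, hU, one_mul]
  rw [hdet, hrow]
  -- Each row is now a sum over `r i`, and multilinearity in the rows expands the determinant over
  -- all horizontal strips.
  have hmulti := (Matrix.detRowAlternating (n := Fin d) (R := R)).toMultilinearMap.map_sum_finset
    (fun i (r : ℕ) => x m ^ r • fun j : Fin d => hComp x (m + 1) (α j) ((ν i : ℤ) - i + j - r))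
    (fun i => Finset.range (e i))
  refine hmulti.trans (Finset.sum_congr rfl fun r hr => ?_)
  rw [MultilinearMap.map_smul_univ, smul_eq_mul]
  congr 1
  change Matrix.det _ = _
  congr 1
  ext i j
  rw [jtMatrix, Matrix.of_apply]
  have hr := Fintype.mem_piFinset.1 hr i
  rw [Finset.mem_range] at hr
  congr 1
  omega

/-- Filling of a horizontal strip with the letter `m`: the row `i` is prolonged by `r i` letters. -/
def fillStrip {d : ℕ} (ν : Fin d → ℕ) (m : ℕ) (r : Fin d → ℕ) (t : Fin d → ℕ → ℕ) :
    Fin d → ℕ → ℕ :=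
  fun i j => if ν i - r i ≤ j ∧ j < ν i then m else t i j

/-- In a filling with entries at least `m`, the letters `m` stand at the ends of the rows and form a
horizontal strip; removing them leaves a filling with entries at least `m + 1`. This matches the
expansion of the determinant term by term. -/
theorem exists_flagFilling_succ (x : ℕ → R) {d : ℕ} {α : Fin d → ℕ} {m : ℕ} (hm : ∀ j, m < α j)
    {ν : Fin d → ℕ} (hν : Antitone ν)
    (ih : ∀ ν : Fin d → ℕ, Antitone ν → ∃ s : Finset (Fin d → ℕ → ℕ),
      (∀ t, t ∈ s ↔ FlagFilling ν α (m + 1) t) ∧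
        ∑ t ∈ s, ∏ i, ∏ j ∈ Finset.range (ν i), x (t i j) = (jtMatrix x α (m + 1) ν).det) :
    ∃ s : Finset (Fin d → ℕ → ℕ), (∀ t, t ∈ s ↔ FlagFilling ν α m t) ∧
      ∑ t ∈ s, ∏ i, ∏ j ∈ Finset.range (ν i), x (t i j) = (jtMatrix x α m ν).det := by
  classical
  set A : Finset (Fin d → ℕ) := Fintype.piFinset fun i => Finset.range (ν i - nextRow ν i + 1)
  have hA : ∀ r, r ∈ A ↔ ∀ i, r i ≤ ν i - nextRow ν i := fun r => by
    rw [Fintype.mem_piFinset]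
    simp only [Finset.mem_range, Nat.lt_succ_iff]
  have hle : ∀ r ∈ A, ∀ i i', i < i' → ν i' ≤ ν i - r i := by
    intro r hr i i' hi
    have h1 := (hA r).1 hr i
    have h2 := nextRow_le hν i
    have h3 := le_nextRow hν hi
    omega
  have hanti : ∀ r ∈ A, Antitone fun i => ν i - r i := by
    intro r hr i i' hi
    rcases hi.eq_or_lt with rfl | hi
    · exact le_rfl
    · exact (Nat.sub_le _ _).trans (hle r hr i i' hi)
  have hex : ∀ r : Fin d → ℕ, ∃ s : Finset (Fin d → ℕ → ℕ), r ∈ A →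
      (∀ t, t ∈ s ↔ FlagFilling (fun i => ν i - r i) α (m + 1) t) ∧
        ∑ t ∈ s, ∏ i, ∏ j ∈ Finset.range (ν i - r i), x (t i j) =
          (jtMatrix x α (m + 1) fun i => ν i - r i).det := by
    intro r
    by_cases hr : r ∈ A
    · obtain ⟨s, hs⟩ := ih _ (hanti r hr)
      exact ⟨s, fun _ => hs⟩
    · exact ⟨∅, fun h => absurd h hr⟩
  choose S hS using hex
  refine ⟨(A.sigma fun r => S r).image fun p => fillStrip ν m p.1 p.2, ?_, ?_⟩
  · intro t
    simp only [Finset.mem_image, Finset.mem_sigma]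
    constructor
    · rintro ⟨⟨r, t'⟩, ⟨hr, ht'⟩, rfl⟩
      have hf := ((hS r hr).1 t').1 ht'
      simp only
      refine ⟨?_, ?_, ?_, ?_, ?_⟩
      · intro i j hj
        rw [fillStrip, if_neg (by omega)]
        exact hf.zero i j (by omega)
      · intro i j j' hjj hj'
        unfold fillStrip
        split_ifs with h1 h2 h2
        · exact le_rfl
        · have := hf.le i j (by omega); omega
        · omega
        · exact hf.row i j j' hjj (by omega)
      · intro i i' j hi hj
        have h3 := hle r hr i i' hi
        unfold fillStrip
        split_ifs with h1 h2 h2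
        · omega
        · have := hf.le i j (by omega); omega
        · omega
        · exact hf.col i i' j hi (by omega)
      · intro i j hj
        unfold fillStrip
        split_ifs with h1
        · exact le_rfl
        · have := hf.le i j (by omega); omega
      · intro i j hj
        unfold fillStrip
        split_ifs with h1
        · exact hm i
        · exact hf.lt i j (by omega)
    · intro hf
      -- Rows decrease weakly, so the entries above `m` form an initial segment of length `n i`.
      -- Strictness down the columns gives `nextRow ν i ≤ n i`, which is the strip condition.
      have hn : ∀ i, ∃ n ≤ ν i, ∀ j < ν i, (m < t i j ↔ j < n) := by
        intro i
        have hx : ∃ n, ν i ≤ n ∨ t i n ≤ m := ⟨ν i, Or.inl le_rfl⟩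
        refine ⟨Nat.find hx, Nat.find_min' hx (Or.inl le_rfl), fun j hj => ?_⟩
        rw [Nat.lt_find_iff]
        constructor
        · intro h k hk
          have := hf.row i k j hk hj
          omega
        · intro h
          have := h j le_rfl
          omega
      choose n hn1 hn2 using hn
      have hr : (fun i => ν i - n i) ∈ A := by
        refine (hA _).2 fun i => ?_
        have h1 := hn1 i
        have h2 : nextRow ν i ≤ n i := by
          by_contra hlt
          have h3 := hlt
          unfold nextRow at h3
          split_ifs at h3 with hi
          · have hlt' : n i < ν ⟨i + 1, hi⟩ := by omega
            have h4 := hf.col i ⟨i + 1, hi⟩ (n i) (Fin.mk_lt_mk.2 (by simp)) hlt'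
            have h5 := hf.le ⟨i + 1, hi⟩ (n i) hlt'
            have h6 := nextRow_le hν i
            have := (hn2 i (n i) (by omega)).1 (by omega)
            omega
          · omega
        change ν i - n i ≤ _
        omega
      have hsub : ∀ i, ν i - (ν i - n i) = n i := fun i => by have := hn1 i; omega
      refine ⟨⟨fun i => ν i - n i, fun i j => if j < n i then t i j else 0⟩, ⟨hr, ?_⟩, ?_⟩
      · rw [(hS _ hr).1]
        simp only [hsub]
        refine ⟨?_, ?_, ?_, ?_, ?_⟩
        · intro i j hj
          rw [if_neg (by omega)]
        · intro i j j' hjj hj'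
          rw [if_pos hj', if_pos (by omega)]
          exact hf.row i j j' hjj (by have := hn1 i; omega)
        · intro i i' j hi hj
          have h1 := hle _ hr i i' hi
          simp only [hsub] at h1
          have h2 := hn1 i'
          rw [if_pos hj, if_pos (by omega)]
          exact hf.col i i' j hi (by omega)
        · intro i j hj
          rw [if_pos hj]
          exact (hn2 i j (by have := hn1 i; omega)).2 hj
        · intro i j hj
          rw [if_pos hj]
          exact hf.lt i j (by have := hn1 i; omega)
      · funext i j
        simp only [fillStrip, hsub]
        have h1 := hn1 i
        split_ifs with h2 h3
        · have h4 := hf.le i j h2.2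
          have h5 := hn2 i j h2.2
          omega
        · rfl
        · exact (hf.zero i j (by omega)).symm
  · rw [Finset.sum_image, Finset.sum_sigma, det_jtMatrix_eq_sum x hm hν]
    · refine Finset.sum_congr rfl fun r hr => ?_
      rw [← (hS r hr).2, Finset.mul_sum]
      refine Finset.sum_congr rfl fun t _ => ?_
      rw [← Finset.prod_mul_distrib]
      refine Finset.prod_congr rfl fun i _ => ?_
      change ∏ j ∈ Finset.range (ν i), x (fillStrip ν m r t i j) = _
      have h1 := (hA r).1 hr i
      obtain ⟨n, hn⟩ : ∃ n, ν i = n + r i := ⟨ν i - r i, by omega⟩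
      rw [hn, Nat.add_sub_cancel, Finset.prod_range_add, mul_comm]
      congr 1
      · rw [Finset.prod_congr rfl (g := fun _ => x m), Finset.prod_const, Finset.card_range]
        intro j hj
        rw [Finset.mem_range] at hj
        rw [fillStrip, if_pos (by omega)]
      · refine Finset.prod_congr rfl fun j hj => ?_
        rw [Finset.mem_range] at hj
        rw [fillStrip, if_neg (by omega)]
    · rintro ⟨r, t⟩ h1 ⟨r', t'⟩ h2 heq
      simp only [Finset.mem_coe, Finset.mem_sigma] at h1 h2 heq
      have hf := ((hS r h1.1).1 t).1 h1.2
      have hf' := ((hS r' h2.1).1 t').1 h2.2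
      have hval : ∀ i j, fillStrip ν m r t i j = fillStrip ν m r' t' i j := fun i j => by rw [heq]
      have hrr : r = r' := by
        funext i
        have g1 := (hA r).1 h1.1 i
        have g2 := (hA r').1 h2.1 i
        by_contra hne
        rcases Nat.lt_or_gt_of_ne hne with h | h
        · have := hval i (ν i - r' i)
          rw [fillStrip, fillStrip, if_neg (by omega), if_pos (by omega)] at this
          have := hf.le i (ν i - r' i) (by omega)
          omega
        · have := hval i (ν i - r i)
          rw [fillStrip, fillStrip, if_pos (by omega), if_neg (by omega)] at this
          have := hf'.le i (ν i - r i) (by omega)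
          omega
      subst hrr
      have htt : t = t' := by
        funext i j
        by_cases hj : j < ν i - r i
        · have := hval i j
          rwa [fillStrip, fillStrip, if_neg (by omega), if_neg (by omega)] at this
        · rw [hf.zero i j (by omega), hf'.zero i j (by omega)]
      rw [htt]

/-- The flagged Jacobi–Trudi formula. -/
theorem exists_flagFilling (x : ℕ → R) {d : ℕ} {α : Fin d → ℕ} (hα : Antitone α) (m : ℕ)
    {ν : Fin d → ℕ} (hν : Antitone ν) : ∃ s : Finset (Fin d → ℕ → ℕ),
      (∀ t, t ∈ s ↔ FlagFilling ν α m t) ∧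
        ∑ t ∈ s, ∏ i, ∏ j ∈ Finset.range (ν i), x (t i j) = (jtMatrix x α m ν).det := by
  classical
  induction d generalizing m with
  | zero =>
    refine ⟨{fun i => i.elim0}, fun t => ?_, by simp⟩
    rw [Finset.mem_singleton]
    exact ⟨fun _ => ⟨fun i => i.elim0, fun i => i.elim0, fun i => i.elim0, fun i => i.elim0,
      fun i => i.elim0⟩, fun _ => Subsingleton.elim _ _⟩
  | succ d ihd =>
    induction hk : α (Fin.last d) - m generalizing m ν with
    | succ k ihk =>
      -- The last bound is the smallest, so as long as `m` is below it, the letter `m` is allowed in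
      -- every row.
      refine exists_flagFilling_succ x (fun j => ?_) hν fun ν hν => ihk (m + 1) hν (by omega)
      have := hα (Fin.le_last j)
      omega
    | zero =>
      -- No variable is left for the last column of the matrix, so its entries are `1` in degree
      -- zero and `0` otherwise. If the last row of the shape is empty, expansion along this column
      -- drops that row. If not, the column vanishes, and there is no admissible entry either.
      have hlast : ∀ i, jtMatrix x α m ν i (Fin.last d) =
          if i = Fin.last d ∧ ν (Fin.last d) = 0 then 1 else 0 := by
        intro i
        rw [jtMatrix, Matrix.of_apply, hComp_of_le x (by omega)]
        have h1 := hν (Fin.le_last i)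
        have h2 : (i : ℕ) < d + 1 := i.2
        refine if_congr ?_ rfl rfl
        rw [Fin.val_last]
        constructor
        · intro h
          have h3 : i = Fin.last d := Fin.ext (by rw [Fin.val_last]; omega)
          exact ⟨h3, by omega⟩
        · rintro ⟨rfl, h⟩
          rw [h, Fin.val_last]; omega
      by_cases h0 : ν (Fin.last d) = 0
      · obtain ⟨s, hs1, hs2⟩ := ihd (α := α ∘ Fin.castSucc)
          (hα.comp_monotone (Fin.strictMono_castSucc).monotone) m
          (ν := ν ∘ Fin.castSucc) (hν.comp_monotone (Fin.strictMono_castSucc).monotone)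
        refine ⟨s.image fun t => Fin.snoc (α := fun _ => ℕ → ℕ) t fun _ => 0, fun t => ?_, ?_⟩
        · rw [Finset.mem_image]
          constructor
          · rintro ⟨t, ht, rfl⟩
            have hf := (hs1 t).1 ht
            refine ⟨fun i => ?_, fun i => ?_, fun i i' => ?_, fun i => ?_, fun i => ?_⟩
            · refine Fin.lastCases ?_ (fun i => ?_) i
              · intro j _; simp
              · intro j hj; simpa using hf.zero i j hj
            · refine Fin.lastCases ?_ (fun i => ?_) i
              · intro j j' _ _; simp
              · intro j j' hj hj'; simpa using hf.row i j j' hj hj'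
            · refine Fin.lastCases ?_ (fun i' => ?_) i'
              · intro j _ hj; omega
              · refine Fin.lastCases ?_ (fun i => ?_) i
                · intro j hi; exact absurd hi (Fin.castSucc_lt_last i').not_gt
                · intro j hi hj; simpa using hf.col i i' j (by simpa using hi) hj
            · refine Fin.lastCases ?_ (fun i => ?_) i
              · intro j hj; omega
              · intro j hj; simpa using hf.le i j hj
            · refine Fin.lastCases ?_ (fun i => ?_) i
              · intro j hj; omega
              · intro j hj; simpa using hf.lt i j hj
          · intro hf
            refine ⟨fun i => t i.castSucc, (hs1 _).2 ⟨fun i => hf.zero _, fun i => hf.row _,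
              fun i i' j hi => hf.col _ _ j (by simpa using hi), fun i => hf.le _,
              fun i => hf.lt _⟩, ?_⟩
            funext i
            refine Fin.lastCases ?_ (fun i => ?_) i
            · funext j
              rw [Fin.snoc_last, hf.zero _ j (by omega)]
            · rw [Fin.snoc_castSucc]
        · rw [Finset.sum_image, Matrix.det_succ_column _ (Fin.last d), Finset.sum_eq_single (Fin.last d)]
          · rw [hlast, if_pos ⟨rfl, h0⟩, Even.neg_one_pow ⟨_, rfl⟩, one_mul, one_mul]
            have hsub : (jtMatrix x α m ν).submatrix (Fin.last d).succAbove (Fin.last d).succAbove =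
                jtMatrix x (α ∘ Fin.castSucc) m (ν ∘ Fin.castSucc) := by
              ext i j
              simp [jtMatrix]
            rw [hsub, ← hs2]
            refine Finset.sum_congr rfl fun t _ => ?_
            rw [Fin.prod_univ_castSucc, h0]
            simp
          · intro i _ hi
            rw [hlast, if_neg fun h => hi h.1]; simp
          · simp
          · intro t _ t' _ h
            funext i
            have := congrFun h i.castSucc
            simpa using this
      · refine ⟨∅, fun t => ?_, ?_⟩
        · simp only [Finset.notMem_empty, false_iff]
          intro hf
          have h1 := hf.le (Fin.last d) 0 (by omega)
          have h2 := hf.lt (Fin.last d) 0 (by omega)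
          omega
        · rw [Finset.sum_empty, Matrix.det_eq_zero_of_column_eq_zero (Fin.last d)]
          intro i
          rw [hlast, if_neg fun h => h0 h.2]

end CompleteSymmetric

/-! ## Tableaux and fillings -/

theorem length_getD {ν : YoungDiagram} {T : Tab} (h : IsSST ν T) (j : ℕ) :
    (T.getD j []).length = ν.colLen j := by
  have h1 : (T.getD j []).length = (T.map List.length).getD j 0 := by
    rw [List.getD_eq_getElem?_getD, List.getD_eq_getElem?_getD, List.getElem?_map]
    cases T[j]? <;> simp
  rw [h1, h.1, ← YoungDiagram.rowLen_transpose]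
  by_cases hj : j < ν.transpose.rowLens.length
  · rw [List.getD_eq_getElem _ _ hj, YoungDiagram.get_rowLens]
  · rw [List.getD_eq_default _ _ (by omega)]
    rw [YoungDiagram.length_rowLens] at hj
    by_contra hne
    have h2 : ((j, 0) : ℕ × ℕ) ∈ ν.transpose := by
      rw [YoungDiagram.mem_iff_lt_rowLen]
      exact Nat.pos_of_ne_zero fun h => hne h.symm
    rw [YoungDiagram.mem_iff_lt_colLen] at h2
    exact hj h2

theorem lt_rowLen_iff {ν : YoungDiagram} {i j : ℕ} : j < ν.rowLen i ↔ i < ν.colLen j := by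
  rw [← YoungDiagram.mem_iff_lt_rowLen, YoungDiagram.mem_iff_lt_colLen]

/-- The entries of a tableau as a filling of `d` rows. -/
def fillOf (d : ℕ) (T : Tab) : Fin d → ℕ → ℕ := fun i j => (T.getD j []).getD i 0

/-- The tableau of shape `ν^π` with given entries. -/
def tabOf (ν : YoungDiagram) {d : ℕ} (t : Fin d → ℕ → ℕ) : Tab :=
  (List.range (ν.rowLen 0)).map fun j => (List.range (ν.colLen j)).map fun i =>
    if h : i < d then t ⟨i, h⟩ j else 0

theorem mem_flaggedSST_rev {ν : YoungDiagram} {d : ℕ} {α : Fin d → ℕ} {T : Tab} :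
    T ∈ flaggedSST ν (fun i => α i.rev) ↔ IsSST ν T ∧ ∀ i : Fin d, ∀ col ∈ T, ∀ x : ℕ,
      col[(i : ℕ)]? = some x → x < α i := by
  unfold flaggedSST
  simp only [Set.mem_ofPred_eq, Fin.rev_rev]

section

variable {ν : YoungDiagram} {d : ℕ} {α : Fin d → ℕ}

theorem getElem?_getD_of_lt {T : Tab} (h : IsSST ν T) {i : Fin d} {j : ℕ} (hij : j < ν.rowLen i) :
    (T.getD j [])[(i : ℕ)]? = some (fillOf d T i j) ∧ T.getD j [] ∈ T := by
  have h1 : (i : ℕ) < (T.getD j []).length := by rwa [length_getD h, ← lt_rowLen_iff]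
  refine ⟨?_, ?_⟩
  · rw [fillOf, List.getD_eq_getElem _ _ h1, List.getElem?_eq_getElem h1]
  · by_cases hj : j < T.length
    · rw [List.getD_eq_getElem _ _ hj]; exact List.getElem_mem hj
    · rw [List.getD_eq_default _ _ (by omega)] at h1; simp at h1

theorem flagFilling_fillOf {T : Tab} (hT : T ∈ flaggedSST ν (fun i => α i.rev)) :
    FlagFilling (fun i : Fin d => ν.rowLen i) α 0 (fillOf d T) := by
  obtain ⟨h1, h2⟩ := mem_flaggedSST_rev.1 hT
  have hs := (isSST_iff.1 h1).1
  refine ⟨?_, ?_, ?_, fun i j _ => Nat.zero_le _, ?_⟩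
  · intro i j hj
    rw [fillOf, List.getD_eq_default]
    rw [length_getD h1]
    by_contra hlt
    have := lt_rowLen_iff.2 (not_le.1 hlt)
    omega
  · intro i j j' hjj hj'
    rcases hjj.eq_or_lt with rfl | hjj
    · exact le_rfl
    obtain ⟨g1, g2⟩ := getElem?_getD_of_lt h1 hj'
    obtain ⟨g3, g4⟩ := getElem?_getD_of_lt h1 (hjj.trans hj')
    have hlen : j' < T.length := by
      by_contra hlt
      rw [List.getD_eq_default _ _ (by omega)] at g1; simp at g1
    rw [List.getD_eq_getElem _ _ hlen] at g1
    rw [List.getD_eq_getElem _ _ (by omega)] at g3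
    obtain ⟨y, hy, hxy⟩ := List.pairwise_iff_getElem.1 hs.2 j j' (by omega) hlen hjj i _ g1
    rw [g3] at hy
    rwa [Option.some.inj hy]
  · intro i i' j hi hj
    have hj2 : j < ν.rowLen i := lt_of_lt_of_le hj (ν.rowLen_anti _ _ (le_of_lt hi))
    obtain ⟨g1, g2⟩ := getElem?_getD_of_lt h1 hj
    obtain ⟨g3, g4⟩ := getElem?_getD_of_lt h1 hj2
    obtain ⟨k1, k2⟩ := List.getElem?_eq_some_iff.1 g1
    obtain ⟨k3, k4⟩ := List.getElem?_eq_some_iff.1 g3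
    have := List.pairwise_iff_getElem.1 (hs.1 _ g2).2 i i' k3 k1 hi
    rwa [k2, k4] at this
  · intro i j hj
    obtain ⟨g1, g2⟩ := getElem?_getD_of_lt h1 hj
    exact h2 i _ g2 _ g1

theorem tabOf_fillOf (hν : ν.colLen 0 ≤ d) {T : Tab} (h : IsSST ν T) : tabOf ν (fillOf d T) = T := by
  have hlen : T.length = ν.rowLen 0 := by
    have := congrArg List.length h.1
    rwa [List.length_map, YoungDiagram.length_rowLens, YoungDiagram.colLen_transpose] at this
  apply List.ext_getElem
  · simp [tabOf, hlen]
  intro j hj1 hj2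
  have hc : T[j].length = ν.colLen j := by
    rw [← length_getD h, List.getD_eq_getElem _ _ hj2]
  apply List.ext_getElem
  · simp [tabOf, hc]
  intro i hi1 hi2
  have hi : i < d := by
    have := ν.colLen_anti 0 j (Nat.zero_le _)
    omega
  simp [tabOf, hi, fillOf, hj2, hi2]

theorem fillOf_tabOf {t : Fin d → ℕ → ℕ}
    (ht : ∀ (i : Fin d) j, ν.rowLen i ≤ j → t i j = 0) : fillOf d (tabOf ν t) = t := by
  funext i j
  rw [fillOf, tabOf]
  by_cases hij : j < ν.rowLen i
  · have hj : j < ν.rowLen 0 := lt_of_lt_of_le hij (ν.rowLen_anti _ _ (Nat.zero_le _))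
    have hi := lt_rowLen_iff.1 hij
    simp [hj, hi]
  · rw [ht i j (by omega)]
    by_cases hj : j < ν.rowLen 0
    · have hi : ν.colLen j ≤ i := by
        by_contra hlt
        exact hij (lt_rowLen_iff.2 (not_le.1 hlt))
      simp [hj, hi]
    · simp [hj]

theorem tabOf_mem (hν : ν.colLen 0 ≤ d) {t : Fin d → ℕ → ℕ}
    (ht : FlagFilling (fun i : Fin d => ν.rowLen i) α 0 t) :
    tabOf ν t ∈ flaggedSST ν (fun i => α i.rev) := by
  have hd : ∀ {i j}, i < ν.colLen j → i < d := fun {i j} h => by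
    have := ν.colLen_anti 0 j (Nat.zero_le _)
    omega
  have hget : ∀ {j col}, (tabOf ν t)[j]? = some col → j < ν.rowLen 0 ∧
      col = (List.range (ν.colLen j)).map fun i => if h : i < d then t ⟨i, h⟩ j else 0 := by
    intro j col h
    obtain ⟨h1, h2⟩ := List.getElem?_eq_some_iff.1 h
    simp only [tabOf, List.length_map, List.length_range] at h1
    exact ⟨h1, by rw [← h2]; simp [tabOf]⟩
  have hent : ∀ {j i y}, ((List.range (ν.colLen j)).map
      fun i => if h : i < d then t ⟨i, h⟩ j else 0)[i]? = some y →
      i < ν.colLen j ∧ ∃ h : i < d, y = t ⟨i, h⟩ j := by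
    intro j i y h
    obtain ⟨h1, h2⟩ := List.getElem?_eq_some_iff.1 h
    simp only [List.length_map, List.length_range] at h1
    refine ⟨h1, hd h1, ?_⟩
    rw [← h2]
    simp [hd h1]
  rw [mem_flaggedSST_rev]
  refine ⟨⟨?_, ?_, ?_⟩, ?_⟩
  · apply List.ext_getElem
    · simp [tabOf, YoungDiagram.length_rowLens]
    · intro j hj1 hj2
      rw [YoungDiagram.get_rowLens]
      simp [tabOf]
  · intro c hc
    obtain ⟨j, hj⟩ := List.getElem?_of_mem hc
    obtain ⟨-, rfl⟩ := hget hj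
    rw [List.pairwise_iff_getElem]
    intro i i' hi hi' hii
    simp only [List.length_map, List.length_range] at hi hi'
    simp only [List.getElem_map, List.getElem_range, hd hi, hd hi', dif_pos]
    exact ht.col _ _ j (Fin.mk_lt_mk.2 hii) (lt_rowLen_iff.2 hi')
  · intro i j c c' y y' hc hc' hy hy'
    obtain ⟨-, rfl⟩ := hget hc
    obtain ⟨-, rfl⟩ := hget hc'
    obtain ⟨-, hi, rfl⟩ := hent hy
    obtain ⟨h1, -, rfl⟩ := hent hy'
    exact ht.row _ j (j + 1) (by omega) (lt_rowLen_iff.2 h1)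
  · intro i c hc y hy
    obtain ⟨j, hj⟩ := List.getElem?_of_mem hc
    obtain ⟨-, rfl⟩ := hget hj
    obtain ⟨h1, -, rfl⟩ := hent hy
    exact ht.lt i j (lt_rowLen_iff.2 h1)

end

/-! ### Weights -/

/-- The product of the weights of all entries of a tableau. -/
def tabWt {R : Type*} [CommMonoid R] (x : ℕ → R) (T : Tab) : R :=
  (T.map fun C => (C.map x).prod).prod

theorem prod_map_range {R : Type*} [CommMonoid R] (f : ℕ → R) (n : ℕ) :
    ((List.range n).map f).prod = ∏ i ∈ Finset.range n, f i := rfl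

theorem tabWt_tabOf {R : Type*} [CommMonoid R] (x : ℕ → R) {ν : YoungDiagram} {d : ℕ}
    (hν : ν.colLen 0 ≤ d) (t : Fin d → ℕ → ℕ) :
    tabWt x (tabOf ν t) = ∏ i : Fin d, ∏ j ∈ Finset.range (ν.rowLen i), x (t i j) := by
  have h1 : tabWt x (tabOf ν t) = ∏ j ∈ Finset.range (ν.rowLen 0), ∏ i ∈ Finset.range (ν.colLen j),
      x (if h : i < d then t ⟨i, h⟩ j else 0) := by
    rw [tabWt, tabOf, List.map_map, ← prod_map_range]
    congr 1
    refine List.map_congr_left fun j _ => ?_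
    rw [Function.comp_apply, List.map_map, ← prod_map_range]
    rfl
  have h2 : ∏ i : Fin d, ∏ j ∈ Finset.range (ν.rowLen i), x (t i j) =
      ∏ i ∈ Finset.range d, ∏ j ∈ Finset.range (ν.rowLen i),
        x (if h : i < d then t ⟨i, h⟩ j else 0) := by
    rw [Finset.prod_range]
    refine Finset.prod_congr rfl fun i _ => Finset.prod_congr rfl fun j _ => ?_
    rw [dif_pos i.2]
  rw [h1, h2]
  refine Finset.prod_comm' fun j i => ?_
  simp only [Finset.mem_range, lt_rowLen_iff]
  have h3 := ν.colLen_anti 0 j (Nat.zero_le _)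
  constructor
  · rintro ⟨-, h⟩
    exact ⟨h, by omega⟩
  · rintro ⟨h, -⟩
    exact ⟨by omega, h⟩

/-- The polynomials `ŝ_ν` are the weight generating functions of flagged tableaux. -/
theorem exists_flaggedSST (ι : ℕ → ℕ ⊕ ℕ) {ν : YoungDiagram} {d : ℕ} (hν : ν.colLen 0 ≤ d)
    {α : Fin d → ℕ} (hα : Antitone α) : ∃ s : Finset Tab,
      (∀ T, T ∈ s ↔ T ∈ flaggedSST ν (fun i => α i.rev)) ∧
        ∑ T ∈ s, tabWt (fun i => (MvPolynomial.X (ι i) : MvPolynomial (ℕ ⊕ ℕ) ℤ)) T =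
          hatSchur ι ν α := by
  classical
  obtain ⟨s, hs1, hs2⟩ := exists_flagFilling
    (fun i => (MvPolynomial.X (ι i) : MvPolynomial (ℕ ⊕ ℕ) ℤ)) hα 0
    (ν := fun i : Fin d => ν.rowLen i) (fun i j hij => ν.rowLen_anti _ _ hij)
  refine ⟨s.image (tabOf ν), fun T => ?_, ?_⟩
  · rw [Finset.mem_image]
    constructor
    · rintro ⟨t, ht, rfl⟩
      exact tabOf_mem hν ((hs1 t).1 ht)
    · intro hT
      exact ⟨fillOf d T, (hs1 _).2 (flagFilling_fillOf hT),
        tabOf_fillOf hν (mem_flaggedSST_rev.1 hT).1⟩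
  · rw [Finset.sum_image]
    · simp only [tabWt_tabOf _ hν]
      rw [hs2, hatSchur, jtMatrix]
      congr 2
      funext i j
      rw [completeSymm, hComp]
      refine if_congr Iff.rfl rfl ?_
      rw [MvPolynomial.hsymm, map_sum]
      have : Finset.Ico 0 (α j) = (Finset.univ : Finset (Fin (α j))).map Fin.valEmbedding := by
        ext k
        simp only [Finset.mem_Ico, Finset.mem_map, Finset.mem_univ, true_and, Fin.valEmbedding_apply]
        exact ⟨fun h => ⟨⟨k, h.2⟩, rfl⟩, fun ⟨a, ha⟩ => ha ▸ ⟨Nat.zero_le _, a.2⟩⟩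
      rw [this, Finset.sym_map, Finset.sum_map, Finset.sym_univ]
      refine Finset.sum_congr rfl fun σ _ => ?_
      rw [map_multiset_prod, Multiset.map_map]
      simp [Function.comp_def]
    · intro t ht t' ht' h
      rw [← fillOf_tabOf ((hs1 t).1 ht).zero, h, fillOf_tabOf ((hs1 t').1 ht').zero]

theorem frobLower_antitone (μ : YoungDiagram) : Antitone (frobLower μ) := fun i j hij => by
  have h : (i : ℕ) ≤ j := hij
  have := μ.colLen_anti i j h
  simp only [frobLower]; omega

theorem frobUpper_antitone (μ : YoungDiagram) : Antitone (frobUpper μ) := fun i j hij => by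
  have h : (i : ℕ) ≤ j := hij
  have := μ.rowLen_anti i j h
  simp only [frobUpper]; omega

/-! ### The weight of `κ A` -/

section

variable {R : Type*} [CommMonoid R] (x : ℕ → R)

theorem prod_peel (L : List (ℕ × ℕ)) :
    ((prec L).map x).prod * ((pout L).map fun p => x p.1).prod = (L.map fun p => x p.1).prod ∧
      ((pcol L).map x).prod * ((pout L).map fun p => x p.2).prod = (L.map fun p => x p.2).prod := by
  induction L with
  | nil => simp [prec, pcol, pout, peel]
  | cons p L ih =>
    rw [prec_cons, pcol_cons, pout_cons, List.map_cons, List.map_cons, List.prod_cons,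
      List.prod_cons, ← ih.1, ← ih.2]
    rcases colInsert_cases p.2 (pcol L) with ⟨h1, h2⟩ | ⟨C1, b, C2, h1, h2, h3, h4⟩
    · rw [h2]
      simp only [List.map_append, List.prod_append, List.map_cons, List.prod_cons, Option.toList_none,
        List.map_nil, List.prod_nil, mul_one, List.nil_append]
      constructor <;> simp [mul_comm, mul_assoc]
    · rw [h4, h1]
      constructor <;> simp [mul_left_comm, mul_assoc]

theorem tabWt_recTab_ins (L : List (ℕ × ℕ)) :
    tabWt x (recTab L) = (L.map fun p => x p.1).prod ∧
      tabWt x (ins (L.map Prod.snd)) = (L.map fun p => x p.2).prod := by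
  induction L using ins_map_snd_induction with
  | h0 => simp [tabWt]
  | h1 L hL ih =>
    rw [recTab_of_ne_nil hL, ins_of_ne_nil hL, ← (prod_peel x L).1, ← (prod_peel x L).2, ← ih.1,
      ← ih.2]
    simp [tabWt]

end

/-- The monomial `∏ (x_i y_j)^(a_ij)` of a matrix. -/
noncomputable def matMonomial {R : Type*} [CommMonoid R] (x y : ℕ → R) (A : Mat) : R :=
  A.prod fun p n => (x p.1 * y p.2) ^ n

/-- Insertion only moves letters around: times go to the first tableau and letters to the second, so
the two weights are the row and the column part of the monomial. -/
theorem tabWt_kappa {R : Type*} [CommMonoid R] (x y : ℕ → R) (A : Mat) :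
    tabWt x (kappa A).1 * tabWt y (kappa A).2 = matMonomial x y A := by
  have h : matMonomial x y A = ((biword' A).map fun p => x p.1 * y p.2).prod := by
    rw [← Multiset.prod_coe, ← Multiset.map_coe, coe_biword', Finsupp.toMultiset_map,
      Finsupp.prod_toMultiset, matMonomial, Finsupp.prod_mapDomain_index]
    · intro; simp
    · intro; simp [pow_add]
  rw [h, kappa_eq, (tabWt_recTab_ins x _).1, (tabWt_recTab_ins y _).2, List.prod_map_mul]

/-! ## Generating series -/

/-- The monomial of a matrix as a formal power series. -/
noncomputable def matSeries (A : Mat) : Ser :=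
  matMonomial (fun i => (MvPowerSeries.X (Sum.inl i) : Ser)) (fun j => MvPowerSeries.X (Sum.inr j)) A

/-- The exponent of the monomial of a matrix: the row sums and the column sums. -/
noncomputable def matExponent (A : Mat) : (ℕ ⊕ ℕ) →₀ ℕ :=
  A.sum fun p n => n • (Finsupp.single (Sum.inl p.1) 1 + Finsupp.single (Sum.inr p.2) 1)

theorem matSeries_eq_monomial (A : Mat) :
    matSeries A = MvPowerSeries.monomial (matExponent A) (1 : ℤ) := by
  have hprod : ∀ (s : Finset (ℕ × ℕ)) (f : ℕ × ℕ → (ℕ ⊕ ℕ) →₀ ℕ),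
      ∏ p ∈ s, MvPowerSeries.monomial (f p) (1 : ℤ) =
        MvPowerSeries.monomial (∑ p ∈ s, f p) (1 : ℤ) := by
    intro s f
    classical
    induction s using Finset.induction_on with
    | empty => simp
    | insert p s hp ih =>
      rw [Finset.prod_insert hp, Finset.sum_insert hp, ih, MvPowerSeries.monomial_mul_monomial,
        one_mul]
  rw [matSeries, matMonomial, Finsupp.prod, matExponent, Finsupp.sum, ← hprod]
  refine Finset.prod_congr rfl fun p _ => ?_
  rw [MvPowerSeries.X, MvPowerSeries.X, MvPowerSeries.monomial_mul_monomial, one_mul,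
    MvPowerSeries.monomial_pow, one_pow]

theorem le_matExponent (A : Mat) (p : ℕ × ℕ) :
    A p ≤ matExponent A (Sum.inl p.1) ∧ A p ≤ matExponent A (Sum.inr p.2) := by
  by_cases hp : p ∈ A.support
  · rw [matExponent, Finsupp.sum, Finsupp.finsetSum_apply, Finsupp.finsetSum_apply]
    constructor
    · refine le_trans ?_ (Finset.single_le_sum (fun _ _ => Nat.zero_le _) hp)
      simp
    · refine le_trans ?_ (Finset.single_le_sum (fun _ _ => Nat.zero_le _) hp)
      simp
  · rw [Finsupp.notMem_support_iff.1 hp]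
    exact ⟨Nat.zero_le _, Nat.zero_le _⟩

/-- Row and column sums bound every entry and confine the support to finitely many positions. -/
theorem finite_matExponent_eq (e : (ℕ ⊕ ℕ) →₀ ℕ) : {A : Mat | matExponent A = e}.Finite := by
  refine (Set.finite_Iic (Finsupp.indicator (e.support.toLeft ×ˢ e.support.toRight)
    fun p _ => e (Sum.inl p.1))).subset ?_
  rintro A rfl p
  obtain ⟨h1, h2⟩ := le_matExponent A p
  rw [Finsupp.indicator_apply]
  split_ifs with hp
  · exact h1
  · by_contra hlt
    apply hp
    simp only [Finset.mem_product, Finset.mem_toLeft, Finset.mem_toRight, Finsupp.mem_support_iff]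
    omega

/-- Each coefficient receives contributions from finitely many matrices only. -/
theorem summable_matSeries {ι : Type*} {g : ι → Mat} (hg : Function.Injective g) :
    Summable fun i => matSeries (g i) := by
  rw [MvPowerSeries.WithPiTopology.summable_iff_summable_coeff]
  intro e
  refine summable_of_hasFiniteSupport ?_
  refine ((finite_matExponent_eq e).preimage hg.injOn).subset fun i hi => ?_
  rw [Function.mem_support, matSeries_eq_monomial, MvPowerSeries.coeff_monomial] at hi
  by_contra hne
  exact hi (if_neg fun h => hne h.symm)

theorem matMonomial_add_single {R : Type*} [CommSemiring R] (x y : ℕ → R) (A : Mat) (p : ℕ × ℕ) :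
    matMonomial x y (A + Finsupp.single p 1) = x p.1 * y p.2 * matMonomial x y A := by
  have h : (Finsupp.single p 1 : Mat).prod (fun q n => (x q.1 * y q.2) ^ n) = x p.1 * y p.2 := by
    rw [Finsupp.prod_single_index (h := fun (q : ℕ × ℕ) n => (x q.1 * y q.2) ^ n) (pow_zero _),
      pow_one]
  rw [matMonomial, Finsupp.prod_add_index' (h := fun (q : ℕ × ℕ) n => (x q.1 * y q.2) ^ n)
    (fun _ => pow_zero _) (fun _ _ _ => pow_add _ _ _), h, mul_comm, matMonomial]

theorem matSeries_add_single (A : Mat) (p : ℕ × ℕ) :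
    matSeries (A + Finsupp.single p 1) =
      (MvPowerSeries.X (Sum.inl p.1) * MvPowerSeries.X (Sum.inr p.2)) * matSeries A :=
  matMonomial_add_single _ _ A p

theorem support_add_single (A : Mat) (p : ℕ × ℕ) :
    (A + Finsupp.single p 1).support = insert p A.support := by
  ext q
  simp only [Finsupp.mem_support_iff, Finsupp.add_apply, Finsupp.single_apply, Finset.mem_insert]
  split_ifs with h
  · simp [h]
  · have : q ≠ p := fun h' => h h'.symm
    simp [this]

/-- The matrices of given support. -/
theorem hasSum_support (S : Finset (ℕ × ℕ)) :
    HasSum (fun A : {A : Mat // A.support = S} => matSeries A) (∏ p ∈ S, edgeSeries p) := by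
  classical
  let g : Finset (ℕ × ℕ) → Mat → Ser := fun S A => if A.support = S then matSeries A else 0
  have hg : ∀ S (Q : Ser), HasSum (fun A : {A : Mat // A.support = S} => matSeries A) Q ↔
      HasSum (g S) Q := by
    intro S Q
    rw [← Function.Injective.hasSum_iff (Subtype.val_injective (p := fun A : Mat => A.support = S))
      (f := g S)]
    · have : g S ∘ Subtype.val = fun A : {A : Mat // A.support = S} => matSeries A :=
        funext fun A => if_pos A.2
      rw [this]
    · intro A hA
      exact if_neg fun h => hA ⟨⟨A, h⟩, rfl⟩
  rw [hg]
  induction S using Finset.induction_on with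
  | empty =>
    have h1 : matSeries 0 = 1 := by simp [matSeries, matMonomial]
    have := hasSum_single (f := g ∅) 0 fun A hA => if_neg fun h => hA (Finsupp.support_eq_empty.1 h)
    simpa [g, h1] using this
  | insert p S hp ih =>
    -- With convergence known beforehand, the sum `Q` is found from an equation: lowering the entry
    -- at `p` by one maps the matrices of support `insert p S` bijectively onto those of support `S`
    -- or `insert p S`, so `Q` is `x_i y_j` times the sum of the series for `S` and `Q`.
    obtain ⟨Q, hQ⟩ := summable_matSeries
      (Subtype.val_injective (p := fun A : Mat => A.support = insert p S))
    replace hQ := (hg _ _).1 hQ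
    have hinj : Function.Injective fun A : Mat => A + Finsupp.single p 1 := add_left_injective _
    have h1 := (hinj.hasSum_iff (f := g (insert p S)) (a := Q) (by
      intro A hA
      refine if_neg fun h => hA ⟨A - Finsupp.single p 1, ?_⟩
      refine tsub_add_cancel_of_le (Finsupp.single_le_iff.2 ?_)
      have : p ∈ A.support := by rw [h]; simp
      exact Nat.one_le_iff_ne_zero.2 (Finsupp.mem_support_iff.1 this))).2 hQ
    have h2 := (ih.add hQ).mul_left
      (MvPowerSeries.X (Sum.inl p.1) * MvPowerSeries.X (Sum.inr p.2) : Ser)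
    have h3 : (g (insert p S) ∘ fun A : Mat => A + Finsupp.single p 1) = fun A =>
        (MvPowerSeries.X (Sum.inl p.1) * MvPowerSeries.X (Sum.inr p.2) : Ser) *
          (g S A + g (insert p S) A) := by
      funext A
      simp only [g, Function.comp_apply, support_add_single, matSeries_add_single]
      by_cases hA : p ∈ A.support
      · have h4 : A.support ≠ S := by rintro rfl; exact hp hA
        rw [Finset.insert_eq_of_mem hA, if_neg h4, zero_add]
        split_ifs <;> simp
      · have h4 : A.support ≠ insert p S := fun h => hA (by rw [h]; simp)
        have h5 : insert p A.support = insert p S ↔ A.support = S := by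
          refine ⟨fun h => ?_, fun h => by rw [h]⟩
          rw [← Finset.erase_insert hA, h, Finset.erase_insert hp]
        rw [if_neg h4, add_zero]
        simp only [h5]
        split_ifs <;> simp
    rw [h3] at h1
    have h4 := h1.unique h2
    rw [Finset.prod_insert hp]
    convert hQ using 1
    have h5 : (1 - MvPowerSeries.X (Sum.inl p.1) * MvPowerSeries.X (Sum.inr p.2) : Ser) *
        MvPowerSeries.invOfUnit (1 - MvPowerSeries.X (Sum.inl p.1) * MvPowerSeries.X (Sum.inr p.2)) 1
          = 1 := MvPowerSeries.mul_invOfUnit _ _ (by simp)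
    rw [edgeSeries]
    set z : Ser := MvPowerSeries.X (Sum.inl p.1) * MvPowerSeries.X (Sum.inr p.2)
    set v : Ser := MvPowerSeries.invOfUnit (1 - z) 1
    calc z * v * ∏ q ∈ S, edgeSeries q
        = v * (z * (∏ q ∈ S, edgeSeries q + Q) - z * Q) := by ring
      _ = v * (Q - z * Q) := by rw [← h4]
      _ = (1 - z) * v * Q := by ring
      _ = Q := by rw [h5, one_mul]

theorem map_tabWt {R R' : Type*} [CommSemiring R] [CommSemiring R'] (φ : R →+* R') (x : ℕ → R)
    (T : Tab) : φ (tabWt x T) = tabWt (fun i => φ (x i)) T := by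
  simp [tabWt, map_list_prod, List.map_map, Function.comp_def]

theorem IsSST.shape_unique {ν ν' : YoungDiagram} {T : Tab} (h : IsSST ν T) (h' : IsSST ν' T) :
    ν = ν' := by
  have h1 : ν.transpose.rowLens = ν'.transpose.rowLens := h.1.symm.trans h'.1
  have h2 : ν.transpose = ν'.transpose := by
    rw [← YoungDiagram.ofRowLens_to_rowLens_eq_self (μ := ν.transpose),
      ← YoungDiagram.ofRowLens_to_rowLens_eq_self (μ := ν'.transpose)]
    congr 1
  exact YoungDiagram.transpose_eq_iff.1 h2

/-! ### Two groupings of the sum over all bounded matrices -/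

theorem hasSum_of_fiber {ι κ : Type*} (f : ι → κ) {F : ι → Ser} {G : κ → Ser} {Q : Ser}
    (hF : HasSum F Q) (hG : ∀ k, HasSum (fun a : {a // f a = k} => F a) (G k)) : HasSum G Q :=
  ((Equiv.hasSum_iff (Equiv.sigmaFiberEquiv f)).2 hF).sigma hG

section

variable (w : Equiv.Perm NZ)

/-- Membership in `boundedMats w` depends on the support alone, so the fibre over a dominated
support consists of all matrices with that support. -/
theorem exists_hasSum_supports (hw : w ∈ minReps) {Q : Ser}
    (hQ : HasSum (fun A : boundedMats w => matSeries A) Q) :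
    HasSum (fun S : dominatedSupports w => ∏ p ∈ S.1, edgeSeries p) Q := by
  have hmem : ∀ A : Mat, A.support ∈ dominatedSupports w ↔ A ∈ boundedMats w := fun A =>
    mem_dominatedSupports hw
  refine hasSum_of_fiber (fun A : boundedMats w =>
    (⟨A.1.support, (hmem A).2 A.2⟩ : dominatedSupports w)) hQ fun S => ?_
  have hinj : Function.Injective fun A : {A : boundedMats w //
      (⟨A.1.support, (hmem A).2 A.2⟩ : dominatedSupports w) = S} =>
        (⟨A.1.1, congrArg Subtype.val A.2⟩ : {A : Mat // A.support = S.1}) := fun A B h =>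
    Subtype.ext (Subtype.ext (by simpa using h))
  refine (hinj.hasSum_iff fun A hA => ?_).2 (hasSum_support S.1)
  refine absurd ⟨⟨⟨A.1, ?_⟩, Subtype.ext A.2⟩, rfl⟩ hA
  exact (hmem A.1).1 (A.2.symm ▸ S.2)

/-- By the bijectivity of κ, the fibre over ν corresponds to pairs of flagged tableaux of shape ν.
Both tableau sets are finite, so its sum is a finite product of their generating polynomials. -/
theorem exists_hasSum_shapes {Q : Ser}
    (hQ : HasSum (fun A : boundedMats w => matSeries A) Q) :
    HasSum (fun ν : {ν : YoungDiagram // ν.colLen 0 ≤ diagLen (shape w)} =>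
      ((hatSchur Sum.inl ν.1 (alpha w) * hatSchur Sum.inr ν.1 (beta w) :
        MvPolynomial (ℕ ⊕ ℕ) ℤ) : Ser)) Q := by
  classical
  have hbij := bijOn_kappa w
  have hex : ∀ A : boundedMats w, ∃ ν : {ν : YoungDiagram // ν.colLen 0 ≤ diagLen (shape w)},
      kappa A ∈ flaggedSST ν.1 (phi w) ×ˢ flaggedSST ν.1 (psi w) := by
    intro A
    have := hbij.mapsTo A.2
    simp only [flaggedBitableaux, Set.mem_iUnion, Set.mem_ofPred_eq, exists_prop] at this
    obtain ⟨ν, h1, h2⟩ := this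
    exact ⟨⟨ν, h1⟩, h2⟩
  choose f hf using hex
  refine hasSum_of_fiber f hQ fun ν => ?_
  obtain ⟨s, hs1, hs2⟩ := exists_flaggedSST Sum.inl ν.2 (α := alpha w) (frobLower_antitone _)
  obtain ⟨t, ht1, ht2⟩ := exists_flaggedSST Sum.inr ν.2 (α := beta w) (frobUpper_antitone _)
  let g : Tab × Tab → Ser := fun q => if q ∈ s ×ˢ t then
    tabWt (fun i => (MvPowerSeries.X (Sum.inl i) : Ser)) q.1 *
      tabWt (fun j => (MvPowerSeries.X (Sum.inr j) : Ser)) q.2 else 0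
  have hg : HasSum g (∑ q ∈ s ×ˢ t, g q) := hasSum_sum_of_ne_finset_zero fun q hq => if_neg hq
  have hval : ∑ q ∈ s ×ˢ t, g q = ((hatSchur Sum.inl ν.1 (alpha w) *
      hatSchur Sum.inr ν.1 (beta w) : MvPolynomial (ℕ ⊕ ℕ) ℤ) : Ser) := by
    rw [← hs2, ← ht2, Finset.sum_mul_sum, ← Finset.sum_product',
      ← MvPolynomial.coeToMvPowerSeries.ringHom_apply, map_sum]
    refine Finset.sum_congr rfl fun q hq => ?_
    rw [map_mul, map_tabWt, map_tabWt]
    simp only [MvPolynomial.coeToMvPowerSeries.ringHom_apply, MvPolynomial.coe_X]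
    exact if_pos hq
  rw [hval] at hg
  have hmem : ∀ A : boundedMats w, f A = ν ↔ kappa A ∈ s ×ˢ t := by
    intro A
    rw [Finset.mem_product, hs1, ht1]
    constructor
    · rintro rfl
      exact hf A
    · rintro ⟨h2, -⟩
      exact Subtype.ext ((hf A).1.1.shape_unique h2.1)
  have hinj : Function.Injective fun A : {A : boundedMats w // f A = ν} => kappa A.1.1 :=
    kappa_injective.comp (Subtype.val_injective.comp Subtype.val_injective)
  convert (hinj.hasSum_iff (f := g) ?_).2 hg using 1
  · funext A
    change matSeries A.1.1 = g (kappa A.1.1)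
    rw [matSeries, ← tabWt_kappa]
    exact (if_pos ((hmem A.1).1 A.2)).symm
  · intro q hq
    refine if_neg fun hqs => hq ?_
    obtain ⟨A, hA, rfl⟩ : q ∈ kappa '' boundedMats w := by
      refine hbij.surjOn ?_
      simp only [flaggedBitableaux, Set.mem_iUnion, Set.mem_ofPred_eq, exists_prop]
      rw [Finset.mem_product, hs1, ht1] at hqs
      exact ⟨ν.1, ν.2, hqs⟩
    exact ⟨⟨⟨A, hA⟩, (hmem ⟨A, hA⟩).2 hqs⟩, rfl⟩

end

end FlaggedRSK

theorem mainTheorem6 (w : Equiv.Perm NZ) (hw : w ∈ minReps) :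
    (∀ l : List ℤ, IsReducedExpr l w → demazure l = boundedMats w) ∧
    Set.BijOn kappa (boundedMats w) (flaggedBitableaux (phi w) (psi w)) ∧
    (∀ i : ℤ, ∀ A ∈ boundedMats w,
      (∀ B, matE i A = some B → B ∈ boundedMats w) ∧
      bitabE i (kappa A) = (matE i A).map kappa) ∧
    (Summable fun S : dominatedSupports w => ∏ p ∈ S.1, edgeSeries p) ∧
    (Summable fun ν : {ν : YoungDiagram // ν.colLen 0 ≤ diagLen (shape w)} =>
      ((hatSchur Sum.inl ν.1 (alpha w) * hatSchur Sum.inr ν.1 (beta w) :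
        MvPolynomial (ℕ ⊕ ℕ) ℤ) : Ser)) ∧
    ∑' S : dominatedSupports w, ∏ p ∈ S.1, edgeSeries p =
      ∑' ν : {ν : YoungDiagram // ν.colLen 0 ≤ diagLen (shape w)},
        ((hatSchur Sum.inl ν.1 (alpha w) * hatSchur Sum.inr ν.1 (beta w) :
          MvPolynomial (ℕ ⊕ ℕ) ℤ) : Ser) := by
  -- Both series are compared with the sum of the monomials of all bounded matrices, of which they
  -- are regroupings.
  obtain ⟨Q, hQ⟩ := summable_matSeries (Subtype.val_injective (p := fun A => A ∈ boundedMats w))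
  have h1 := exists_hasSum_supports w hw hQ
  have h2 := exists_hasSum_shapes w hQ
  refine ⟨fun l hl => demazure_eq hw hl, bijOn_kappa w, fun i A hA => ⟨fun B hB => ?_, ?_⟩,
    h1.summable, h2.summable, h1.tsum_eq.trans h2.tsum_eq.symm⟩
  · exact mem_boundedMats.2 ((mem_boundedMats.1 hA).of_matE hB)
  · exact bitabE_kappa i A
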